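/- **Setting.** Let $\Sigma$ be a finite alphabet. A DFA is a finite automaton $(Q,\Sigma,\delta,Q_0,F)$ with $Q\neq\emptyset$, a partial transition function $\delta:Q\times\Sigma\to Q$, at most one initial state and a set $F$ of marked states; the state complexity of a regular language is the least number of states of a DFA marking it. A mask is a map $P:\Sigma\to\Delta\cup\{\varepsilon\}$ ($\Delta$ a finite alphabet), extended to strings by $P(\varepsilon)=\varepsilon$, $P(sa)=P(s)P(a)$. A language $M$ with prefix closure $\overline M$ is observable (with respect to $\Sigma^*$ and $P$) if for all $s,t\in\overline M$ and $a\in\Sigma$ with $P(s)=P(t)$ and $sa\in\overline M$ also $ta\in\overline M$. For $K\subseteq\Sigma^*$ let $\overline{\inf}\,\mathrm O(K,\Sigma^*,P)$ be the least prefix-closed observable language that contains $K$ (the intersection of all of them). **Algorithm 1.** Input: a DFA for $K$ over $\Sigma$ and a mask $P$. If $K=\emptyset$, return the input DFA. Otherwise: (1) compute a DFA for $\overline K$; (2) compute a DFA for $\bigcup_{a\in\Sigma}(\overline K/a)a'$, where $\Sigma'=\{a'\mid a\in\Sigma\}$ is a disjoint copy of $\Sigma$ and $L/a=\{w\mid wa\in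 L\}$, by adding one new state $f$, the only marked one; (3) compute an NFA for $g(h^{-1}h(\bigcup_{a}(\overline K/a)a')\cap\Sigma^*\Sigma')$, where $h(a)=P(a)$, $h(a')=a'$ and $g(a')=a$ for $a\in\Sigma$; (4) determinize this NFA by the subset construction; (5) compute the union with $\{\varepsilon\}$ by adding a new marked initial state; (6) compute the supremal prefix-closed sublanguage by removing all non-marked states. The algorithm is implemented as a fixed program, the same for all inputs, of a unit-cost random-access machine with addition, truncated subtraction, multiplication, bitwise disjunction and comparison of words, in which each literal, register access, array access, operation, assignment, test and loop round takes one step; sets of states are words, and step (4) builds the automaton of all sets of states. **Corollary.** The algorithm is correct and its worst-case time complexity is $\Theta(2^n)$, where $n$ is the state complexity of the input language and the alphabet size is treated as a constant. Precisely: 1. For every DFA with $n\ge 1$ states, marking a language $K$ over $\Sigma$, and every mask $P$, the program returns a DFA that marks $\overline{\inf}\,\mathrm O(K,\Sigma^*,P)$. 2. All words that occur in the computation have at most $n+c$ bits, where $c$ depends only on $|\Sigma|$ and $|\Delta|$. 3. There is a constant $C$, depending only on $|\Sigma|$, such that for every DFA over $\Sigma$ with $n\ge1$ states (in particular for the minimal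 DFA of a language of state complexity $n$) and every mask, the program takes at most $C\cdot 2^n$ steps. 4. If $|\Sigma|\ge 3$, there is a constant $C'>0$, depending only on $|\Sigma|$, such that for every $n\ge1$ there are a mask $P$ and a DFA with $n$ states marking a language $K$ over $\Sigma$ of state complexity $n$, for which the program takes at least $2^n/C'$ steps; moreover, for this input every DFA marking $\overline{\inf}\,\mathrm O(K,\Sigma^*,P)$ has at least $2^n/C'$ states. -/

import Mathlib

namespace InfObs

/-! ## Languages, masks, observability -/

/-- An observation mask from the alphabet `α` to `Δ ∪ {ε}`; the value `none` stands for `ε`. -/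
abbrev Mask (α Δ : Type) : Type := α → Option Δ

/-- The extension of a mask to strings: `P(ε) = ε`, `P(sa) = P(s)P(a)`. -/
def Mask.word {α Δ : Type} (P : Mask α Δ) (w : List α) : List Δ := w.filterMap P

/-- `M` is prefix-closed. -/
def PrefixClosed {α : Type} (M : Language α) : Prop :=
  ∀ u v : List α, u ++ v ∈ M → u ∈ M

/-- The prefix closure of a language. -/
def prefixClosure {α : Type} (M : Language α) : Language α :=
  {u | ∃ v : List α, u ++ v ∈ M}

/-- `M` is observable with respect to the language of all strings and the mask `P`: if two strings
of the prefix closure look alike, then an event that may follow one of them may follow the other. -/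
def Observable {α Δ : Type} (P : Mask α Δ) (M : Language α) : Prop :=
  ∀ (s t : List α) (a : α), s ∈ prefixClosure M → t ∈ prefixClosure M → P.word s = P.word t →
    s ++ [a] ∈ prefixClosure M → t ++ [a] ∈ prefixClosure M

/-- The infimal prefix-closed and observable superlanguage of `K` (with respect to the language of
all strings and the mask `P`): the intersection of all such superlanguages. -/
def infO {α Δ : Type} (P : Mask α Δ) (K : Language α) : Language α :=
  {w | ∀ M : Language α, K ≤ M → PrefixClosed M → Observable P M → w ∈ M}

theorem mem_prefixClosure_iff {α : Type} {M : Language α} (h : PrefixClosed M) (w : List α) :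
    w ∈ prefixClosure M ↔ w ∈ M :=
  ⟨fun ⟨v, hv⟩ => h w v hv, fun hw => ⟨[], by simpa using hw⟩⟩

/-- The infimum is attained: `infO P K` is itself such a superlanguage, hence the least one. -/
theorem infO_isLeast {α Δ : Type} (P : Mask α Δ) (K : Language α) :
    IsLeast {M : Language α | K ≤ M ∧ PrefixClosed M ∧ Observable P M} (infO P K) := by
  have hpc : PrefixClosed (infO P K) :=
    fun u v huv M h1 h2 h3 => h2 u v (huv M h1 h2 h3)
  refine ⟨⟨fun w hw M h1 _ _ => h1 hw, hpc, ?_⟩, fun M hM w hw => hw M hM.1 hM.2.1 hM.2.2⟩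
  intro s t a hs ht hst hsa
  rw [mem_prefixClosure_iff hpc] at hs ht hsa ⊢
  intro M h1 h2 h3
  have := h3 s t a
  simp only [mem_prefixClosure_iff h2] at this
  exact this (hs M h1 h2 h3) (ht M h1 h2 h3) hst (hsa M h1 h2 h3)

/-! ## Deterministic automata -/

/-- An (incomplete) deterministic finite automaton with state set `{0, …, n-1}`: the transition
function is partial and there is at most one initial state. -/
structure PDFA (α : Type) (n : ℕ) where
  step : Fin n → α → Option (Fin n)
  start : Option (Fin n)
  accept : Fin n → Bool

/-- The state reached from the initial state by the string `w`, if there is one. -/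
def PDFA.eval {α : Type} {n : ℕ} (A : PDFA α n) (w : List α) : Option (Fin n) :=
  w.foldl (fun o a => o.bind fun q => A.step q a) A.start

/-- The language marked by `A`. -/
def PDFA.marked {α : Type} {n : ℕ} (A : PDFA α n) : Language α :=
  {w | ∃ q, A.eval w = some q ∧ A.accept q = true}

/-- The state complexity of a (regular) language: the least number of states (at least one) of a
deterministic automaton that marks it. -/
noncomputable def stateComplexity {α : Type} (L : Language α) : ℕ :=
  sInf {n : ℕ | 0 < n ∧ ∃ A : PDFA α n, A.marked = L}

/-! ## The machine model

A unit-cost random-access machine with finitely many registers (indexed by `V`) and finitely many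
unbounded arrays (indexed by `M`), programmed by assignments, conditionals and counting loops.
Every literal, register access, array access, operation, assignment, test and loop round costs one
step.  The bit length of the words that occur is tracked separately, by `Fits`. -/

/-- The word operations; comparisons return `1` (true) or `0` (false). -/
inductive Op where
  | add | sub | mul | lor | lt | eq

def Op.eval : Op → ℕ → ℕ → ℕ
  | .add, a, b => a + b
  | .sub, a, b => a - b
  | .mul, a, b => a * b
  | .lor, a, b => a ||| b
  | .lt, a, b => if a < b then 1 else 0
  | .eq, a, b => if a = b then 1 else 0

/-- The memory of the machine. -/
structure Store (V M : Type) where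
  reg : V → ℕ
  mem : M → ℕ → ℕ

def Store.setReg {V M : Type} [DecidableEq V] (s : Store V M) (x : V) (v : ℕ) : Store V M :=
  { s with reg := fun y => if y = x then v else s.reg y }

def Store.setMem {V M : Type} [DecidableEq M] (s : Store V M) (b : M) (i v : ℕ) : Store V M :=
  { s with mem := fun c j => if c = b ∧ j = i then v else s.mem c j }

/-- Expressions: literals, registers, array cells `b[i]`, and word operations. -/
inductive Expr (V M : Type) where
  | lit (c : ℕ)
  | var (x : V)
  | get (b : M) (i : Expr V M)
  | bin (o : Op) (e₁ e₂ : Expr V M)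

def Expr.eval {V M : Type} (s : Store V M) : Expr V M → ℕ
  | .lit c => c
  | .var x => s.reg x
  | .get b i => s.mem b (i.eval s)
  | .bin o e₁ e₂ => o.eval (e₁.eval s) (e₂.eval s)

/-- The number of steps that the evaluation of an expression takes. -/
def Expr.cost {V M : Type} : Expr V M → ℕ
  | .lit _ => 1
  | .var _ => 1
  | .get _ i => i.cost + 1
  | .bin _ e₁ e₂ => e₁.cost + e₂.cost + 1

/-- All values that occur in the evaluation of an expression are words of `w` bits. -/
def Expr.Fits {V M : Type} (w : ℕ) (s : Store V M) : Expr V M → Prop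
  | .lit c => c < 2 ^ w
  | .var x => s.reg x < 2 ^ w
  | .get b i => i.Fits w s ∧ s.mem b (i.eval s) < 2 ^ w
  | .bin o e₁ e₂ => e₁.Fits w s ∧ e₂.Fits w s ∧ o.eval (e₁.eval s) (e₂.eval s) < 2 ^ w

instance {V M : Type} {c : ℕ} : OfNat (Expr V M) c := ⟨.lit c⟩
instance {V M : Type} : Add (Expr V M) := ⟨.bin .add⟩
instance {V M : Type} : Sub (Expr V M) := ⟨.bin .sub⟩
instance {V M : Type} : Mul (Expr V M) := ⟨.bin .mul⟩

/-- Programs. `set x e` is `x := e`; `put b i e` is `b[i] := e`; `ite e c d` runs `c` if the value of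
`e` is not `0` and `d` otherwise; `loop x e c` evaluates `e` once, to `N`, and then runs `c` with
`x := 0`, `x := 1`, …, `x := N - 1`. -/
inductive Cmd (V M : Type) where
  | skip
  | set (x : V) (e : Expr V M)
  | put (b : M) (i e : Expr V M)
  | seq (c d : Cmd V M)
  | ite (e : Expr V M) (c d : Cmd V M)
  | loop (x : V) (e : Expr V M) (c : Cmd V M)

/-- The memory after the rounds `0, …, N - 1` of a loop with counter `x` and body `f`. -/
def rounds {V M : Type} [DecidableEq V] (x : V) (f : Store V M → Store V M) :
    ℕ → Store V M → Store V M
  | 0, s => s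
  | i + 1, s => f ((rounds x f i s).setReg x i)

/-- The memory after the execution of a program. -/
def Cmd.run {V M : Type} [DecidableEq V] [DecidableEq M] : Cmd V M → Store V M → Store V M
  | .skip, s => s
  | .set x e, s => s.setReg x (e.eval s)
  | .put b i e, s => s.setMem b (i.eval s) (e.eval s)
  | .seq c d, s => d.run (c.run s)
  | .ite e c d, s => if e.eval s ≠ 0 then c.run s else d.run s
  | .loop x e c, s => rounds x c.run (e.eval s) s

/-- The number of steps of the execution of a program. -/
def Cmd.time {V M : Type} [DecidableEq V] [DecidableEq M] : Cmd V M → Store V M → ℕ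
  | .skip, _ => 1
  | .set _ e, _ => e.cost + 1
  | .put _ i e, _ => i.cost + e.cost + 1
  | .seq c d, s => c.time s + d.time (c.run s)
  | .ite e c d, s => e.cost + 1 + if e.eval s ≠ 0 then c.time s else d.time s
  | .loop x e c, s =>
      e.cost + 1 +
        ∑ i ∈ Finset.range (e.eval s), (c.time ((rounds x c.run i s).setReg x i) + 1)

/-- All values that occur in the execution of a program (addresses, operands, results, loop bounds)
are words of `w` bits. -/
def Cmd.Fits {V M : Type} [DecidableEq V] [DecidableEq M] (w : ℕ) :
    Cmd V M → Store V M → Prop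
  | .skip, _ => True
  | .set _ e, s => e.Fits w s
  | .put _ i e, s => i.Fits w s ∧ e.Fits w s
  | .seq c d, s => c.Fits w s ∧ d.Fits w (c.run s)
  | .ite e c d, s => e.Fits w s ∧ if e.eval s ≠ 0 then c.Fits w s else d.Fits w s
  | .loop x e c, s =>
      e.Fits w s ∧ ∀ i < e.eval s, c.Fits w ((rounds x c.run i s).setReg x i)

infixr:60 " ;; " => Cmd.seq

/-! ## The algorithm as a program of the machine -/

/-- The registers. Input: `k` (number of events), `n` (number of states), `start` (initial state).
Output: `outN`, `outStart`. The others are auxiliary. -/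
inductive Reg where
  | k | n | start | outN | outStart
  | detStart | q | r | t | x | y
  deriving DecidableEq

/-- The arrays. Input: `delta`, `acc` (transitions and marked states), `mask`. Output: `outDelta`,
`outAcc`. Auxiliary: `live` (states from which a marked state is reachable), `acc3` (the marked
states of the automaton for the prefix closure), `prime` (the primed transitions), `nfa` and `eps`
(the transitions and the `ε`-transitions of the nondeterministic automaton), `pow` (powers of two),
`clo` (`ε`-closures), `succ` (closed successor sets of single states), `det`, `detAcc` (the
transitions and the marked states of the subset automaton), `num` (the new numbers of the states that are
kept).  Sets of states are words: the state `q` belongs to the set if the bit `q` is `1`. -/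
inductive Arr where
  | delta | acc | mask | outDelta | outAcc
  | live | acc3 | prime | nfa | eps | pow | clo | succ | det | detAcc | num
  deriving DecidableEq

abbrev RExpr : Type := Expr Reg Arr
abbrev Program : Type := Cmd Reg Arr

/-- The value of a register. -/
abbrev rd (v : Reg) : RExpr := .var v
/-- The address of row `q`, column `a` in a table with one row per state, one column per event. -/
abbrev cell (q a : RExpr) : RExpr := q * rd .k + a
/-- The address of a triple (state, event, state) in a table of transitions of the
nondeterministic automaton, which has the states `0, …, n`. -/
abbrev cell3 (q a r : RExpr) : RExpr := cell q a * (rd .n + 1) + r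
/-- A conditional without an alternative. -/
abbrev when (e : RExpr) (c : Program) : Program := .ite e c .skip
/-- The test `e₁ = e₂`. -/
abbrev eqTest (e₁ e₂ : RExpr) : RExpr := .bin .eq e₁ e₂
/-- The test `e₁ < e₂`. -/
abbrev ltTest (e₁ e₂ : RExpr) : RExpr := .bin .lt e₁ e₂
/-- Bitwise disjunction: the union of two sets of states. -/
abbrev union (e₁ e₂ : RExpr) : RExpr := .bin .lor e₁ e₂

/-- Find the states from which a marked state can be reached. -/
def findLive : Program :=
  (.loop .q (rd .n) (.put .live (rd .q) (.get .acc (rd .q)))) ;;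
  (.loop .t (rd .n) <| .loop .q (rd .n) <| .loop .x (rd .k) <|
    when (ltTest 0 (.get .delta (cell (rd .q) (rd .x)))) <|
      when (.get .live (.get .delta (cell (rd .q) (rd .x)) - 1)) <|
        .put .live (rd .q) 1)

/-- Return the input automaton. -/
def returnInput : Program :=
  (.set .outN (rd .n)) ;;
  (.set .outStart (rd .start)) ;;
  (.loop .q (rd .n) <|
    (.put .outAcc (rd .q) (.get .acc (rd .q))) ;;
    (.loop .x (rd .k) <|
      .put .outDelta (cell (rd .q) (rd .x)) (.get .delta (cell (rd .q) (rd .x)))))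

/-- Compute a deterministic automaton for the prefix closure of `K`: mark the live states. -/
def prefixStep : Program :=
  .loop .q (rd .n) (.put .acc3 (rd .q) (.get .live (rd .q)))

/-- Compute a deterministic automaton for the union over all events `a` of the quotients of the
prefix closure by `a`, each followed by `a'`: add a state `f = n`, the only marked one, and the
transition from `q` to `f` under `a'` whenever the `a`-transition of `q` leads to a marked state. -/
def primeStep : Program :=
  .loop .q (rd .n) <| .loop .x (rd .k) <|
    when (ltTest 0 (.get .delta (cell (rd .q) (rd .x)))) <|
      .put .prime (cell (rd .q) (rd .x)) (.get .acc3 (.get .delta (cell (rd .q) (rd .x)) - 1))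

/-- Compute a nondeterministic automaton for `g(h⁻¹(h(·)) ∩ Σ*Σ')`: a transition under an
observable event is copied to all events with the same mask value; a transition under an
unobservable event becomes an `ε`-transition, and all states but `f` get a self-loop under that
event; the transitions under `a'` are renamed to `a`. -/
def nfaStep : Program :=
  .loop .q (rd .n) <| .loop .x (rd .k) <|
    (when (ltTest 0 (.get .delta (cell (rd .q) (rd .x)))) <|
      (.set .r (.get .delta (cell (rd .q) (rd .x)) - 1)) ;;
      (.ite (eqTest (.get .mask (rd .x)) 0)
        (.put .eps (rd .q * (rd .n + 1) + rd .r) 1)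
        (.loop .y (rd .k) <|
          when (eqTest (.get .mask (rd .y)) (.get .mask (rd .x))) <|
            .put .nfa (cell3 (rd .q) (rd .y) (rd .r)) 1))) ;;
    (when (eqTest (.get .mask (rd .x)) 0) <|
      .put .nfa (cell3 (rd .q) (rd .x) (rd .q)) 1) ;;
    (when (.get .prime (cell (rd .q) (rd .x))) <|
      .put .nfa (cell3 (rd .q) (rd .x) (rd .n)) 1)

/-- Determinize: the subset automaton, whose states are all sets of states. The sets are treated in
increasing order; the set with largest element `q` is the word `pow[q] + y` with `y < pow[q]`, and
its successors are those of `y` together with those of `q`. -/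
def determinizeStep : Program :=
  (.put .pow 0 1) ;;
  (.loop .q (rd .n + 1) <|
    .put .pow (rd .q + 1) (.get .pow (rd .q) + .get .pow (rd .q))) ;;
  (.loop .q (rd .n + 1) <| .put .clo (rd .q) (.get .pow (rd .q))) ;;
  (.loop .t (rd .n + 1) <| .loop .q (rd .n + 1) <| .loop .r (rd .n + 1) <|
    when (.get .eps (rd .q * (rd .n + 1) + rd .r)) <|
      .put .clo (rd .q) (union (.get .clo (rd .q)) (.get .clo (rd .r)))) ;;
  (.loop .q (rd .n + 1) <| .loop .x (rd .k) <| .loop .r (rd .n + 1) <|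
    when (.get .nfa (cell3 (rd .q) (rd .x) (rd .r))) <|
      .put .succ (cell (rd .q) (rd .x))
        (union (.get .succ (cell (rd .q) (rd .x))) (.get .clo (rd .r)))) ;;
  (.loop .x (rd .k) <| .put .det (cell 0 (rd .x)) 0) ;;
  (.put .detAcc 0 0) ;;
  (.loop .q (rd .n + 1) <| .loop .y (.get .pow (rd .q)) <|
    (.put .detAcc (.get .pow (rd .q) + rd .y)
      (union (.get .detAcc (rd .y)) (eqTest (rd .q) (rd .n)))) ;;
    (.loop .x (rd .k) <|
      .put .det (cell (.get .pow (rd .q) + rd .y) (rd .x))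
        (union (.get .det (cell (rd .y) (rd .x))) (.get .succ (cell (rd .q) (rd .x)))))) ;;
  (.set .detStart (.get .clo (rd .start - 1)))

/-- Compute the union with `{ε}`: a new marked initial state with the transitions of the old one. -/
def unionStep : Program :=
  (.loop .x (rd .k) <|
    .put .det (cell (.get .pow (rd .n + 1)) (rd .x)) (.get .det (cell (rd .detStart) (rd .x)))) ;;
  (.put .detAcc (.get .pow (rd .n + 1)) 1) ;;
  (.set .detStart (.get .pow (rd .n + 1)))

/-- Compute the supremal prefix-closed sublanguage: remove all states that are not marked, with
their transitions, and number the remaining states. -/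
def supStep : Program :=
  (.set .outN 0) ;;
  (.loop .y (.get .pow (rd .n + 1) + 1) <|
    when (.get .detAcc (rd .y)) <|
      (.set .outN (rd .outN + 1)) ;;
      (.put .num (rd .y) (rd .outN))) ;;
  (.loop .y (.get .pow (rd .n + 1) + 1) <|
    when (.get .detAcc (rd .y)) <|
      (.put .outAcc (.get .num (rd .y) - 1) 1) ;;
      (.loop .x (rd .k) <|
        .put .outDelta (cell (.get .num (rd .y) - 1) (rd .x))
          (.get .num (.get .det (cell (rd .y) (rd .x)))))) ;;
  (.set .outStart (.get .num (rd .detStart)))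

/-- The algorithm. The marked language is nonempty if and only if there is an initial state and it
is live. -/
def algorithm1 : Program :=
  findLive ;;
  .ite (ltTest 0 (rd .start) * .get .live (rd .start - 1))
    (prefixStep ;; primeStep ;; nfaStep ;; determinizeStep ;; unionStep ;; supStep)
    returnInput

/-! ## Input and output -/

/-- The word for a possibly undefined state: `0` for "undefined", `q + 1` for the state `q`. -/
def code {n : ℕ} : Option (Fin n) → ℕ
  | none => 0
  | some q => q + 1

/-- The initial memory for the automaton `A` over `k` events and the mask `P`; all registers and
cells that do not belong to the input are `0`. -/
def inputStore {k n m : ℕ} (A : PDFA (Fin k) n) (P : Mask (Fin k) (Fin m)) : Store Reg Arr where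
  reg
    | .k => k
    | .n => n
    | .start => code A.start
    | _ => 0
  mem
    | .delta, i =>
        if h : i / k < n ∧ i % k < k then code (A.step ⟨i / k, h.1⟩ ⟨i % k, h.2⟩) else 0
    | .acc, i => if h : i < n then (A.accept ⟨i, h⟩).toNat else 0
    | .mask, i => if h : i < k then code (P ⟨i, h⟩) else 0
    | _, _ => 0

/-- The automaton `B` stands in the output registers and arrays of the memory `s`. -/
def IsOutput {k N : ℕ} (s : Store Reg Arr) (B : PDFA (Fin k) N) : Prop :=
  s.reg .outN = N ∧ s.reg .outStart = code B.start ∧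
    ∀ q : Fin N, s.mem .outAcc q = (B.accept q).toNat ∧
      ∀ a : Fin k, s.mem .outDelta (q * k + a) = code (B.step q a)

end InfObs

open InfObs

/-! For nonempty K, a string belongs to the infimum exactly when each of its nonempty prefixes ua is
justified by some u' with P(u') = P(u) and u'a in the prefix closure of K. The strings with this
property form a prefix-closed observable language that contains K, because the justification depends
on u only through P(u); and induction on the length shows that every prefix-closed observable
superlanguage of K contains them (`mem_infO_iff`).

The subset automaton decides this property. After reading w, its set contains, among the input
states, those that the input automaton reaches by look-alikes of w (`sets_iff`), and for nonempty w
it contains f exactly when the last event of w is justified (`sets_testBit_top_iff`). Discarding the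
sets without f therefore leaves the strings all of whose nonempty prefixes are justified
(`good_iff`); the new initial state takes care of the empty string. If K is empty, the input is
already an answer (`infO_empty`).

That the program computes these tables is shown in a Hoare logic: `Runs` bundles postcondition, time
bound and word length, so that one analysis of each step serves three claims, and `Frame` supplies
what a step leaves unchanged. The two reachability computations relax a table in place and stop
after as many rounds as there are states, which is enough by `within_of_reflTransGen`. The steps
that do not enumerate sets take polynomial time. Those that do spend, on each set, a number of
operations depending only on the alphabet, since the row of a set is one union away from the row of
the set without its largest element. This gives O(2^n) without a factor n (`algorithm1_runs_width`).

For the lower bound, the states reached by look-alikes are pictured as tokens on a ring. Rotation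
shifts all tokens, and the look-alike loop at 0 leaves a copy of the token there; the event `drop`
shifts all tokens but deletes the one at 0. By choosing between the two events, any set of tokens on
the states 1, ..., n - 1 can be written (`reach_code`), and later read bit by bit with `drop` and
`test` (`code_test_mem_infO_iff`). So 2^(n-1) strings are pairwise inequivalent (`two_pow_le`). The
running time is at least the size of the output, because the state counter grows by at most one in
each round of a loop (`algorithm1_outN_le_time`). -/

namespace InfObs

/-! ## Reasoning about programs -/

section Machine

variable {V M : Type}

/-- The expression `e` evaluates to `v`, and all values that occur are words of `w` bits. -/
def Expr.Val (w : ℕ) (s : Store V M) (e : Expr V M) (v : ℕ) : Prop :=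
  e.Fits w s ∧ e.eval s = v

namespace Expr.Val

variable {w : ℕ} {s : Store V M} {e e₁ e₂ : Expr V M} {v v₁ v₂ : ℕ}

theorem zero : Val w s (0 : Expr V M) 0 := ⟨Nat.two_pow_pos w, rfl⟩

theorem one (h : 1 < 2 ^ w) : Val w s (1 : Expr V M) 1 := ⟨h, rfl⟩

theorem var {x : V} (hv : s.reg x = v) (h : v < 2 ^ w) : Val w s (.var x) v :=
  ⟨by subst hv; exact h, hv⟩

theorem get {b : M} {a : ℕ} (hi : Val w s e a) (hv : s.mem b a = v) (h : v < 2 ^ w) :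
    Val w s (.get b e) v := by
  obtain ⟨h1, rfl⟩ := hi
  subst hv
  exact ⟨⟨h1, h⟩, rfl⟩

theorem add (h₁ : Val w s e₁ v₁) (h₂ : Val w s e₂ v₂) (h : v₁ + v₂ < 2 ^ w) :
    Val w s (e₁ + e₂) (v₁ + v₂) := by
  obtain ⟨h1, rfl⟩ := h₁
  obtain ⟨h2, rfl⟩ := h₂
  exact ⟨⟨h1, h2, h⟩, rfl⟩

theorem mul (h₁ : Val w s e₁ v₁) (h₂ : Val w s e₂ v₂) (h : v₁ * v₂ < 2 ^ w) :
    Val w s (e₁ * e₂) (v₁ * v₂) := by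
  obtain ⟨h1, rfl⟩ := h₁
  obtain ⟨h2, rfl⟩ := h₂
  exact ⟨⟨h1, h2, h⟩, rfl⟩

theorem fits_lt : ∀ {e : Expr V M}, e.Fits w s → e.eval s < 2 ^ w
  | .lit _, h => h
  | .var _, h => h
  | .get _ _, h => h.2
  | .bin _ _ _, h => h.2.2

theorem lt (h : Val w s e v) : v < 2 ^ w := h.2 ▸ fits_lt h.1

/-- Truncated subtraction cannot lengthen a word, so unlike `add` and `mul` it needs no bound on the
result; the same is true of `lor`. -/
theorem sub (h₁ : Val w s e₁ v₁) (h₂ : Val w s e₂ v₂) : Val w s (e₁ - e₂) (v₁ - v₂) := by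
  have h := h₁.lt
  obtain ⟨h1, rfl⟩ := h₁
  obtain ⟨h2, rfl⟩ := h₂
  exact ⟨⟨h1, h2, (Nat.sub_le _ _).trans_lt h⟩, rfl⟩

theorem lor (h₁ : Val w s e₁ v₁) (h₂ : Val w s e₂ v₂) :
    Val w s (.bin .lor e₁ e₂) (v₁ ||| v₂) := by
  have h := Nat.or_lt_two_pow h₁.lt h₂.lt
  obtain ⟨h1, rfl⟩ := h₁
  obtain ⟨h2, rfl⟩ := h₂
  exact ⟨⟨h1, h2, h⟩, rfl⟩

theorem ltTest (h₁ : Val w s e₁ v₁) (h₂ : Val w s e₂ v₂) (h : 1 < 2 ^ w) :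
    Val w s (.bin .lt e₁ e₂) (if v₁ < v₂ then 1 else 0) := by
  obtain ⟨h1, rfl⟩ := h₁
  obtain ⟨h2, rfl⟩ := h₂
  refine ⟨⟨h1, h2, ?_⟩, rfl⟩
  simp only [Op.eval]
  split <;> omega

theorem eqTest (h₁ : Val w s e₁ v₁) (h₂ : Val w s e₂ v₂) (h : 1 < 2 ^ w) :
    Val w s (.bin .eq e₁ e₂) (if v₁ = v₂ then 1 else 0) := by
  obtain ⟨h1, rfl⟩ := h₁
  obtain ⟨h2, rfl⟩ := h₂
  refine ⟨⟨h1, h2, ?_⟩, rfl⟩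
  simp only [Op.eval]
  split <;> omega

end Expr.Val

namespace Expr

variable (x : V) (b : M) (o : Op) (e e₁ e₂ : Expr V M)

@[simp] theorem cost_zero : (0 : Expr V M).cost = 1 := rfl
@[simp] theorem cost_one : (1 : Expr V M).cost = 1 := rfl
@[simp] theorem cost_var : (var x : Expr V M).cost = 1 := rfl
@[simp] theorem cost_get : (get b e).cost = e.cost + 1 := rfl
@[simp] theorem cost_bin : (bin o e₁ e₂).cost = e₁.cost + e₂.cost + 1 := rfl
@[simp] theorem cost_add : (e₁ + e₂).cost = e₁.cost + e₂.cost + 1 := rfl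
@[simp] theorem cost_sub : (e₁ - e₂).cost = e₁.cost + e₂.cost + 1 := rfl
@[simp] theorem cost_mul : (e₁ * e₂).cost = e₁.cost + e₂.cost + 1 := rfl

end Expr

namespace Cmd

/-- The program may assign the register `y`. -/
def writesReg [DecidableEq V] : Cmd V M → V → Bool
  | .skip, _ => false
  | .set x _, y => y = x
  | .put _ _ _, _ => false
  | .seq c d, y => c.writesReg y || d.writesReg y
  | .ite _ c d, y => c.writesReg y || d.writesReg y
  | .loop x _ c, y => decide (y = x) || c.writesReg y

/-- The program may write into the array `b`. -/
def writesMem [DecidableEq M] : Cmd V M → M → Bool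
  | .skip, _ => false
  | .set _ _, _ => false
  | .put a _ _, b => b = a
  | .seq c d, b => c.writesMem b || d.writesMem b
  | .ite _ c d, b => c.writesMem b || d.writesMem b
  | .loop _ _ c, b => c.writesMem b

variable [DecidableEq V] [DecidableEq M]

/-- The memories `s` and `t` agree outside of what the program `c` may write. -/
structure Frame (c : Cmd V M) (s t : Store V M) : Prop where
  reg : ∀ y, c.writesReg y = false → t.reg y = s.reg y
  mem : ∀ b, c.writesMem b = false → t.mem b = s.mem b

theorem Frame.rounds {x : V} {e : Expr V M} {c : Cmd V M}
    (h : ∀ s, Frame c s (c.run s)) (s : Store V M) :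
    ∀ N, Frame (.loop x e c) s (InfObs.rounds x c.run N s)
  | 0 => ⟨fun _ _ => rfl, fun _ _ => rfl⟩
  | N + 1 => by
    have ih := Frame.rounds (x := x) (e := e) h s N
    refine ⟨fun y hy => ?_, fun b hb => ?_⟩
    · have hy' := hy
      simp only [writesReg, Bool.or_eq_false_iff, decide_eq_false_iff_not] at hy'
      rw [InfObs.rounds, (h _).reg y hy'.2, ← ih.reg y hy]
      simp [Store.setReg, hy'.1]
    · rw [InfObs.rounds, (h _).mem b hb, ← ih.mem b hb]
      rfl

/-- The write sets are read off the syntax. For a concrete program they compute, so that the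
invariance of a register or an array is later proved by `rfl`. -/
theorem frame_run (c : Cmd V M) : ∀ s, Frame c s (c.run s) := by
  induction c with
  | skip => exact fun s => ⟨fun _ _ => rfl, fun _ _ => rfl⟩
  | set x e =>
    refine fun s => ⟨fun y hy => ?_, fun _ _ => rfl⟩
    simp only [writesReg, decide_eq_false_iff_not] at hy
    simp [run, Store.setReg, hy]
  | put b i e =>
    refine fun s => ⟨fun _ _ => rfl, fun a ha => ?_⟩
    simp only [writesMem, decide_eq_false_iff_not] at ha
    simp [run, Store.setMem, ha]
  | seq c d hc hd =>
    refine fun s => ⟨fun y hy => ?_, fun b hb => ?_⟩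
    · simp only [writesReg, Bool.or_eq_false_iff] at hy
      rw [run, (hd _).reg y hy.2, (hc s).reg y hy.1]
    · simp only [writesMem, Bool.or_eq_false_iff] at hb
      rw [run, (hd _).mem b hb.2, (hc s).mem b hb.1]
  | ite e c d hc hd =>
    refine fun s => ⟨fun y hy => ?_, fun b hb => ?_⟩
    · simp only [writesReg, Bool.or_eq_false_iff] at hy
      rw [run]
      split
      exacts [(hc s).reg y hy.1, (hd s).reg y hy.2]
    · simp only [writesMem, Bool.or_eq_false_iff] at hb
      rw [run]
      split
      exacts [(hc s).mem b hb.1, (hd s).mem b hb.2]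
  | loop x e c hc => exact fun s => Frame.rounds hc s _

/-- From the memory `s`, the program `c` reaches a memory with the property `Q` in at most `T`
steps, and all values that occur are words of `w` bits. -/
structure Runs (w T : ℕ) (c : Cmd V M) (s : Store V M) (Q : Store V M → Prop) : Prop where
  post : Q (c.run s)
  time_le : c.time s ≤ T
  fits : c.Fits w s

namespace Runs

variable {w T T₁ T₂ : ℕ} {c d : Cmd V M} {s : Store V M} {Q Q₁ : Store V M → Prop}

/-- The frame is handed to the implication between the postconditions, so invariants need not carry
along what the program never writes. -/
theorem mono (h : Runs w T₁ c s Q₁) (hQ : ∀ t, Frame c s t → Q₁ t → Q t) (hT : T₁ ≤ T) :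
    Runs w T c s Q :=
  ⟨hQ _ (frame_run c s) h.post, h.time_le.trans hT, h.fits⟩

theorem conseq (hQ : ∀ t, Frame c s t → Q₁ t → Q t) (h : Runs w T c s Q₁) : Runs w T c s Q :=
  h.mono hQ le_rfl

theorem set {x : V} {e : Expr V M} {v : ℕ} (he : e.Val w s v) (hQ : Q (s.setReg x v)) :
    Runs w (e.cost + 1) (.set x e) s Q := by
  obtain ⟨h1, rfl⟩ := he
  exact ⟨hQ, le_rfl, h1⟩

theorem put {b : M} {i e : Expr V M} {a v : ℕ} (hi : i.Val w s a) (he : e.Val w s v)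
    (hQ : Q (s.setMem b a v)) : Runs w (i.cost + e.cost + 1) (.put b i e) s Q := by
  obtain ⟨h1, rfl⟩ := hi
  obtain ⟨h2, rfl⟩ := he
  exact ⟨hQ, le_rfl, h1, h2⟩

theorem seq (hc : Runs w T₁ c s Q₁) (hd : ∀ t, Frame c s t → Q₁ t → Runs w T₂ d t Q) :
    Runs w (T₁ + T₂) (.seq c d) s Q := by
  have h := hd _ (frame_run c s) hc.post
  exact ⟨h.post, Nat.add_le_add hc.time_le h.time_le, hc.fits, h.fits⟩

/-- The sum of the two branch bounds replaces their maximum; the loss is at most a factor of two,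
and time bounds stay polynomial expressions. -/
theorem ite {e : Expr V M} {v : ℕ} (he : e.Val w s v) (hc : v ≠ 0 → Runs w T₁ c s Q)
    (hd : v = 0 → Runs w T₂ d s Q) : Runs w (e.cost + 1 + (T₁ + T₂)) (.ite e c d) s Q := by
  obtain ⟨h1, rfl⟩ := he
  by_cases h : e.eval s = 0
  · have h' := hd h
    refine ⟨by simpa [run, h] using h'.post, ?_, h1, by simpa [h] using h'.fits⟩
    have := h'.time_le
    simp only [time, h, ne_eq, not_true_eq_false, if_false]
    omega
  · have h' := hc h
    refine ⟨by simpa [run, h] using h'.post, ?_, h1, by simpa [h] using h'.fits⟩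
    have := h'.time_le
    simp only [time, h, ne_eq, not_false_eq_true, if_true]
    omega

/-- Sequences associate to the right, so two leading commands must be regrouped before they can be
treated as one named step. -/
theorem assoc {c' : Cmd V M} (h : Runs w T (.seq (.seq c c') d) s Q) :
    Runs w T (.seq c (.seq c' d)) s Q :=
  ⟨h.post, by simpa only [time, run, Nat.add_assoc] using h.time_le, h.fits.1.1, h.fits.1.2,
    h.fits.2⟩

theorem skip (hQ : Q s) : Runs w 1 (.skip : Cmd V M) s Q := ⟨hQ, le_rfl, trivial⟩

theorem when {e : Expr V M} {v : ℕ} (he : e.Val w s v) (hc : v ≠ 0 → Runs w T c s Q)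
    (hd : v = 0 → Q s) : Runs w (e.cost + 1 + (T + 1)) (.ite e c .skip) s Q :=
  ite he hc fun h => skip (hd h)

/-- The rule for loops with an invariant `I`. -/
theorem loop_sum {x : V} {e : Expr V M} {N : ℕ} {T : ℕ → ℕ} (I : ℕ → Store V M → Prop)
    (he : e.Val w s N) (h0 : I 0 s)
    (hs : ∀ i < N, ∀ t, Frame (.loop x e c) s t → I i t →
      Runs w (T i) c (t.setReg x i) (I (i + 1))) :
    Runs w (e.cost + 1 + ∑ i ∈ Finset.range N, (T i + 1)) (.loop x e c) s (I N) := by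
  obtain ⟨h1, rfl⟩ := he
  -- The frame spans all rounds so far, hence inside the loop the initial memory may still be
  -- consulted for everything that the loop does not write.
  have fr := Frame.rounds (x := x) (e := e) (frame_run c) s
  have hI : ∀ i ≤ e.eval s, I i (rounds x c.run i s) := by
    intro i
    induction i with
    | zero => exact fun _ => h0
    | succ i ih => exact fun hi => (hs i hi _ (fr i) (ih (Nat.le_of_succ_le hi))).post
  have hr := fun i hi => hs i hi _ (fr i) (hI i hi.le)
  refine ⟨hI _ le_rfl, ?_, h1, fun i hi => (hr i hi).fits⟩
  refine Nat.add_le_add_left (Finset.sum_le_sum fun i hi => ?_) _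
  exact Nat.add_le_add_right (hr i (Finset.mem_range.mp hi)).time_le 1

theorem loop {x : V} {e : Expr V M} {N T : ℕ} (I : ℕ → Store V M → Prop)
    (he : e.Val w s N) (h0 : I 0 s)
    (hs : ∀ i < N, ∀ t, Frame (.loop x e c) s t → I i t →
      Runs w T c (t.setReg x i) (I (i + 1))) :
    Runs w (e.cost + 1 + N * (T + 1)) (.loop x e c) s (I N) := by
  simpa using loop_sum (T := fun _ => T) I he h0 hs

end Runs

end Cmd

end Machine

/-! ### Addresses in two-dimensional tables. -/

theorem add_mod_cell {k q x : ℕ} (hx : x < k) : (q * k + x) % k = x := by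
  rw [Nat.add_comm, Nat.add_mul_mod_self_right, Nat.mod_eq_of_lt hx]

theorem add_div_cell {k q x : ℕ} (hx : x < k) : (q * k + x) / k = q := by
  rw [Nat.add_comm, Nat.add_mul_div_right _ _ (by omega), Nat.div_eq_of_lt hx, Nat.zero_add]

theorem cell_lt {k n q x : ℕ} (hq : q < n) (hx : x < k) : q * k + x < n * k := by
  calc q * k + x < q * k + k := by omega
    _ = (q + 1) * k := by ring
    _ ≤ n * k := Nat.mul_le_mul_right k hq

/-! ## Reachability in a bounded number of steps -/

/-- `b` can be reached from `a` by at most `t` steps of the relation `R`. -/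
def Within (R : ℕ → ℕ → Prop) : ℕ → ℕ → ℕ → Prop
  | 0, a, b => a = b
  | t + 1, a, b => a = b ∨ ∃ c, R a c ∧ Within R t c b

theorem Within.refl {R : ℕ → ℕ → Prop} (a : ℕ) : ∀ t, Within R t a a
  | 0 => rfl
  | _ + 1 => .inl rfl

theorem Within.succ {R : ℕ → ℕ → Prop} : ∀ {t a b : ℕ}, Within R t a b → Within R (t + 1) a b
  | 0, _, _, h => .inl h
  | _ + 1, _, _, .inl h => .inl h
  | _ + 1, _, _, .inr ⟨c, hc, h⟩ => .inr ⟨c, hc, h.succ⟩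

theorem Within.mono {R : ℕ → ℕ → Prop} {t u a b : ℕ} (h : Within R t a b) (htu : t ≤ u) :
    Within R u a b := by
  induction htu with
  | refl => exact h
  | step _ ih => exact ih.succ

/-- The sets of points below N that reach b within t steps increase with t, and once two consecutive
ones coincide they stay constant. Since their sizes are bounded by N, they are constant from t = N
on. -/
theorem within_of_reflTransGen {R : ℕ → ℕ → Prop} {N a b : ℕ} (hR : ∀ a b, R a b → a < N)
    (ha : a < N) (h : Relation.ReflTransGen R a b) : Within R N a b := by
  classical
  let X : ℕ → Finset ℕ := fun t => (Finset.range N).filter fun c => Within R t c b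
  have hX : ∀ t, X t ⊆ X (t + 1) := fun t c hc => by
    simp only [X, Finset.mem_filter] at hc ⊢
    exact ⟨hc.1, hc.2.succ⟩
  have key := fun n => Nat.stabilises_of_monotone (f := fun t => (X t).card) (b := N) (n := n)
    (monotone_nat_of_le_succ fun t => Finset.card_le_card (hX t))
    (fun t => (Finset.card_le_card (Finset.filter_subset _ _)).trans (by simp))
    -- Equal cardinalities of nested sets mean equal sets. A path of length t + 2 then has its
    -- second vertex in X (t + 1) = X t, so it can be shortened.
    (fun t ht => by
      have e : X t = X (t + 1) := Finset.eq_of_subset_of_card_le (hX t) ht.ge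
      refine congrArg Finset.card (Finset.Subset.antisymm (hX _) fun c hc => ?_)
      simp only [X, Finset.mem_filter] at hc ⊢
      refine ⟨hc.1, ?_⟩
      rcases hc.2 with h | ⟨d, hd, h⟩
      · exact .inl h
      · refine .inr ⟨d, hd, ?_⟩
        rcases h with rfl | ⟨d', hd', h⟩
        · exact Within.refl _ _
        · have : d ∈ X (t + 1) := by
            simp only [X, Finset.mem_filter, Finset.mem_range]
            exact ⟨hR _ _ hd', .inr ⟨d', hd', h⟩⟩
          rw [← e] at this
          exact (Finset.mem_filter.mp this).2)
  have h' : ∃ t, Within R t a b := by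
    induction h using Relation.ReflTransGen.head_induction_on with
    | refl => exact ⟨0, rfl⟩
    | @head a c hac hcb ih =>
      -- A point c outside the range has no outgoing edge, so the rest of the path is empty and c =
      -- b.
      by_cases hc : c < N
      · obtain ⟨t, ht⟩ := ih hc
        exact ⟨t + 1, .inr ⟨c, hac, ht⟩⟩
      · rcases hcb.cases_head with rfl | ⟨d, hd, _⟩
        · exact ⟨1, .inr ⟨c, hac, rfl⟩⟩
        · exact absurd (hR _ _ hd) hc
  obtain ⟨t, ht⟩ := h'
  have hm : a ∈ X (t + N) := by
    simp only [X, Finset.mem_filter, Finset.mem_range]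
    exact ⟨ha, ht.mono (by omega)⟩
  have hsub : X N ⊆ X (t + N) := monotone_nat_of_le_succ (f := X) hX (by omega)
  rw [← Finset.eq_of_subset_of_card_le hsub (key (t + N) (by omega)).le] at hm
  exact (Finset.mem_filter.mp hm).2

open InfObs.Expr (Val)
open InfObs.Cmd (Runs Frame)

/-! ## The steps of the algorithm -/

theorem setReg_mem {V M : Type} [DecidableEq V] (s : Store V M) (x : V) (v : ℕ) :
    (s.setReg x v).mem = s.mem := rfl

theorem setMem_mem_self {V M : Type} [DecidableEq M] (s : Store V M) (b : M) (i v j : ℕ) :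
    (s.setMem b i v).mem b j = if j = i then v else s.mem b j := by
  simp [Store.setMem]

/-- Words of `w` bits suffice for all addresses and data. -/
structure Room (w k n : ℕ) : Prop where
  poly : (n + 2) * (n + 2) * (k + 1) < 2 ^ w
  exp : (2 ^ (n + 1) + 2) * (k + 1) < 2 ^ w

namespace Room

variable {w k n : ℕ} (h : Room w k n)
include h

theorem small {v : ℕ} (hv : v ≤ n + 2) : v < 2 ^ w := by
  refine lt_of_le_of_lt ?_ h.poly
  nlinarith [Nat.zero_le (n * n), Nat.zero_le (n * k), Nat.zero_le (n * n * k)]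

theorem row {v : ℕ} (hv : v ≤ (n + 1) * k) : v < 2 ^ w := by
  refine lt_of_le_of_lt ?_ h.poly
  nlinarith [Nat.zero_le (n * n), Nat.zero_le (n * k), Nat.zero_le (n * n * k)]

theorem cube {v : ℕ} (hv : v ≤ (n + 1) * k * (n + 1)) : v < 2 ^ w := by
  refine lt_of_le_of_lt ?_ h.poly
  nlinarith [Nat.zero_le (n * n), Nat.zero_le (n * k), Nat.zero_le (n * n * k)]

theorem square {v : ℕ} (hv : v ≤ (n + 1) * (n + 1)) : v < 2 ^ w := by
  refine lt_of_le_of_lt ?_ h.poly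
  nlinarith [Nat.zero_le (n * n), Nat.zero_le (n * k), Nat.zero_le (n * n * k)]

theorem table {v : ℕ} (hv : v ≤ (2 ^ (n + 1) + 1) * k) : v < 2 ^ w := by
  refine lt_of_le_of_lt ?_ h.exp
  rw [Nat.add_mul] at *
  rw [Nat.mul_add]
  omega

theorem set {v : ℕ} (hv : v ≤ 2 ^ (n + 1) + 1) : v < 2 ^ w := by
  refine lt_of_le_of_lt ?_ h.exp
  nlinarith [Nat.zero_le (2 ^ (n + 1) * k)]

theorem col {v : ℕ} (hv : v ≤ k) : v < 2 ^ w :=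
  h.row (hv.trans (by nlinarith [Nat.zero_le (n * k)]))

theorem valK {s : Store Reg Arr} (hk : s.reg .k = k) : Val w s (rd .k) k := .var hk (h.col le_rfl)

theorem valN {s : Store Reg Arr} (hn : s.reg .n = n) : Val w s (rd .n) n :=
  .var hn (h.small (by omega))

theorem valOne {s : Store Reg Arr} : Val w s (1 : RExpr) 1 := .one (h.small (by omega))

theorem valN1 {s : Store Reg Arr} (hn : s.reg .n = n) : Val w s (rd .n + 1) (n + 1) :=
  (h.valN hn).add h.valOne (h.small (by omega))

theorem valCol {s : Store Reg Arr} {v : Reg} {x : ℕ} (hv : s.reg v = x) (hx : x < k) :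
    Val w s (rd v) x := .var hv (h.col hx.le)

theorem valState {s : Store Reg Arr} {v : Reg} {x : ℕ} (hv : s.reg v = x) (hx : x < n + 1) :
    Val w s (rd v) x := .var hv (h.small (by omega))

theorem valCell {s : Store Reg Arr} {e₁ e₂ : RExpr} {q x : ℕ} (hk : s.reg .k = k)
    (h₁ : Val w s e₁ q) (h₂ : Val w s e₂ x) (hq : q < n + 1) (hx : x < k) :
    Val w s (cell e₁ e₂) (q * k + x) := by
  have := cell_lt hq hx
  exact (h₁.mul (h.valK hk) (h.row (by omega))).add h₂ (h.row this.le)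

theorem valCell3 {s : Store Reg Arr} {e₁ e₂ e₃ : RExpr} {q x r : ℕ} (hk : s.reg .k = k)
    (hn : s.reg .n = n) (h₁ : Val w s e₁ q) (h₂ : Val w s e₂ x) (h₃ : Val w s e₃ r)
    (hq : q < n + 1) (hx : x < k) (hr : r < n + 1) :
    Val w s (cell3 e₁ e₂ e₃) ((q * k + x) * (n + 1) + r) := by
  have := cell_lt (cell_lt hq hx) hr
  exact ((h.valCell hk h₁ h₂ hq hx).mul (h.valN1 hn) (h.cube (by omega))).add h₃ (h.cube this.le)

theorem valPair {s : Store Reg Arr} {e₁ e₂ : RExpr} {q r : ℕ}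
    (hn : s.reg .n = n) (h₁ : Val w s e₁ q) (h₂ : Val w s e₂ r) (hq : q < n + 1) (hr : r < n + 1) :
    Val w s (e₁ * (rd .n + 1) + e₂) (q * (n + 1) + r) := by
  have := cell_lt hq hr
  exact (h₁.mul (h.valN1 hn) (h.square (by omega))).add h₂ (h.square this.le)

end Room

/-- There is a transition from `q` to `r`, according to the table `D`. -/
def Edge (k n : ℕ) (D : ℕ → ℕ) (q r : ℕ) : Prop :=
  q < n ∧ ∃ x < k, D (q * k + x) = r + 1

/-- A marked state can be reached from `q`. -/
def Live (k n : ℕ) (D acc : ℕ → ℕ) (q : ℕ) : Prop :=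
  ∃ f < n, acc f ≠ 0 ∧ Relation.ReflTransGen (Edge k n D) q f

/-- In-place relaxation: a round may already profit from marks set in the same round, so the exact
table after τ rounds is not tracked. It is bounded from both sides: every mark is correct, and every
state within τ steps of a marked state has a mark. -/
theorem findLive_runs {w k n : ℕ} (room : Room w k n) {s : Store Reg Arr} (hk : s.reg .k = k)
    (hn : s.reg .n = n) (hD : ∀ j, s.mem .delta j ≤ n) (ha : ∀ j, s.mem .acc j ≤ 1) :
    Runs w (30 * ((n + 1) * (n + 1) * (k + 1))) findLive s fun t =>
      ∀ q < n, t.mem .live q ≤ 1 ∧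
        (t.mem .live q ≠ 0 ↔ Live k n (s.mem .delta) (s.mem .acc) q) := by
  set D := s.mem .delta with hDdef
  set acc := s.mem .acc with hadef
  let P : ℕ → ℕ → Prop := fun τ q => ∃ f < n, acc f ≠ 0 ∧ Within (Edge k n D) τ q f
  -- `S` is soundness and `C τ i` is completeness for the states below i and paths of length at most
  -- τ. Marks are never erased, so `C τ n` survives while `C (τ + 1)` is being built up.
  let S : Store Reg Arr → Prop := fun t => ∀ q < n, t.mem .live q ≤ 1 ∧
    (t.mem .live q ≠ 0 → Live k n D acc q)
  let C : ℕ → ℕ → Store Reg Arr → Prop := fun τ i t => ∀ q < i, P τ q → t.mem .live q ≠ 0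
  apply Runs.mono (Q₁ := fun t => S t ∧ C n n t)
  · apply Runs.seq (Q₁ := fun t => ∀ q < n, t.mem .live q = acc q)
    · apply Runs.loop (fun i t => ∀ q < i, t.mem .live q = acc q) (room.valN hn) (by simp)
      intro i hi t fr hI
      have vq : Val w (t.setReg .q i) (rd .q) i := room.valState rfl (by omega)
      refine Runs.put vq (.get vq (congrFun (fr.mem .acc rfl) i)
          (room.small ((ha i).trans (by omega)))) ?_
      intro q hq
      rw [setMem_mem_self]
      split
      · next e => rw [e]
      · exact hI q (by omega)
    intro t fr h1
    apply Runs.loop (fun τ t => S t ∧ C τ n t) (room.valN ((fr.reg .n rfl).trans hn))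
    · refine ⟨fun q hq => ⟨h1 q hq ▸ ha q, fun h => ⟨q, hq, ?_, .refl⟩⟩, fun q hq => ?_⟩
      · rwa [← h1 q hq]
      · rintro ⟨f, _, hf, rfl⟩
        rwa [h1 q hq]
    intro τ hτ t₁ fr₁ hI
    have hn₁ : t₁.reg .n = n := (fr₁.reg .n rfl).trans ((fr.reg .n rfl).trans hn)
    have hk₁ : t₁.reg .k = k := (fr₁.reg .k rfl).trans ((fr.reg .k rfl).trans hk)
    have hd₁ : t₁.mem .delta = D := (fr₁.mem .delta rfl).trans (fr.mem .delta rfl)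
    apply Runs.conseq (Q₁ := fun t => S t ∧ C τ n t ∧ C (τ + 1) n t)
      (fun t _ h => ⟨h.1, h.2.2⟩)
    apply Runs.loop (fun i t => S t ∧ C τ n t ∧ C (τ + 1) i t)
    · exact room.valN hn₁
    · exact ⟨hI.1, hI.2, fun _ h => absurd h (Nat.not_lt_zero _)⟩
    intro q hq t₂ fr₂ hJ
    have hn₂ : t₂.reg .n = n := (fr₂.reg .n rfl).trans hn₁
    have hk₂ : t₂.reg .k = k := (fr₂.reg .k rfl).trans hk₁
    have hd₂ : t₂.mem .delta = D := (fr₂.mem .delta rfl).trans hd₁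
    -- The events below i have been tried at q: if one of them leads to a state within τ steps of a
    -- marked state, then q has its mark.
    let L : ℕ → Store Reg Arr → Prop := fun i t => S t ∧ C τ n t ∧ C (τ + 1) q t ∧
      ∀ x < i, ∀ r, D (q * k + x) = r + 1 → P τ r → t.mem .live q ≠ 0
    apply Runs.conseq (Q₁ := L k)
    rotate_left
    · apply Runs.loop L
      · exact room.valK hk₂
      · exact ⟨hJ.1, hJ.2.1, hJ.2.2, fun _ h => absurd h (Nat.not_lt_zero _)⟩
      intro x hx t₃ fr₃ hL
      have hk₃ : t₃.reg .k = k := (fr₃.reg .k rfl).trans hk₂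
      have hd₃ : t₃.mem .delta = D := (fr₃.mem .delta rfl).trans hd₂
      have hq₃ : t₃.reg .q = q := fr₃.reg .q rfl
      have vq : Val w (t₃.setReg .x x) (rd .q) q := room.valState hq₃ (by omega)
      have vx : Val w (t₃.setReg .x x) (rd .x) x := room.valCol rfl hx
      have vd : Val w (t₃.setReg .x x) (.get .delta (cell (rd .q) (rd .x))) (D (q * k + x)) :=
        .get (room.valCell hk₃ vq vx (by omega) hx) (congrFun hd₃ _)
          (room.small ((hD _).trans (by omega)))
      apply Runs.when (Expr.Val.zero.ltTest vd (room.small (by omega)))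
      · intro h
        have hpos : 0 < D (q * k + x) := by
          by_contra h'
          simp [h'] at h
        obtain ⟨r, hr⟩ := Nat.exists_eq_succ_of_ne_zero hpos.ne'
        have hrn : r < n := by have := hD (q * k + x); rw [hr] at this; exact this
        have vl : Val w (t₃.setReg .x x) (.get .live (.get .delta (cell (rd .q) (rd .x)) - 1))
            (t₃.mem .live r) := by
          refine .get (vd.sub room.valOne) ?_ (room.small ((hL.1 r hrn).1.trans (by omega)))
          rw [hr]; rfl
        apply Runs.when vl
        · intro h'
          refine Runs.put vq room.valOne ?_
          refine ⟨fun p hp => ?_, fun p hp hP => ?_, fun p hp hP => ?_, fun y _ r' _ _ => ?_⟩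
          · rw [setMem_mem_self]
            split
            · next e =>
              subst e
              obtain ⟨f, hf, hf', hrf⟩ := (hL.1 r hrn).2 h'
              exact ⟨le_rfl, fun _ => ⟨f, hf, hf', .head ⟨hq, x, hx, hr⟩ hrf⟩⟩
            · exact hL.1 p hp
          · rw [setMem_mem_self]
            split
            · exact one_ne_zero
            · exact hL.2.1 p hp hP
          · rw [setMem_mem_self]
            split
            · exact one_ne_zero
            · exact hL.2.2.1 p hp hP
          · simp [setMem_mem_self]
        · intro h'
          refine ⟨hL.1, hL.2.1, hL.2.2.1, fun y hy r' hr' hP => ?_⟩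
          rcases Nat.lt_succ_iff_lt_or_eq.mp hy with hy | rfl
          · exact hL.2.2.2 y hy r' hr' hP
          · obtain rfl : r' = r := by omega
            exact absurd h' (hL.2.1 r' hrn hP)
      · intro h
        have h0 : D (q * k + x) = 0 := by
          by_contra h'
          simp [Nat.pos_of_ne_zero h'] at h
        refine ⟨hL.1, hL.2.1, hL.2.2.1, fun y hy r' hr' hP => ?_⟩
        rcases Nat.lt_succ_iff_lt_or_eq.mp hy with hy | rfl
        · exact hL.2.2.2 y hy r' hr' hP
        · omega
    · intro t _ hL
      refine ⟨hL.1, hL.2.1, fun p hp hP => ?_⟩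
      rcases Nat.lt_succ_iff_lt_or_eq.mp hp with hp | rfl
      · exact hL.2.2.1 p hp hP
      · obtain ⟨f, hf, hf', rfl | ⟨c, ⟨_, x, hx, hc⟩, hw⟩⟩ := hP
        · exact hL.2.1 p hq ⟨p, hf, hf', Within.refl _ _⟩
        · exact hL.2.2.2 x hx c hc ⟨f, hf, hf', hw⟩
  · intro t _ h q hq
    refine ⟨(h.1 q hq).1, (h.1 q hq).2, ?_⟩
    rintro ⟨f, hf, hf', hqf⟩
    exact h.2 q hq ⟨f, hf, hf', within_of_reflTransGen (fun _ _ h => h.1) hq hqf⟩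
  · simp only [Expr.cost_get, Expr.cost_var, Expr.cost_bin, Expr.cost_add, Expr.cost_mul,
      Expr.cost_sub, Expr.cost_zero, Expr.cost_one]
    nlinarith [Nat.zero_le (n * k), Nat.zero_le (n * n * k), Nat.zero_le (n * n)]

theorem returnInput_runs {w k n : ℕ} (room : Room w k n) {s : Store Reg Arr} (hk : s.reg .k = k)
    (hn : s.reg .n = n) (hs : s.reg .start ≤ n) (hD : ∀ j, s.mem .delta j ≤ n)
    (ha : ∀ j, s.mem .acc j ≤ 1) :
    Runs w (30 * ((n + 1) * (k + 1))) returnInput s fun t =>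
      t.reg .outN = n ∧ t.reg .outStart = s.reg .start ∧
        (∀ q < n, t.mem .outAcc q = s.mem .acc q) ∧
        ∀ j < n * k, t.mem .outDelta j = s.mem .delta j := by
  let I : ℕ → ℕ → Store Reg Arr → Prop := fun i j t =>
    t.reg .outN = n ∧ t.reg .outStart = s.reg .start ∧
      (∀ q < i, t.mem .outAcc q = s.mem .acc q) ∧ ∀ j' < j, t.mem .outDelta j' = s.mem .delta j'
  apply Runs.mono (Q₁ := I n (n * k))
  · apply Runs.seq (Q₁ := fun t => t.reg .outN = n)
    · exact Runs.set (room.valN hn) rfl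
    intro t₁ fr₁ h₁
    apply Runs.seq (Q₁ := fun t => t.reg .outN = n ∧ t.reg .outStart = s.reg .start)
    · exact Runs.set (.var (fr₁.reg .start rfl) (room.small (by omega))) ⟨h₁, rfl⟩
    intro t₂ fr₂ h₂
    have hn₂ : t₂.reg .n = n := (fr₂.reg .n rfl).trans ((fr₁.reg .n rfl).trans hn)
    have hk₂ : t₂.reg .k = k := (fr₂.reg .k rfl).trans ((fr₁.reg .k rfl).trans hk)
    have hd₂ : t₂.mem .delta = s.mem .delta := (fr₂.mem .delta rfl).trans (fr₁.mem .delta rfl)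
    have ha₂ : t₂.mem .acc = s.mem .acc := (fr₂.mem .acc rfl).trans (fr₁.mem .acc rfl)
    apply Runs.loop (fun i t => I i (i * k) t) (room.valN hn₂)
    · exact ⟨h₂.1, h₂.2, by simp, by simp⟩
    intro q hq t₃ fr₃ h₃
    have vq : Val w (t₃.setReg .q q) (rd .q) q := room.valState rfl (by omega)
    apply Runs.seq (Q₁ := I (q + 1) (q * k))
    · refine Runs.put vq (.get vq (congrFun ((fr₃.mem .acc rfl).trans ha₂) q)
        (room.small ((ha q).trans (by omega)))) ⟨h₃.1, h₃.2.1, fun p hp => ?_, h₃.2.2.2⟩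
      rw [setMem_mem_self]
      split
      · next e => rw [e]
      · exact h₃.2.2.1 p (by omega)
    intro t₄ fr₄ h₄
    have hk₄ : t₄.reg .k = k := (fr₄.reg .k rfl).trans ((fr₃.reg .k rfl).trans hk₂)
    have hq₄ : t₄.reg .q = q := fr₄.reg .q rfl
    have hd₄ : t₄.mem .delta = s.mem .delta :=
      (fr₄.mem .delta rfl).trans ((fr₃.mem .delta rfl).trans hd₂)
    -- Row q ends where row q + 1 begins. One linear count of the cells thus serves as the invariant
    -- of both nested loops.
    rw [Nat.succ_mul]
    apply Runs.loop (fun x t => I (q + 1) (q * k + x) t) (room.valK hk₄) h₄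
    intro x hx t₅ fr₅ h₅
    have vx : Val w (t₅.setReg .x x) (rd .x) x := room.valCol rfl hx
    have vc : Val w (t₅.setReg .x x) (cell (rd .q) (rd .x)) (q * k + x) :=
      room.valCell ((fr₅.reg .k rfl).trans hk₄)
        (room.valState ((fr₅.reg .q rfl).trans hq₄) (by omega)) vx (by omega) hx
    refine Runs.put vc (.get vc (congrFun ((fr₅.mem .delta rfl).trans hd₄) _)
      (room.small ((hD _).trans (by omega)))) ⟨h₅.1, h₅.2.1, h₅.2.2.1, fun j hj => ?_⟩
    rw [setMem_mem_self]
    split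
    · next e => rw [e]
    · exact h₅.2.2.2 j (by omega)
  · exact fun t _ h => h
  · simp
    nlinarith [Nat.zero_le (n * k)]

theorem prefixStep_runs {w k n : ℕ} (room : Room w k n) {s : Store Reg Arr} (hn : s.reg .n = n)
    (hl : ∀ q < n, s.mem .live q ≤ 1) :
    Runs w (10 * (n + 1)) prefixStep s fun t => ∀ q < n, t.mem .acc3 q = s.mem .live q := by
  apply Runs.mono (Q₁ := fun t => ∀ q < n, t.mem .acc3 q = s.mem .live q)
  · apply Runs.loop (fun i t => ∀ q < i, t.mem .acc3 q = s.mem .live q) (room.valN hn) (by simp)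
    intro q hq t fr h
    have vq : Val w (t.setReg .q q) (rd .q) q := room.valState rfl (by omega)
    refine Runs.put vq (.get vq (congrFun (fr.mem .live rfl) q)
      (room.small ((hl q hq).trans (by omega)))) fun p hp => ?_
    rw [setMem_mem_self]
    split
    · next e => rw [e]
    · exact h p (by omega)
  · exact fun _ _ h => h
  · simp
    omega

theorem primeStep_runs {w k n : ℕ} (room : Room w k n) {s : Store Reg Arr} (hk : s.reg .k = k)
    (hn : s.reg .n = n) (hD : ∀ j, s.mem .delta j ≤ n) (hl : ∀ q < n, s.mem .acc3 q ≤ 1)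
    (hp : ∀ j, s.mem .prime j = 0) :
    Runs w (40 * ((n + 1) * (k + 1))) primeStep s fun t => ∀ j < n * k, t.mem .prime j =
      if s.mem .delta j = 0 then 0 else s.mem .acc3 (s.mem .delta j - 1) := by
  set D := s.mem .delta with hDdef
  -- The cells not yet visited must still be 0, because an undefined transition makes the program
  -- skip its cell instead of writing 0.
  let I : ℕ → Store Reg Arr → Prop := fun j t =>
    (∀ i < j, t.mem .prime i = if D i = 0 then 0 else s.mem .acc3 (D i - 1)) ∧
      ∀ i ≥ j, t.mem .prime i = 0
  apply Runs.mono (Q₁ := I (n * k))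
  · apply Runs.loop (fun q t => I (q * k) t) (room.valN hn)
    · exact ⟨by simp, fun i _ => hp i⟩
    intro q hq t₁ fr₁ h₁
    have hk₁ : t₁.reg .k = k := (fr₁.reg .k rfl).trans hk
    rw [Nat.succ_mul]
    apply Runs.loop (fun x t => I (q * k + x) t)
    · exact room.valK hk₁
    · exact h₁
    intro x hx t₂ fr₂ h₂
    have hk₂ : t₂.reg .k = k := (fr₂.reg .k rfl).trans hk₁
    have hd₂ : t₂.mem .delta = D := (fr₂.mem .delta rfl).trans (fr₁.mem .delta rfl)
    have ha₂ : t₂.mem .acc3 = s.mem .acc3 := (fr₂.mem .acc3 rfl).trans (fr₁.mem .acc3 rfl)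
    have vx : Val w (t₂.setReg .x x) (rd .x) x := room.valCol rfl hx
    have vc : Val w (t₂.setReg .x x) (cell (rd .q) (rd .x)) (q * k + x) :=
      room.valCell hk₂ (room.valState (fr₂.reg .q rfl) (by omega)) vx (by omega) hx
    have vd : Val w (t₂.setReg .x x) (.get .delta (cell (rd .q) (rd .x))) (D (q * k + x)) :=
      .get vc (congrFun hd₂ _) (room.small ((hD _).trans (by omega)))
    apply Runs.when (Expr.Val.zero.ltTest vd (room.small (by omega)))
    · intro h
      have hpos : 0 < D (q * k + x) := by
        by_contra h'
        simp [h'] at h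
      have hlt : D (q * k + x) - 1 < n := by have := hD (q * k + x); omega
      refine Runs.put vc (.get (vd.sub room.valOne) (congrFun ha₂ _)
        (room.small ((hl _ hlt).trans (by omega)))) ⟨fun i hi => ?_, fun i hi => ?_⟩
      · rw [setMem_mem_self]
        split
        · next e => rw [e, if_neg hpos.ne']
        · exact h₂.1 i (by omega)
      · rw [setMem_mem_self, if_neg (by omega)]
        exact h₂.2 i (by omega)
    · intro h
      have h0 : D (q * k + x) = 0 := by
        by_contra h'
        simp [Nat.pos_of_ne_zero h'] at h
      refine ⟨fun i hi => ?_, fun i hi => h₂.2 i (by omega)⟩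
      rcases Nat.lt_succ_iff_lt_or_eq.mp hi with hi | hi
      · exact h₂.1 i hi
      · rw [show i = q * k + x from hi, if_pos h0]
        exact h₂.2 _ le_rfl
  · exact fun t _ h => h.1
  · simp
    nlinarith [Nat.zero_le (n * k)]

/-- The table `b` consists of zeros and ones, the ones being at the addresses in `R`. -/
def Marks (b : ℕ → ℕ) (R : ℕ → Prop) : Prop := ∀ j, b j ≤ 1 ∧ (b j ≠ 0 ↔ R j)

theorem Marks.put {s : Store Reg Arr} {b : Arr} {R R' : ℕ → Prop} {a : ℕ} (h : Marks (s.mem b) R)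
    (hR : ∀ j, R' j ↔ R j ∨ j = a) : Marks ((s.setMem b a 1).mem b) R' := by
  intro j
  rw [setMem_mem_self, hR]
  split
  · next e => simp [e]
  · next e => simpa [e] using h j

theorem Marks.congr {b : ℕ → ℕ} {R R' : ℕ → Prop} (h : Marks b R) (hR : ∀ j, R' j ↔ R j) :
    Marks b R' := fun j => by rw [hR]; exact h j

/-- One of the first `J` pairs of a state and an event contributes the address `j`. -/
def Upto (k J : ℕ) (C : ℕ → ℕ → ℕ → Prop) (j : ℕ) : Prop :=
  ∃ q x, x < k ∧ q * k + x < J ∧ C q x j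

/-- Quotient and remainder recover row and column. Applied twice, this decodes the triples of the
transition table. -/
theorem cell_inj {k q x p y : ℕ} (hx : x < k) (hy : y < k) (h : q * k + x = p * k + y) :
    q = p ∧ x = y := by
  have h1 := congrArg (· / k) h
  have h2 := congrArg (· % k) h
  simp only [add_div_cell hx, add_div_cell hy, add_mod_cell hx, add_mod_cell hy] at h1 h2
  exact ⟨h1, h2⟩

/-- The pairs are visited in the order of their numbers q * k + x, so a round adds exactly the
contribution of one pair. -/
theorem upto_succ {k q x : ℕ} {C : ℕ → ℕ → ℕ → Prop} (hx : x < k) (j : ℕ) :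
    Upto k (q * k + (x + 1)) C j ↔ Upto k (q * k + x) C j ∨ C q x j := by
  constructor
  · rintro ⟨p, y, hy, hlt, h⟩
    rcases Nat.lt_succ_iff_lt_or_eq.mp hlt with hlt | he
    · exact .inl ⟨p, y, hy, hlt, h⟩
    · obtain ⟨rfl, rfl⟩ := cell_inj hy hx he
      exact .inr h
  · rintro (⟨p, y, hy, hlt, h⟩ | h)
    · exact ⟨p, y, hy, by omega, h⟩
    · exact ⟨q, x, hx, by omega, h⟩

/-- The address `j` belongs to an observable transition that is copied from `(q, x)`. -/
def ObsAt (k n : ℕ) (D mk : ℕ → ℕ) (q x j : ℕ) : Prop :=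
  ∃ r, D (q * k + x) = r + 1 ∧ mk x ≠ 0 ∧
    ∃ y < k, mk y = mk x ∧ j = (q * k + y) * (n + 1) + r

/-- The address `j` belongs to a transition that stems from `(q, x)`. -/
def NfaAt (k n : ℕ) (D mk pr : ℕ → ℕ) (q x j : ℕ) : Prop :=
  ObsAt k n D mk q x j ∨ (mk x = 0 ∧ j = (q * k + x) * (n + 1) + q) ∨
    (pr (q * k + x) ≠ 0 ∧ j = (q * k + x) * (n + 1) + n)

/-- The address `j` belongs to an `ε`-transition that stems from `(q, x)`. -/
def EpsAt (k n : ℕ) (D mk : ℕ → ℕ) (q x j : ℕ) : Prop :=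
  ∃ r, D (q * k + x) = r + 1 ∧ mk x = 0 ∧ j = q * (n + 1) + r

theorem nfaStep_runs {w k n : ℕ} (room : Room w k n) {s : Store Reg Arr} (hk : s.reg .k = k)
    (hn : s.reg .n = n) (hD : ∀ j, s.mem .delta j ≤ n) (hm : ∀ j, s.mem .mask j < 2 ^ w)
    (hp : ∀ j < n * k, s.mem .prime j ≤ 1) (h_nfa : ∀ j, s.mem .nfa j = 0)
    (h_eps : ∀ j, s.mem .eps j = 0) :
    Runs w (200 * ((n + 1) * (k + 1) * (k + 1))) nfaStep s fun t =>
      Marks (t.mem .nfa) (Upto k (n * k) (NfaAt k n (s.mem .delta) (s.mem .mask) (s.mem .prime))) ∧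
        Marks (t.mem .eps) (Upto k (n * k) (EpsAt k n (s.mem .delta) (s.mem .mask))) := by
  set D := s.mem .delta with hDdef
  set mk := s.mem .mask with hmdef
  set pr := s.mem .prime with hpdef
  let I : ℕ → Store Reg Arr → Prop := fun J t =>
    Marks (t.mem .nfa) (Upto k J (NfaAt k n D mk pr)) ∧
      Marks (t.mem .eps) (Upto k J (EpsAt k n D mk))
  apply Runs.mono (Q₁ := I (n * k))
  · apply Runs.loop (fun q t => I (q * k) t) (room.valN hn)
    · refine ⟨fun j => ?_, fun j => ?_⟩ <;> simp [h_nfa, h_eps, Upto]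
    intro q hq t₁ fr₁ h₁
    have hk₁ : t₁.reg .k = k := (fr₁.reg .k rfl).trans hk
    have hn₁ : t₁.reg .n = n := (fr₁.reg .n rfl).trans hn
    rw [Nat.succ_mul]
    apply Runs.loop (fun x t => I (q * k + x) t)
    · exact room.valK hk₁
    · exact h₁
    intro x hx t₂ fr₂ h₂
    have hk₂ : t₂.reg .k = k := (fr₂.reg .k rfl).trans hk₁
    have hn₂ : t₂.reg .n = n := (fr₂.reg .n rfl).trans hn₁
    have hd₂ : t₂.mem .delta = D := (fr₂.mem .delta rfl).trans (fr₁.mem .delta rfl)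
    have hm₂ : t₂.mem .mask = mk := (fr₂.mem .mask rfl).trans (fr₁.mem .mask rfl)
    have hp₂ : t₂.mem .prime = pr := (fr₂.mem .prime rfl).trans (fr₁.mem .prime rfl)
    have hq₂ : t₂.reg .q = q := fr₂.reg .q rfl
    -- The addresses with a mark before the three conditionals (`U`), after the first (`U₁`) and
    -- after the second (`U₂`). Only the first conditional writes ε-transitions, so `E` is already
    -- final after it.
    let U : ℕ → Prop := Upto k (q * k + x) (NfaAt k n D mk pr)
    let U₁ : ℕ → Prop := fun j => U j ∨ ObsAt k n D mk q x j
    let U₂ : ℕ → Prop := fun j => U₁ j ∨ (mk x = 0 ∧ j = (q * k + x) * (n + 1) + q)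
    let E : ℕ → Prop := Upto k (q * k + (x + 1)) (EpsAt k n D mk)
    apply Runs.seq (Q₁ := fun t => Marks (t.mem .nfa) U₁ ∧ Marks (t.mem .eps) E)
    · have vx : Val w (t₂.setReg .x x) (rd .x) x := room.valCol rfl hx
      have vc : Val w (t₂.setReg .x x) (cell (rd .q) (rd .x)) (q * k + x) :=
        room.valCell hk₂ (room.valState hq₂ (by omega)) vx (by omega) hx
      have vd : Val w (t₂.setReg .x x) (.get .delta (cell (rd .q) (rd .x))) (D (q * k + x)) :=
        .get vc (congrFun hd₂ _) (room.small ((hD _).trans (by omega)))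
      apply Runs.when (Expr.Val.zero.ltTest vd (room.small (by omega)))
      · intro h
        have hpos : 0 < D (q * k + x) := by
          by_contra h'
          simp [h'] at h
        obtain ⟨r, hr⟩ := Nat.exists_eq_succ_of_ne_zero hpos.ne'
        have hrn : r < n := by have := hD (q * k + x); rw [hr] at this; exact this
        apply Runs.seq (Q₁ := fun t => t.mem = t₂.mem ∧ t.reg .r = r ∧ t.reg .x = x)
        · refine Runs.set (vd.sub room.valOne) ⟨rfl, ?_, rfl⟩
          rw [hr]; rfl
        intro t₃ fr₃ h₃
        have hk₃ : t₃.reg .k = k := (fr₃.reg .k rfl).trans hk₂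
        have hn₃ : t₃.reg .n = n := (fr₃.reg .n rfl).trans hn₂
        have hq₃ : t₃.reg .q = q := (fr₃.reg .q rfl).trans hq₂
        have vx : Val w t₃ (rd .x) x := room.valCol h₃.2.2 hx
        have vm : Val w t₃ (.get .mask (rd .x)) (mk x) :=
          .get vx (by rw [h₃.1, hm₂]) (hm x)
        apply Runs.ite (vm.eqTest .zero (room.small (by omega)))
        · intro h'
          have h' : mk x = 0 := by simpa using h'
          have va := room.valPair hn₃ (room.valState hq₃ (by omega))
            (room.valState h₃.2.1 (by omega)) (by omega : q < n + 1) (by omega : r < n + 1)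
          refine Runs.put va room.valOne ⟨?_, Marks.put (h₃.1 ▸ h₂.2) fun j => ?_⟩
          · have : Marks (t₃.mem .nfa) U := h₃.1 ▸ h₂.1
            exact this.congr fun j => by simp [U₁, ObsAt, h']
          · simp [E, upto_succ hx, EpsAt, hr, h']
        · intro h'
          have h' : mk x ≠ 0 := by simpa using h'
          have hE : Marks (t₃.mem .eps) E := by
            rw [h₃.1]
            exact h₂.2.congr fun j => by simp [E, upto_succ hx, EpsAt, h']
          -- The copies of the transition to the events below i with the same mask value; x itself
          -- is among the events, so the original transition is kept.
          let J : ℕ → Store Reg Arr → Prop := fun i t => Marks (t.mem .nfa) (fun j => U j ∨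
            ∃ y < i, mk y = mk x ∧ j = (q * k + y) * (n + 1) + r) ∧ Marks (t.mem .eps) E
          apply Runs.conseq (Q₁ := J k)
          · exact fun t _ h => ⟨h.1.congr fun j => by simp [U₁, ObsAt, hr, h'], h.2⟩
          apply Runs.loop J
          · exact room.valK hk₃
          · refine ⟨?_, hE⟩
            rw [h₃.1]
            exact h₂.1.congr fun j => by simp [U]
          intro y hy t₄ fr₄ h₄
          have hm₄ : t₄.mem .mask = mk := (fr₄.mem .mask rfl).trans (by rw [h₃.1, hm₂])
          have vy : Val w (t₄.setReg .y y) (rd .y) y := room.valCol rfl hy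
          have vx : Val w (t₄.setReg .y y) (rd .x) x :=
            room.valCol ((fr₄.reg .x rfl).trans h₃.2.2) hx
          have vq : Val w (t₄.setReg .y y) (rd .q) q :=
            room.valState ((fr₄.reg .q rfl).trans hq₃) (by omega)
          have vr : Val w (t₄.setReg .y y) (rd .r) r :=
            room.valState ((fr₄.reg .r rfl).trans h₃.2.1) (by omega)
          have vmx : Val w (t₄.setReg .y y) (.get .mask (rd .x)) (mk x) :=
            .get vx (congrFun hm₄ x) (hm x)
          have vmy : Val w (t₄.setReg .y y) (.get .mask (rd .y)) (mk y) :=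
            .get vy (congrFun hm₄ y) (hm y)
          apply Runs.when (vmy.eqTest vmx (room.small (by omega)))
          · intro h''
            have h'' : mk y = mk x := by simpa using h''
            refine Runs.put (room.valCell3 ((fr₄.reg .k rfl).trans hk₃)
              ((fr₄.reg .n rfl).trans hn₃) vq vy vr (by omega) hy (by omega)) room.valOne
              ⟨Marks.put h₄.1 fun j => ?_, h₄.2⟩
            rw [or_assoc]
            refine or_congr Iff.rfl ⟨?_, ?_⟩
            · rintro ⟨z, hz, h⟩
              rcases Nat.lt_succ_iff_lt_or_eq.mp hz with hz | rfl
              · exact .inl ⟨z, hz, h⟩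
              · exact .inr h.2
            · rintro (⟨z, hz, h⟩ | h)
              · exact ⟨z, by omega, h⟩
              · exact ⟨y, by omega, h'', h⟩
          · intro h''
            have h'' : mk y ≠ mk x := by simpa using h''
            refine ⟨h₄.1.congr fun j => or_congr Iff.rfl ⟨?_, ?_⟩, h₄.2⟩
            · rintro ⟨z, hz, h⟩
              rcases Nat.lt_succ_iff_lt_or_eq.mp hz with hz | rfl
              · exact ⟨z, hz, h⟩
              · exact absurd h.1 h''
            · rintro ⟨z, hz, h⟩
              exact ⟨z, by omega, h⟩
      · intro h
        have h0 : D (q * k + x) = 0 := by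
          by_contra h'
          simp [Nat.pos_of_ne_zero h'] at h
        exact ⟨h₂.1.congr fun j => by simp [U₁, U, ObsAt, h0],
          h₂.2.congr fun j => by simp [E, upto_succ hx, EpsAt, h0]⟩
    intro t₃ fr₃ h₃
    have hk₃ : t₃.reg .k = k := (fr₃.reg .k rfl).trans hk₂
    have hn₃ : t₃.reg .n = n := (fr₃.reg .n rfl).trans hn₂
    have hq₃ : t₃.reg .q = q := (fr₃.reg .q rfl).trans hq₂
    have hx₃ : t₃.reg .x = x := fr₃.reg .x rfl
    have hm₃ : t₃.mem .mask = mk := (fr₃.mem .mask rfl).trans hm₂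
    have hp₃ : t₃.mem .prime = pr := (fr₃.mem .prime rfl).trans hp₂
    have vx : Val w t₃ (rd .x) x := room.valCol hx₃ hx
    have vq : Val w t₃ (rd .q) q := room.valState hq₃ (by omega)
    apply Runs.seq (Q₁ := fun t => Marks (t.mem .nfa) U₂ ∧ Marks (t.mem .eps) E)
    · have vm : Val w t₃ (.get .mask (rd .x)) (mk x) := .get vx (congrFun hm₃ x) (hm x)
      apply Runs.when (vm.eqTest .zero (room.small (by omega)))
      · intro h
        have h : mk x = 0 := by simpa using h
        refine Runs.put (room.valCell3 hk₃ hn₃ vq vx vq (by omega) hx (by omega)) room.valOne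
          ⟨Marks.put h₃.1 fun j => ?_, h₃.2⟩
        simp [U₂, h]
      · intro h
        have h : mk x ≠ 0 := by simpa using h
        exact ⟨h₃.1.congr fun j => by simp [U₂, h], h₃.2⟩
    intro t₄ fr₄ h₄
    have hk₄ : t₄.reg .k = k := (fr₄.reg .k rfl).trans hk₃
    have hn₄ : t₄.reg .n = n := (fr₄.reg .n rfl).trans hn₃
    have hp₄ : t₄.mem .prime = pr := (fr₄.mem .prime rfl).trans hp₃
    have vx : Val w t₄ (rd .x) x := room.valCol ((fr₄.reg .x rfl).trans hx₃) hx
    have vq : Val w t₄ (rd .q) q := room.valState ((fr₄.reg .q rfl).trans hq₃) (by omega)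
    have vp : Val w t₄ (.get .prime (cell (rd .q) (rd .x))) (pr (q * k + x)) :=
      .get (room.valCell hk₄ vq vx (by omega) hx) (congrFun hp₄ _)
        (room.small ((hp _ (cell_lt hq hx)).trans (by omega)))
    apply Runs.when vp
    · intro h
      refine Runs.put (room.valCell3 hk₄ hn₄ vq vx (room.valN hn₄) (by omega) hx (by omega))
        room.valOne ⟨Marks.put h₄.1 fun j => ?_, h₄.2⟩
      rw [upto_succ hx]
      simp [U₂, U₁, U, NfaAt, h, or_assoc]
    · intro h
      refine ⟨h₄.1.congr fun j => ?_, h₄.2⟩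
      rw [upto_succ hx]
      simp [U₂, U₁, U, NfaAt, h, or_assoc]
  · exact fun t _ h => h
  · simp
    nlinarith [Nat.zero_le (n * k), Nat.zero_le (n * k * k), Nat.zero_le (k * k)]

/-! ### The subset construction -/

/-- Compute the powers of two. -/
def powStep : Program :=
  (.put .pow 0 1) ;;
  (.loop .q (rd .n + 1) <|
    .put .pow (rd .q + 1) (.get .pow (rd .q) + .get .pow (rd .q)))

/-- Initialize the closures with singletons. -/
def singletonStep : Program :=
  .loop .q (rd .n + 1) <| .put .clo (rd .q) (.get .pow (rd .q))

/-- Compute the closures under `ε`-transitions. -/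
def closureStep : Program :=
  .loop .t (rd .n + 1) <| .loop .q (rd .n + 1) <| .loop .r (rd .n + 1) <|
    when (.get .eps (rd .q * (rd .n + 1) + rd .r)) <|
      .put .clo (rd .q) (union (.get .clo (rd .q)) (.get .clo (rd .r)))

/-- Compute the closed successor sets of single states. -/
def succStep : Program :=
  .loop .q (rd .n + 1) <| .loop .x (rd .k) <| .loop .r (rd .n + 1) <|
    when (.get .nfa (cell3 (rd .q) (rd .x) (rd .r))) <|
      .put .succ (cell (rd .q) (rd .x))
        (union (.get .succ (cell (rd .q) (rd .x))) (.get .clo (rd .r)))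

/-- The row of the empty set. -/
def emptyRowStep : Program :=
  (.loop .x (rd .k) <| .put .det (cell 0 (rd .x)) 0) ;;
  (.put .detAcc 0 0)

/-- The rows of the nonempty sets. -/
def subsetStep : Program :=
  .loop .q (rd .n + 1) <| .loop .y (.get .pow (rd .q)) <|
    (.put .detAcc (.get .pow (rd .q) + rd .y)
      (union (.get .detAcc (rd .y)) (eqTest (rd .q) (rd .n)))) ;;
    (.loop .x (rd .k) <|
      .put .det (cell (.get .pow (rd .q) + rd .y) (rd .x))
        (union (.get .det (cell (rd .y) (rd .x))) (.get .succ (cell (rd .q) (rd .x)))))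

theorem Room.pow_le {w k n i : ℕ} (room : Room w k n) (hi : i ≤ n + 1) : 2 ^ i < 2 ^ w :=
  room.set ((Nat.pow_le_pow_right two_pos hi).trans (Nat.le_succ _))

theorem powStep_runs {w k n : ℕ} (room : Room w k n) {s : Store Reg Arr} (hn : s.reg .n = n) :
    Runs w (20 * (n + 1)) powStep s fun t => ∀ i < n + 2, t.mem .pow i = 2 ^ i := by
  apply Runs.mono (Q₁ := fun t => ∀ i < n + 1 + 1, t.mem .pow i = 2 ^ i)
  · apply Runs.seq (Q₁ := fun t => t.mem .pow 0 = 1)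
    · exact Runs.put .zero room.valOne (by simp [setMem_mem_self])
    intro t₁ fr₁ h₁
    have hn₁ : t₁.reg .n = n := (fr₁.reg .n rfl).trans hn
    apply Runs.loop (fun j t => ∀ i < j + 1, t.mem .pow i = 2 ^ i) (room.valN1 hn₁)
    · intro i hi
      obtain rfl : i = 0 := by omega
      simpa using h₁
    intro q hq t fr h
    have vq : Val w (t.setReg .q q) (rd .q) q := room.valState rfl (by omega)
    have vp : Val w (t.setReg .q q) (.get .pow (rd .q)) (2 ^ q) :=
      .get vq (h q (by omega)) (room.pow_le (by omega))
    have e : 2 ^ q + 2 ^ q = 2 ^ (q + 1) := by ring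
    refine Runs.put (vq.add room.valOne (room.small (by omega)))
      (vp.add vp (e ▸ room.pow_le (by omega))) fun i hi => ?_
    rw [setMem_mem_self]
    split
    · next e' => rw [e', e]
    · exact h i (by omega)
  · exact fun _ _ h => h
  · simp
    omega

theorem singletonStep_runs {w k n : ℕ} (room : Room w k n) {s : Store Reg Arr}
    (hn : s.reg .n = n) (hp : ∀ i < n + 2, s.mem .pow i = 2 ^ i) :
    Runs w (20 * (n + 1)) singletonStep s fun t => ∀ i < n + 1, t.mem .clo i = 2 ^ i := by
  apply Runs.mono (Q₁ := fun t => ∀ i < n + 1, t.mem .clo i = 2 ^ i)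
  · apply Runs.loop (fun j t => ∀ i < j, t.mem .clo i = 2 ^ i) (room.valN1 hn) (by simp)
    intro q hq t fr h
    have vq : Val w (t.setReg .q q) (rd .q) q := room.valState rfl (by omega)
    have vp : Val w (t.setReg .q q) (.get .pow (rd .q)) (2 ^ q) :=
      .get vq ((congrFun (fr.mem .pow rfl) q).trans (hp q (by omega))) (room.pow_le (by omega))
    refine Runs.put vq vp fun i hi => ?_
    rw [setMem_mem_self]
    split
    · next e => rw [e]
    · exact h i (by omega)
  · exact fun _ _ h => h
  · simp
    omega

/-- There is an `ε`-transition from `q` to `r`, according to the table `b`. -/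
def EpsEdge (n : ℕ) (b : ℕ → ℕ) (q r : ℕ) : Prop :=
  q < n + 1 ∧ r < n + 1 ∧ b (q * (n + 1) + r) ≠ 0

/-- The scheme is that of `findLive_runs`, with words of bits in place of single marks: unions are
always sound, and round τ completes the paths of length τ. The bound 2^(n+1) records that only the
states 0, ..., n occur. -/
theorem closureStep_runs {w k n : ℕ} (room : Room w k n) {s : Store Reg Arr}
    (hn : s.reg .n = n) (he : ∀ j, s.mem .eps j ≤ 1)
    (hc : ∀ i < n + 1, s.mem .clo i = 2 ^ i) :
    Runs w (40 * ((n + 1) * (n + 1) * (n + 1))) closureStep s fun t => ∀ q < n + 1,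
      t.mem .clo q < 2 ^ (n + 1) ∧
        ∀ b, (t.mem .clo q).testBit b ↔ Relation.ReflTransGen (EpsEdge n (s.mem .eps)) q b := by
  set E := EpsEdge n (s.mem .eps) with hE
  let S : Store Reg Arr → Prop := fun t => ∀ q < n + 1, t.mem .clo q < 2 ^ (n + 1) ∧
    ∀ b, (t.mem .clo q).testBit b → Relation.ReflTransGen E q b
  let C : ℕ → ℕ → Store Reg Arr → Prop := fun τ i t => ∀ q < i, ∀ b, Within E τ q b →
    (t.mem .clo q).testBit b
  apply Runs.mono (Q₁ := fun t => S t ∧ C (n + 1) (n + 1) t)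
  · apply Runs.loop (fun τ t => S t ∧ C τ (n + 1) t) (room.valN1 hn)
    · refine ⟨fun q hq => ?_, fun q hq b hb => ?_⟩
      · rw [hc q hq]
        refine ⟨Nat.pow_lt_pow_right one_lt_two hq, fun b hb => ?_⟩
        rw [Nat.testBit_two_pow, decide_eq_true_eq] at hb
        rw [hb]
      · obtain rfl : q = b := hb
        rw [hc q hq]
        simp
    intro τ hτ t₁ fr₁ h₁
    have hn₁ : t₁.reg .n = n := (fr₁.reg .n rfl).trans hn
    have he₁ : t₁.mem .eps = s.mem .eps := fr₁.mem .eps rfl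
    apply Runs.conseq (Q₁ := fun t => S t ∧ C τ (n + 1) t ∧ C (τ + 1) (n + 1) t)
      (fun t _ h => ⟨h.1, h.2.2⟩)
    apply Runs.loop (fun i t => S t ∧ C τ (n + 1) t ∧ C (τ + 1) i t)
    · exact room.valN1 hn₁
    · exact ⟨h₁.1, h₁.2, fun _ h => absurd h (Nat.not_lt_zero _)⟩
    intro q hq t₂ fr₂ h₂
    have hn₂ : t₂.reg .n = n := (fr₂.reg .n rfl).trans hn₁
    have he₂ : t₂.mem .eps = s.mem .eps := (fr₂.mem .eps rfl).trans he₁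
    let L : ℕ → Store Reg Arr → Prop := fun i t => S t ∧ C τ (n + 1) t ∧ C (τ + 1) q t ∧
      ∀ r < i, E q r → ∀ b, Within E τ r b → (t.mem .clo q).testBit b
    apply Runs.conseq (Q₁ := L (n + 1))
    · intro t _ h
      refine ⟨h.1, h.2.1, fun p hp b hb => ?_⟩
      rcases Nat.lt_succ_iff_lt_or_eq.mp hp with hp | rfl
      · exact h.2.2.1 p hp b hb
      · rcases hb with rfl | ⟨c, hc, hb⟩
        · exact h.2.1 p hq p (Within.refl _ _)
        · exact h.2.2.2 c hc.2.1 hc b hb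
    apply Runs.loop L
    · exact room.valN1 hn₂
    · exact ⟨h₂.1, h₂.2.1, h₂.2.2, fun _ h => absurd h (Nat.not_lt_zero _)⟩
    intro r hr t₃ fr₃ h₃
    have hn₃ : t₃.reg .n = n := (fr₃.reg .n rfl).trans hn₂
    have he₃ : t₃.mem .eps = s.mem .eps := (fr₃.mem .eps rfl).trans he₂
    have vq : Val w (t₃.setReg .r r) (rd .q) q := room.valState (fr₃.reg .q rfl) hq
    have vr : Val w (t₃.setReg .r r) (rd .r) r := room.valState rfl hr
    have ve : Val w (t₃.setReg .r r) (.get .eps (rd .q * (rd .n + 1) + rd .r))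
        (s.mem .eps (q * (n + 1) + r)) :=
      .get (room.valPair hn₃ vq vr hq hr) (congrFun he₃ _)
        (room.small ((he _).trans (by omega)))
    have hpow := room.pow_le (le_refl (n + 1))
    apply Runs.when ve
    · intro h
      have hqr : E q r := ⟨hq, hr, h⟩
      -- The effect of one update on every entry, bit by bit: the entry of q gains the members of
      -- the entry of r, and nothing is lost.
      have key : ∀ p < n + 1, ∀ b, ((if p = q then t₃.mem .clo q ||| t₃.mem .clo r
          else t₃.mem .clo p).testBit b ↔
          (t₃.mem .clo p).testBit b ∨ (p = q ∧ (t₃.mem .clo r).testBit b)) := by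
        intro p _ b
        split
        · next e => simp [e]
        · next e => simp [e]
      refine Runs.put vq ((Val.get vq rfl ((h₃.1 q hq).1.trans hpow)).lor
        (Val.get vr rfl ((h₃.1 r hr).1.trans hpow)))
        ⟨fun p hp => ⟨?_, fun b => ?_⟩, fun p hp b hb => ?_, fun p hp b hb => ?_,
          fun r' hr' hqr' b hb => ?_⟩ <;> rw [setMem_mem_self]
      · split
        · exact Nat.or_lt_two_pow (h₃.1 q hq).1 (h₃.1 r hr).1
        · exact (h₃.1 p hp).1
      · refine fun hb => ((key p hp b).mp hb).elim ((h₃.1 p hp).2 b) ?_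
        rintro ⟨hpq, hb⟩
        rw [hpq]
        exact .head hqr ((h₃.1 r hr).2 b hb)
      · exact (key p hp b).mpr (.inl (h₃.2.1 p hp b hb))
      · exact (key p (by omega) b).mpr (.inl (h₃.2.2.1 p hp b hb))
      · refine (key q hq b).mpr ?_
        rcases Nat.lt_succ_iff_lt_or_eq.mp hr' with hr' | rfl
        · exact .inl (h₃.2.2.2 r' hr' hqr' b hb)
        · exact .inr ⟨rfl, h₃.2.1 r' hr b hb⟩
    · intro h
      refine ⟨h₃.1, h₃.2.1, h₃.2.2.1, fun r' hr' hqr' b hb => ?_⟩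
      rcases Nat.lt_succ_iff_lt_or_eq.mp hr' with hr' | rfl
      · exact h₃.2.2.2 r' hr' hqr' b hb
      · exact absurd h hqr'.2.2
  · exact fun t _ h q hq => ⟨(h.1 q hq).1, fun b => ⟨(h.1 q hq).2 b, fun hb =>
      h.2 q hq b (within_of_reflTransGen (fun _ _ h => h.1) hq hb)⟩⟩
  · simp
    nlinarith [Nat.zero_le (n * n), Nat.zero_le (n * n * n)]

/-- `v` is the union of the closures of the states `r < R` to which there is a transition from the
pair with the number `j`. -/
def SuccSpec (n : ℕ) (nfa clo : ℕ → ℕ) (R j v : ℕ) : Prop :=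
  v < 2 ^ (n + 1) ∧
    ∀ b, v.testBit b ↔ ∃ r < R, nfa (j * (n + 1) + r) ≠ 0 ∧ (clo r).testBit b

theorem succStep_runs {w k n : ℕ} (room : Room w k n) {s : Store Reg Arr} (hk : s.reg .k = k)
    (hn : s.reg .n = n) (hf : ∀ j, s.mem .nfa j ≤ 1) (hc : ∀ i < n + 1, s.mem .clo i < 2 ^ (n + 1))
    (hs : ∀ j, s.mem .succ j = 0) :
    Runs w (60 * ((n + 1) * (n + 1) * (k + 1))) succStep s fun t => ∀ j < (n + 1) * k,
      SuccSpec n (s.mem .nfa) (s.mem .clo) (n + 1) j (t.mem .succ j) := by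
  set nfa := s.mem .nfa with hnfa
  set clo := s.mem .clo with hclo
  let I : ℕ → Store Reg Arr → Prop := fun J t =>
    (∀ j < J, SuccSpec n nfa clo (n + 1) j (t.mem .succ j)) ∧ ∀ j ≥ J, t.mem .succ j = 0
  apply Runs.mono (Q₁ := I ((n + 1) * k))
  · apply Runs.loop (fun q t => I (q * k) t) (room.valN1 hn)
    · exact ⟨by simp, fun i _ => hs i⟩
    intro q hq t₁ fr₁ h₁
    have hk₁ : t₁.reg .k = k := (fr₁.reg .k rfl).trans hk
    have hn₁ : t₁.reg .n = n := (fr₁.reg .n rfl).trans hn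
    rw [Nat.succ_mul]
    apply Runs.loop (fun x t => I (q * k + x) t)
    · exact room.valK hk₁
    · exact h₁
    intro x hx t₂ fr₂ h₂
    have hk₂ : t₂.reg .k = k := (fr₂.reg .k rfl).trans hk₁
    have hn₂ : t₂.reg .n = n := (fr₂.reg .n rfl).trans hn₁
    have hf₂ : t₂.mem .nfa = nfa := (fr₂.mem .nfa rfl).trans (fr₁.mem .nfa rfl)
    have hc₂ : t₂.mem .clo = clo := (fr₂.mem .clo rfl).trans (fr₁.mem .clo rfl)
    have hq₂ : t₂.reg .q = q := fr₂.reg .q rfl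
    -- Finished cells, the cell in progress with the targets below R taken into account, and the
    -- cells that are still empty.
    let J : ℕ → Store Reg Arr → Prop := fun R t =>
      (∀ j < q * k + x, SuccSpec n nfa clo (n + 1) j (t.mem .succ j)) ∧
        SuccSpec n nfa clo R (q * k + x) (t.mem .succ (q * k + x)) ∧
        ∀ j ≥ q * k + x + 1, t.mem .succ j = 0
    apply Runs.conseq (Q₁ := J (n + 1))
    · intro t _ h
      refine ⟨fun j hj => ?_, h.2.2⟩
      rcases Nat.lt_succ_iff_lt_or_eq.mp hj with hj | hj
      · exact h.1 j hj
      · rw [show j = q * k + x from hj]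
        exact h.2.1
    apply Runs.loop J
    · exact room.valN1 hn₂
    · refine ⟨h₂.1, ?_, fun j hj => h₂.2 j (by omega)⟩
      have h0 := h₂.2 _ le_rfl
      rw [setReg_mem, h0]
      exact ⟨Nat.two_pow_pos _, by simp⟩
    intro r hr t₃ fr₃ h₃
    have hk₃ : t₃.reg .k = k := (fr₃.reg .k rfl).trans hk₂
    have hn₃ : t₃.reg .n = n := (fr₃.reg .n rfl).trans hn₂
    have hf₃ : t₃.mem .nfa = nfa := (fr₃.mem .nfa rfl).trans hf₂
    have hc₃ : t₃.mem .clo = clo := (fr₃.mem .clo rfl).trans hc₂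
    have vq : Val w (t₃.setReg .r r) (rd .q) q :=
      room.valState ((fr₃.reg .q rfl).trans hq₂) hq
    have vx : Val w (t₃.setReg .r r) (rd .x) x := room.valCol (fr₃.reg .x rfl) hx
    have vr : Val w (t₃.setReg .r r) (rd .r) r := room.valState rfl hr
    have vc := room.valCell (s := t₃.setReg .r r) hk₃ vq vx hq hx
    have vf : Val w (t₃.setReg .r r) (.get .nfa (cell3 (rd .q) (rd .x) (rd .r)))
        (nfa ((q * k + x) * (n + 1) + r)) :=
      .get (room.valCell3 hk₃ hn₃ vq vx vr hq hx hr) (congrFun hf₃ _)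
        (room.small ((hf _).trans (by omega)))
    have hpow := room.pow_le (le_refl (n + 1))
    apply Runs.when vf
    · intro h
      refine Runs.put vc ((Val.get vc rfl (h₃.2.1.1.trans hpow)).lor
        (Val.get vr (congrFun hc₃ r) ((hc r hr).trans hpow)))
        ⟨fun j hj => ?_, ?_, fun j hj => ?_⟩ <;> rw [setMem_mem_self]
      · rw [if_neg (by omega)]
        exact h₃.1 j hj
      · rw [if_pos rfl]
        refine ⟨Nat.or_lt_two_pow h₃.2.1.1 (hc r hr), fun b => ?_⟩
        have h3 := h₃.2.1.2 b
        rw [Nat.testBit_or, Bool.or_eq_true, setReg_mem, h3]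
        constructor
        · rintro (⟨r', hr', h'⟩ | hb)
          · exact ⟨r', by omega, h'⟩
          · exact ⟨r, by omega, h, hb⟩
        · rintro ⟨r', hr', h'⟩
          rcases Nat.lt_succ_iff_lt_or_eq.mp hr' with hr' | rfl
          · exact .inl ⟨r', hr', h'⟩
          · exact .inr h'.2
      · rw [if_neg (by omega)]
        exact h₃.2.2 j hj
    · intro h
      refine ⟨h₃.1, ⟨h₃.2.1.1, fun b => (h₃.2.1.2 b).trans ⟨?_, ?_⟩⟩, h₃.2.2⟩
      · rintro ⟨r', hr', h'⟩
        exact ⟨r', by omega, h'⟩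
      · rintro ⟨r', hr', h'⟩
        rcases Nat.lt_succ_iff_lt_or_eq.mp hr' with hr' | rfl
        · exact ⟨r', hr', h'⟩
        · exact absurd h h'.1
  · exact fun t _ h => h.1
  · simp
    nlinarith [Nat.zero_le (n * k), Nat.zero_le (n * n * k), Nat.zero_le (n * n)]

theorem emptyRowStep_runs {w k n : ℕ} (room : Room w k n) {s : Store Reg Arr}
    (hk : s.reg .k = k) :
    Runs w (20 * (k + 1)) emptyRowStep s fun t =>
      (∀ x < k, t.mem .det x = 0) ∧ t.mem .detAcc 0 = 0 := by
  apply Runs.mono (Q₁ := fun t => (∀ x < k, t.mem .det x = 0) ∧ t.mem .detAcc 0 = 0)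
  · apply Runs.seq (Q₁ := fun t => ∀ x < k, t.mem .det x = 0)
    · apply Runs.loop (fun i t => ∀ x < i, t.mem .det x = 0) (room.valK hk) (by simp)
      intro x hx t fr h
      have vx : Val w (t.setReg .x x) (rd .x) x := room.valCol rfl hx
      refine Runs.put (room.valCell ((fr.reg .k rfl).trans hk) .zero vx (Nat.succ_pos n) hx) .zero
        fun y hy => ?_
      rw [setMem_mem_self]
      split
      · rfl
      · next e => exact h y (by omega)
    intro t fr h
    exact Runs.put .zero .zero ⟨h, by simp [setMem_mem_self]⟩
  · exact fun _ _ h => h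
  · simp
    omega

/-- Since y < 2^q there is no carry, so adding 2^q inserts the element q into the set y. -/
theorem testBit_two_pow_add {q y : ℕ} (hy : y < 2 ^ q) (b : ℕ) :
    (2 ^ q + y).testBit b ↔ y.testBit b ∨ b = q := by
  have h := Nat.two_pow_add_eq_or_of_lt hy 1
  rw [mul_one] at h
  rw [h, Nat.testBit_or, Bool.or_eq_true, Nat.testBit_two_pow, decide_eq_true_eq, or_comm,
    eq_comm (a := q)]

theorem two_pow_add_lt {q y N : ℕ} (hq : q < N) (hy : y < 2 ^ q) : 2 ^ q + y < 2 ^ N := by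
  have h1 : 2 ^ (q + 1) ≤ 2 ^ N := Nat.pow_le_pow_right two_pos hq
  rw [pow_succ] at h1
  omega

/-- The geometric sum: inner loops of lengths 1, 2, 4, ... together cost about as much as one loop
over all sets. This is why no factor n appears in the time bound. -/
theorem sum_two_pow_mul_le (a b N : ℕ) :
    ∑ i ∈ Finset.range N, (a + 2 ^ i * b) ≤ N * a + 2 ^ N * b := by
  induction N with
  | zero => simp
  | succ N ih =>
    rw [Finset.sum_range_succ, pow_succ]
    nlinarith

/-- `v` is the union of the successor sets, in the column `j % k`, of the members of the set
`j / k`. -/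
def DetSpec (k n : ℕ) (succ : ℕ → ℕ) (j v : ℕ) : Prop :=
  v < 2 ^ (n + 1) ∧
    ∀ b, v.testBit b ↔ ∃ q, (j / k).testBit q ∧ (succ (q * k + j % k)).testBit b

namespace Room

variable {w k n : ℕ} (room : Room w k n) {s : Store Reg Arr}
include room

theorem valSet {v : Reg} {y : ℕ} (hv : s.reg v = y) (hy : y < 2 ^ (n + 1) + 1) :
    Val w s (rd v) y := .var hv (room.set hy.le)

theorem valSetCell {e₁ e₂ : RExpr} {y x : ℕ} (hk : s.reg .k = k) (h₁ : Val w s e₁ y)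
    (h₂ : Val w s e₂ x) (hy : y < 2 ^ (n + 1) + 1) (hx : x < k) :
    Val w s (cell e₁ e₂) (y * k + x) := by
  have := cell_lt hy hx
  exact (h₁.mul (room.valK hk) (room.table (by omega))).add h₂ (room.table this.le)

end Room

theorem subsetStep_runs {w k n : ℕ} (room : Room w k n) {s : Store Reg Arr} (hk : s.reg .k = k)
    (hn : s.reg .n = n) (hp : ∀ i < n + 2, s.mem .pow i = 2 ^ i)
    (hs : ∀ j < (n + 1) * k, s.mem .succ j < 2 ^ (n + 1)) (hd : ∀ x < k, s.mem .det x = 0)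
    (ha : s.mem .detAcc 0 = 0) :
    Runs w (100 * ((k + 1) * 2 ^ (n + 1))) subsetStep s fun t =>
      (∀ y < 2 ^ (n + 1), t.mem .detAcc y ≤ 1 ∧ (t.mem .detAcc y ≠ 0 ↔ y.testBit n)) ∧
        ∀ j < 2 ^ (n + 1) * k, DetSpec k n (s.mem .succ) j (t.mem .det j) := by
  set succ := s.mem .succ with hsucc
  let I : ℕ → ℕ → Store Reg Arr → Prop := fun A J t =>
    (∀ y < A, t.mem .detAcc y ≤ 1 ∧ (t.mem .detAcc y ≠ 0 ↔ y.testBit n)) ∧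
      ∀ j < J, DetSpec k n succ j (t.mem .det j)
  apply Runs.mono (Q₁ := I (2 ^ (n + 1)) (2 ^ (n + 1) * k))
  · apply Runs.loop_sum (T := fun q => 3 + 2 ^ q * (23 + 23 * k))
      (fun q t => I (2 ^ q) (2 ^ q * k) t) (room.valN1 hn)
    · refine ⟨fun y hy => ?_, fun j hj => ?_⟩
      · obtain rfl : y = 0 := by simpa using hy
        simp [ha]
      · have hj : j < k := by simpa using hj
        rw [hd j hj]
        refine ⟨Nat.two_pow_pos _, ?_⟩
        simp [Nat.div_eq_of_lt hj]
    intro q hq t₁ fr₁ h₁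
    have hk₁ : t₁.reg .k = k := (fr₁.reg .k rfl).trans hk
    have hn₁ : t₁.reg .n = n := (fr₁.reg .n rfl).trans hn
    have hp₁ : t₁.mem .pow = s.mem .pow := fr₁.mem .pow rfl
    have hs₁ : t₁.mem .succ = succ := fr₁.mem .succ rfl
    have vq : Val w (t₁.setReg .q q) (rd .q) q := room.valState rfl hq
    have vp : Val w (t₁.setReg .q q) (.get .pow (rd .q)) (2 ^ q) :=
      .get vq ((congrFun hp₁ q).trans (hp q (by omega))) (room.pow_le (by omega))
    apply Runs.mono (Q₁ := I (2 ^ q + 2 ^ q) ((2 ^ q + 2 ^ q) * k))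
    · apply Runs.loop (fun y t => I (2 ^ q + y) ((2 ^ q + y) * k) t) vp h₁
      intro y hy t₂ fr₂ h₂
      have hk₂ : t₂.reg .k = k := (fr₂.reg .k rfl).trans hk₁
      have hn₂ : t₂.reg .n = n := (fr₂.reg .n rfl).trans hn₁
      have hp₂ : t₂.mem .pow = s.mem .pow := (fr₂.mem .pow rfl).trans hp₁
      have hs₂ : t₂.mem .succ = succ := (fr₂.mem .succ rfl).trans hs₁
      have hlt := two_pow_add_lt hq hy
      have vq : Val w (t₂.setReg .y y) (rd .q) q := room.valState (fr₂.reg .q rfl) hq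
      have vy : Val w (t₂.setReg .y y) (rd .y) y := room.valSet rfl (by omega)
      have vp : Val w (t₂.setReg .y y) (.get .pow (rd .q)) (2 ^ q) :=
        .get vq ((congrFun hp₂ q).trans (hp q (by omega))) (room.pow_le (by omega))
      have vs : Val w (t₂.setReg .y y) (.get .pow (rd .q) + rd .y) (2 ^ q + y) :=
        vp.add vy (room.set (by omega))
      have hbit := testBit_two_pow_add hy
      apply Runs.seq (Q₁ := I (2 ^ q + y + 1) ((2 ^ q + y) * k))
      · refine Runs.put vs (.lor (.get vy rfl ?_) (vq.eqTest (room.valN hn₂)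
          (room.small (by omega)))) ⟨fun z hz => ?_, h₂.2⟩
        · exact room.small ((h₂.1 y (by omega)).1.trans (by omega))
        · rw [setMem_mem_self]
          split
          · next e =>
            subst e
            have hy' := h₂.1 y (by omega)
            rw [hbit, eq_comm (a := n), ← hy'.2, setReg_mem]
            have h01 : t₂.mem .detAcc y = 0 ∨ t₂.mem .detAcc y = 1 := by omega
            rcases h01 with h | h <;> rw [h] <;> split <;> simp [*]
          · exact h₂.1 z (by omega)
      intro t₃ fr₃ h₃
      have hk₃ : t₃.reg .k = k := (fr₃.reg .k rfl).trans hk₂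
      have hq₃ : t₃.reg .q = q := (fr₃.reg .q rfl).trans (fr₂.reg .q rfl)
      have hy₃ : t₃.reg .y = y := fr₃.reg .y rfl
      have hp₃ : t₃.mem .pow = s.mem .pow := (fr₃.mem .pow rfl).trans hp₂
      have hs₃ : t₃.mem .succ = succ := (fr₃.mem .succ rfl).trans hs₂
      rw [← Nat.add_assoc, Nat.succ_mul]
      apply Runs.loop (fun x t => I (2 ^ q + y + 1) ((2 ^ q + y) * k + x) t)
      · exact room.valK hk₃
      · exact h₃
      intro x hx t₄ fr₄ h₄
      have hk₄ : t₄.reg .k = k := (fr₄.reg .k rfl).trans hk₃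
      have vq : Val w (t₄.setReg .x x) (rd .q) q := room.valState ((fr₄.reg .q rfl).trans hq₃) hq
      have vy : Val w (t₄.setReg .x x) (rd .y) y :=
        room.valSet ((fr₄.reg .y rfl).trans hy₃) (by omega)
      have vx : Val w (t₄.setReg .x x) (rd .x) x := room.valCol rfl hx
      have vp : Val w (t₄.setReg .x x) (.get .pow (rd .q)) (2 ^ q) :=
        .get vq ((congrFun ((fr₄.mem .pow rfl).trans hp₃) q).trans (hp q (by omega)))
          (room.pow_le (by omega))
      have vs : Val w (t₄.setReg .x x) (.get .pow (rd .q) + rd .y) (2 ^ q + y) :=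
        vp.add vy (room.set (by omega))
      -- The row of y precedes the row of 2^q + y, so it is already complete when it is read.
      have hlt' : y * k + x < (2 ^ q + y) * k + x := by
        have := Nat.two_pow_pos q
        have : 0 < 2 ^ q * k := Nat.mul_pos this (by omega)
        rw [Nat.add_mul]
        omega
      have hdet := h₄.2 _ hlt'
      have hpow := room.pow_le (le_refl (n + 1))
      have hsq := hs _ (cell_lt hq hx)
      have vd : Val w (t₄.setReg .x x) (.get .det (cell (rd .y) (rd .x)))
          (t₄.mem .det (y * k + x)) :=
        .get (room.valSetCell hk₄ vy vx (by omega) hx) rfl (hdet.1.trans hpow)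
      have vu : Val w (t₄.setReg .x x) (.get .succ (cell (rd .q) (rd .x)))
          (succ (q * k + x)) :=
        .get (room.valCell hk₄ vq vx hq hx) (congrFun ((fr₄.mem .succ rfl).trans hs₃) _)
          (hsq.trans hpow)
      refine Runs.put (room.valSetCell hk₄ vs vx (by omega) hx) (vd.lor vu)
        ⟨h₄.1, fun j hj => ?_⟩
      rw [setMem_mem_self]
      split
      · next e =>
        subst e
        refine ⟨Nat.or_lt_two_pow hdet.1 hsq, fun b => ?_⟩
        rw [add_div_cell hx, add_mod_cell hx, Nat.testBit_or, Bool.or_eq_true, hdet.2 b,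
          add_div_cell hx, add_mod_cell hx]
        constructor
        · rintro (⟨p, hp, hb⟩ | hb)
          · exact ⟨p, (hbit p).mpr (.inl hp), hb⟩
          · exact ⟨q, (hbit q).mpr (.inr rfl), hb⟩
        · rintro ⟨p, hp, hb⟩
          rcases (hbit p).mp hp with hp | rfl
          · exact .inl ⟨p, hp, hb⟩
          · exact .inr hb
      · exact h₄.2 j (by omega)
    · intro t _ h
      rw [← mul_two, ← pow_succ] at h
      exact h
    · simp
      nlinarith [Nat.zero_le (2 ^ q)]
  · exact fun t _ h => h
  · have h := sum_two_pow_mul_le 4 (23 + 23 * k) (n + 1)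
    have h' : ∀ i, 3 + 2 ^ i * (23 + 23 * k) + 1 = 4 + 2 ^ i * (23 + 23 * k) := fun i => by omega
    have h2 : n + 1 < 2 ^ (n + 1) := Nat.lt_two_pow_self
    simp only [h', Expr.cost_add, Expr.cost_var, Expr.cost_one]
    nlinarith

/-- The word `v` is the closure of the state `q`. -/
def CloSpec (n : ℕ) (eps : ℕ → ℕ) (q v : ℕ) : Prop :=
  ∀ b, v.testBit b ↔ Relation.ReflTransGen (EpsEdge n eps) q b

theorem determinizeStep_runs {w k n : ℕ} (room : Room w k n) {s : Store Reg Arr}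
    (hk : s.reg .k = k) (hn : s.reg .n = n) (h_start : s.reg .start - 1 < n + 1)
    (h_start' : s.reg .start ≤ n)
    (he : ∀ j, s.mem .eps j ≤ 1) (hf : ∀ j, s.mem .nfa j ≤ 1) (hs : ∀ j, s.mem .succ j = 0) :
    Runs w (1000 * ((n + 1) * (n + 1) * (n + 1) * (k + 1) + (k + 1) * 2 ^ (n + 1)))
      determinizeStep s fun t =>
      t.mem .pow (n + 1) = 2 ^ (n + 1) ∧
      (∀ y < 2 ^ (n + 1), t.mem .detAcc y ≤ 1 ∧ (t.mem .detAcc y ≠ 0 ↔ y.testBit n)) ∧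
      (∃ clo succ : ℕ → ℕ, (∀ q < n + 1, CloSpec n (s.mem .eps) q (clo q)) ∧
        (∀ j < (n + 1) * k, SuccSpec n (s.mem .nfa) clo (n + 1) j (succ j)) ∧
        (∀ j < 2 ^ (n + 1) * k, DetSpec k n succ j (t.mem .det j)) ∧
        t.reg .detStart = clo (s.reg .start - 1)) ∧ t.reg .detStart < 2 ^ (n + 1) := by
  apply Runs.mono
  · apply Runs.assoc
    apply Runs.seq (c := powStep) (powStep_runs room hn)
    intro t₁ fr₁ h₁
    have hn₁ : t₁.reg .n = n := (fr₁.reg .n rfl).trans hn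
    apply Runs.seq (c := singletonStep) (singletonStep_runs room hn₁ h₁)
    intro t₂ fr₂ h₂
    have hn₂ : t₂.reg .n = n := (fr₂.reg .n rfl).trans hn₁
    have he₂ : t₂.mem .eps = s.mem .eps := (fr₂.mem .eps rfl).trans (fr₁.mem .eps rfl)
    apply Runs.seq (c := closureStep) (closureStep_runs room hn₂ (he₂ ▸ he) h₂)
    intro t₃ fr₃ h₃
    rw [he₂] at h₃
    have hn₃ : t₃.reg .n = n := (fr₃.reg .n rfl).trans hn₂
    have hk₃ : t₃.reg .k = k :=
      (fr₃.reg .k rfl).trans ((fr₂.reg .k rfl).trans ((fr₁.reg .k rfl).trans hk))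
    have hf₃ : t₃.mem .nfa = s.mem .nfa :=
      (fr₃.mem .nfa rfl).trans ((fr₂.mem .nfa rfl).trans (fr₁.mem .nfa rfl))
    have hs₃ : t₃.mem .succ = s.mem .succ :=
      (fr₃.mem .succ rfl).trans ((fr₂.mem .succ rfl).trans (fr₁.mem .succ rfl))
    apply Runs.seq (c := succStep)
      (succStep_runs room hk₃ hn₃ (hf₃ ▸ hf) (fun i hi => (h₃ i hi).1) (hs₃ ▸ hs))
    intro t₄ fr₄ h₄
    rw [hf₃] at h₄
    have hn₄ : t₄.reg .n = n := (fr₄.reg .n rfl).trans hn₃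
    have hk₄ : t₄.reg .k = k := (fr₄.reg .k rfl).trans hk₃
    apply Runs.assoc
    apply Runs.seq (c := emptyRowStep) (emptyRowStep_runs room hk₄)
    intro t₅ fr₅ h₅
    have hn₅ : t₅.reg .n = n := (fr₅.reg .n rfl).trans hn₄
    have hk₅ : t₅.reg .k = k := (fr₅.reg .k rfl).trans hk₄
    have hp₅ : t₅.mem .pow = t₁.mem .pow :=
      (fr₅.mem .pow rfl).trans ((fr₄.mem .pow rfl).trans
        ((fr₃.mem .pow rfl).trans (fr₂.mem .pow rfl)))
    have hs₅ : t₅.mem .succ = t₄.mem .succ := fr₅.mem .succ rfl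
    apply Runs.seq (c := subsetStep)
      (subsetStep_runs room hk₅ hn₅ (hp₅ ▸ h₁) (fun j hj => hs₅ ▸ (h₄ j hj).1) h₅.1 h₅.2)
    intro t₆ fr₆ h₆
    have hc₆ : t₆.mem .clo = t₃.mem .clo :=
      (fr₆.mem .clo rfl).trans ((fr₅.mem .clo rfl).trans (fr₄.mem .clo rfl))
    have hp₆ : t₆.mem .pow = t₁.mem .pow := (fr₆.mem .pow rfl).trans hp₅
    have h_start₆ : t₆.reg .start = s.reg .start :=
      (fr₆.reg .start rfl).trans <| (fr₅.reg .start rfl).trans <| (fr₄.reg .start rfl).trans <|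
        (fr₃.reg .start rfl).trans <| (fr₂.reg .start rfl).trans (fr₁.reg .start rfl)
    have hlt := (h₃ _ h_start).1
    rw [hs₅] at h₆
    have vs : Val w t₆ (rd .start - 1) (s.reg .start - 1) :=
      (Val.var h_start₆ (room.small (by omega))).sub room.valOne
    refine Runs.set (.get vs (congrFun hc₆ _) (hlt.trans (room.pow_le le_rfl)))
      (Q := fun t => t.mem .pow (n + 1) = 2 ^ (n + 1) ∧
      (∀ y < 2 ^ (n + 1), t.mem .detAcc y ≤ 1 ∧ (t.mem .detAcc y ≠ 0 ↔ y.testBit n)) ∧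
      (∃ clo succ : ℕ → ℕ, (∀ q < n + 1, CloSpec n (s.mem .eps) q (clo q)) ∧
        (∀ j < (n + 1) * k, SuccSpec n (s.mem .nfa) clo (n + 1) j (succ j)) ∧
        (∀ j < 2 ^ (n + 1) * k, DetSpec k n succ j (t.mem .det j)) ∧
        t.reg .detStart = clo (s.reg .start - 1)) ∧ t.reg .detStart < 2 ^ (n + 1)) ?_
    refine ⟨?_, h₆.1, ⟨t₃.mem .clo, t₄.mem .succ, fun q hq => (h₃ q hq).2, h₄, h₆.2, rfl⟩, hlt⟩
    rw [setReg_mem, hp₆]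
    exact h₁ _ (by omega)
  · exact fun _ _ h => h
  · have h : n + 1 ≤ (n + 1) * (n + 1) * (n + 1) * (k + 1) := by
      rw [Nat.mul_assoc, Nat.mul_assoc]
      exact Nat.le_mul_of_pos_right _ (by positivity)
    have h' : k + 1 ≤ (n + 1) * (n + 1) * (n + 1) * (k + 1) :=
      Nat.le_mul_of_pos_left _ (by positivity)
    have h2 : (n + 1) * (n + 1) * (k + 1) ≤ (n + 1) * (n + 1) * (n + 1) * (k + 1) := by
      gcongr
      exact Nat.le_mul_of_pos_right _ (by positivity)
    have h3 : (n + 1) * (n + 1) * (n + 1) ≤ (n + 1) * (n + 1) * (n + 1) * (k + 1) :=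
      Nat.le_mul_of_pos_right _ (by positivity)
    simp only [Expr.cost_get, Expr.cost_sub, Expr.cost_var, Expr.cost_one]
    omega

/-! ### The new initial state and the removal of unmarked states. -/

theorem Room.valTop {w k n : ℕ} (room : Room w k n) {s : Store Reg Arr} (hn : s.reg .n = n)
    (hp : s.mem .pow (n + 1) = 2 ^ (n + 1)) :
    Val w s (.get .pow (rd .n + 1)) (2 ^ (n + 1)) :=
  .get (room.valN1 hn) hp (room.pow_le le_rfl)

theorem unionStep_runs {w k n : ℕ} (room : Room w k n) {s : Store Reg Arr} (hk : s.reg .k = k)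
    (hn : s.reg .n = n) (hp : s.mem .pow (n + 1) = 2 ^ (n + 1))
    (hst : s.reg .detStart < 2 ^ (n + 1))
    (hd : ∀ j < 2 ^ (n + 1) * k, s.mem .det j < 2 ^ (n + 1)) :
    Runs w (40 * (k + 1)) unionStep s fun t =>
      (∀ j < 2 ^ (n + 1) * k, t.mem .det j = s.mem .det j) ∧
      (∀ x < k, t.mem .det (2 ^ (n + 1) * k + x) = s.mem .det (s.reg .detStart * k + x)) ∧
      (∀ y < 2 ^ (n + 1), t.mem .detAcc y = s.mem .detAcc y) ∧
      t.mem .detAcc (2 ^ (n + 1)) = 1 ∧ t.reg .detStart = 2 ^ (n + 1) := by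
  set d := s.reg .detStart with hdef
  let I : ℕ → Store Reg Arr → Prop := fun i t =>
    (∀ j < 2 ^ (n + 1) * k, t.mem .det j = s.mem .det j) ∧
      ∀ x < i, t.mem .det (2 ^ (n + 1) * k + x) = s.mem .det (d * k + x)
  apply Runs.mono
  · apply Runs.seq (Q₁ := I k)
    · apply Runs.loop I (room.valK hk)
      · exact ⟨fun _ _ => rfl, by simp⟩
      intro x hx t fr h
      have hk' : t.reg .k = k := (fr.reg .k rfl).trans hk
      have vx : Val w (t.setReg .x x) (rd .x) x := room.valCol rfl hx
      have vd : Val w (t.setReg .x x) (rd .detStart) d :=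
        room.valSet (fr.reg .detStart rfl) (by omega)
      have vt : Val w (t.setReg .x x) (.get .pow (rd .n + 1)) (2 ^ (n + 1)) :=
        room.valTop ((fr.reg .n rfl).trans hn) ((congrFun (fr.mem .pow rfl) _).trans hp)
      have hlt := cell_lt hst hx
      refine Runs.put (room.valSetCell hk' vt vx (by omega) hx)
        (.get (room.valSetCell hk' vd vx (by omega) hx) (h.1 _ hlt)
          ((hd _ hlt).trans (room.pow_le le_rfl))) ⟨fun j hj => ?_, fun y hy => ?_⟩ <;>
        rw [setMem_mem_self]
      · rw [if_neg (by omega)]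
        exact h.1 j hj
      · split
        · next e => rw [show y = x by omega]
        · exact h.2 y (by omega)
    intro t₁ fr₁ h₁
    have hp₁ : t₁.mem .pow (n + 1) = 2 ^ (n + 1) := (congrFun (fr₁.mem .pow rfl) _).trans hp
    have hn₁ : t₁.reg .n = n := (fr₁.reg .n rfl).trans hn
    apply Runs.seq (Q₁ := fun t => I k t ∧ (∀ y < 2 ^ (n + 1), t.mem .detAcc y = s.mem .detAcc y) ∧
      t.mem .detAcc (2 ^ (n + 1)) = 1)
    · refine Runs.put (room.valTop hn₁ hp₁) room.valOne ⟨h₁, fun y hy => ?_, ?_⟩ <;>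
        rw [setMem_mem_self]
      · rw [if_neg hy.ne, fr₁.mem .detAcc rfl]
      · rw [if_pos rfl]
    intro t₂ fr₂ h₂
    have hp₂ : t₂.mem .pow (n + 1) = 2 ^ (n + 1) := (congrFun (fr₂.mem .pow rfl) _).trans hp₁
    exact Runs.set (room.valTop ((fr₂.reg .n rfl).trans hn₁) hp₂)
      (Q := fun t => (I k t ∧ (∀ y < 2 ^ (n + 1), t.mem .detAcc y = s.mem .detAcc y) ∧
        t.mem .detAcc (2 ^ (n + 1)) = 1) ∧ t.reg .detStart = 2 ^ (n + 1)) ⟨h₂, rfl⟩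
  · exact fun _ _ h => ⟨h.1.1.1, h.1.1.2, h.1.2.1, h.1.2.2, h.2⟩
  · simp
    omega

/-- The states `y` of the table `da` with a mark are numbered `1, …, N` by `num`. -/
structure Numbering (M : ℕ) (da num : ℕ → ℕ) (N : ℕ) : Prop where
  le : ∀ y < M, num y ≤ N
  ne_zero_iff : ∀ y < M, num y ≠ 0 ↔ da y ≠ 0
  inj : ∀ y < M, ∀ z < M, num y ≠ 0 → num y = num z → y = z
  surj : ∀ i < N, ∃ y < M, num y = i + 1

theorem Numbering.skip {M N : ℕ} {da num : ℕ → ℕ} (h : Numbering M da num N) (hM : da M = 0)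
    (h0 : num M = 0) : Numbering (M + 1) da num N where
  le y hy := by
    rcases Nat.lt_succ_iff_lt_or_eq.mp hy with hy | rfl
    · exact h.le y hy
    · omega
  ne_zero_iff y hy := by
    rcases Nat.lt_succ_iff_lt_or_eq.mp hy with hy | rfl
    · exact h.ne_zero_iff y hy
    · simp [hM, h0]
  inj y hy z hz hne he := by
    rcases Nat.lt_succ_iff_lt_or_eq.mp hy with hy | rfl
    · rcases Nat.lt_succ_iff_lt_or_eq.mp hz with hz | rfl
      · exact h.inj y hy z hz hne he
      · omega
    · exact absurd h0 hne
  surj i hi := by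
    obtain ⟨y, hy, e⟩ := h.surj i hi
    exact ⟨y, by omega, e⟩

/-- The number N + 1 is fresh because all earlier numbers are at most N. The number 0 is reserved
for discarded states; it agrees with the code for an undefined transition, so `num` of a target can
be written into the output unchanged. -/
theorem Numbering.next {M N : ℕ} {da num : ℕ → ℕ} (h : Numbering M da num N) (hM : da M ≠ 0) :
    Numbering (M + 1) da (fun y => if y = M then N + 1 else num y) (N + 1) where
  le y hy := by
    split
    · exact le_rfl
    · exact (h.le y (by omega)).trans (Nat.le_succ N)
  ne_zero_iff y hy := by
    split
    · next e => simp [e, hM]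
    · exact h.ne_zero_iff y (by omega)
  inj y hy z hz := by
    have hy' := h.le y
    have hz' := h.le z
    have hyz := h.inj y
    split <;> split
    · omega
    · have := hz' (by omega)
      omega
    · have := hy' (by omega)
      omega
    · exact fun h1 h2 => hyz (by omega) z (by omega) h1 h2
  surj i hi := by
    rcases Nat.lt_succ_iff_lt_or_eq.mp hi with hi | rfl
    · obtain ⟨y, hy, e⟩ := h.surj i hi
      exact ⟨y, by omega, by rw [if_neg (by omega), e]⟩
    · exact ⟨M, by omega, if_pos rfl⟩

theorem supStep_runs {w k n : ℕ} (room : Room w k n) {s : Store Reg Arr} (hk : s.reg .k = k)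
    (hn : s.reg .n = n) (hp : s.mem .pow (n + 1) = 2 ^ (n + 1))
    (hst : s.reg .detStart < 2 ^ (n + 1) + 1)
    (ha : ∀ y < 2 ^ (n + 1) + 1, s.mem .detAcc y ≤ 1)
    (hd : ∀ j < (2 ^ (n + 1) + 1) * k, s.mem .det j < 2 ^ (n + 1) + 1)
    (hnum : ∀ y, s.mem .num y = 0) :
    Runs w (200 * ((k + 1) * 2 ^ (n + 1))) supStep s fun t => ∃ num : ℕ → ℕ,
      Numbering (2 ^ (n + 1) + 1) (s.mem .detAcc) num (t.reg .outN) ∧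
      (∀ y < 2 ^ (n + 1) + 1, num y ≠ 0 → t.mem .outAcc (num y - 1) = 1 ∧
        ∀ x < k, t.mem .outDelta ((num y - 1) * k + x) = num (s.mem .det (y * k + x))) ∧
      t.reg .outStart = num (s.reg .detStart) := by
  set da := s.mem .detAcc with hda
  set det := s.mem .det with hdet
  set M := 2 ^ (n + 1) + 1 with hM
  apply Runs.mono
  · apply Runs.seq (Q₁ := fun t => t.reg .outN = 0)
    · exact Runs.set .zero rfl
    intro t₁ fr₁ h₁
    have hk₁ : t₁.reg .k = k := (fr₁.reg .k rfl).trans hk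
    have hn₁ : t₁.reg .n = n := (fr₁.reg .n rfl).trans hn
    have hp₁ : t₁.mem .pow = s.mem .pow := fr₁.mem .pow rfl
    have vM₁ : Val w t₁ (.get .pow (rd .n + 1) + 1) M :=
      (room.valTop hn₁ (hp₁ ▸ hp)).add room.valOne (room.set le_rfl)
    -- The bound of the counter by the number of rounds is what keeps it within the word length; the
    -- zeros beyond y supply the number 0 of a state that is skipped.
    let I : ℕ → Store Reg Arr → Prop := fun y t => t.reg .outN ≤ y ∧
      Numbering y da (t.mem .num) (t.reg .outN) ∧ ∀ z ≥ y, t.mem .num z = 0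
    apply Runs.seq (Q₁ := I M)
    · apply Runs.loop I vM₁
      · refine ⟨h₁.le, ?_, fun z _ => ?_⟩
        · rw [h₁]
          constructor <;> simp
        · rw [fr₁.mem .num rfl]
          exact hnum z
      intro y hy t fr h
      have ha' : t.mem .detAcc = da := (fr.mem .detAcc rfl).trans (fr₁.mem .detAcc rfl)
      have vy : Val w (t.setReg .y y) (rd .y) y := room.valSet rfl hy
      have va : Val w (t.setReg .y y) (.get .detAcc (rd .y)) (da y) :=
        .get vy (congrFun ha' y) (room.small ((ha y hy).trans (by omega)))
      have hle := h.1
      apply Runs.when va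
      · intro hne
        apply Runs.seq (Q₁ := fun t' => t'.mem = t.mem ∧ t'.reg .outN = t.reg .outN + 1 ∧
          t'.reg .y = y)
        · exact Runs.set ((Val.var rfl (room.set (v := t.reg .outN) (by omega))).add room.valOne
            (room.set (by omega))) ⟨rfl, rfl, rfl⟩
        rintro t' fr' ⟨hm, ho, hy'⟩
        refine Runs.put (room.valSet hy' hy) (.var ho (room.set (by omega)))
          ⟨?_, ?_, fun z hz => ?_⟩
        · change t'.reg .outN ≤ y + 1
          omega
        · change Numbering _ _ _ (t'.reg .outN)
          rw [ho]
          convert h.2.1.next hne using 1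
          funext z
          rw [setMem_mem_self, hm]
        · rw [setMem_mem_self, if_neg (by omega), hm]
          exact h.2.2 z (by omega)
      · intro h0
        exact ⟨Nat.le_succ_of_le hle, h.2.1.skip h0 (h.2.2 y le_rfl),
          fun z hz => h.2.2 z (by omega)⟩
    intro t₂ fr₂ h₂
    have hk₂ : t₂.reg .k = k := (fr₂.reg .k rfl).trans hk₁
    have hn₂ : t₂.reg .n = n := (fr₂.reg .n rfl).trans hn₁
    have hp₂ : t₂.mem .pow = s.mem .pow := (fr₂.mem .pow rfl).trans hp₁
    have ha₂ : t₂.mem .detAcc = da := (fr₂.mem .detAcc rfl).trans (fr₁.mem .detAcc rfl)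
    have hd₂ : t₂.mem .det = det := (fr₂.mem .det rfl).trans (fr₁.mem .det rfl)
    have hs₂ : t₂.reg .detStart = s.reg .detStart :=
      (fr₂.reg .detStart rfl).trans (fr₁.reg .detStart rfl)
    have vM₂ : Val w t₂ (.get .pow (rd .n + 1) + 1) M :=
      (room.valTop hn₂ (hp₂ ▸ hp)).add room.valOne (room.set le_rfl)
    obtain ⟨hle, hnumb, -⟩ := h₂
    set num := t₂.mem .num with hnumdef
    let J : ℕ → Store Reg Arr → Prop := fun y t =>
      ∀ z < y, num z ≠ 0 → t.mem .outAcc (num z - 1) = 1 ∧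
        ∀ x < k, t.mem .outDelta ((num z - 1) * k + x) = num (det (z * k + x))
    apply Runs.seq (Q₁ := J M)
    · apply Runs.loop J vM₂
      · exact fun _ h => absurd h (Nat.not_lt_zero _)
      intro y hy t fr h
      have ha' : t.mem .detAcc = da := (fr.mem .detAcc rfl).trans ha₂
      have hn' : t.mem .num = num := fr.mem .num rfl
      have vy : Val w (t.setReg .y y) (rd .y) y := room.valSet rfl hy
      have va : Val w (t.setReg .y y) (.get .detAcc (rd .y)) (da y) :=
        .get vy (congrFun ha' y) (room.small ((ha y hy).trans (by omega)))
      apply Runs.when va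
      · intro hne
        have hny : num y ≠ 0 := (hnumb.ne_zero_iff y hy).mpr hne
        have hyle := hnumb.le y hy
        have vn : Val w (t.setReg .y y) (.get .num (rd .y) - 1) (num y - 1) :=
          (Val.get vy (congrFun hn' y) (room.set (by omega))).sub room.valOne
        apply Runs.seq (Q₁ := fun t => J y t ∧ t.mem .outAcc (num y - 1) = 1)
        · refine Runs.put vn room.valOne ⟨fun z hz hnz => ⟨?_, (h z hz hnz).2⟩, ?_⟩ <;>
            rw [setMem_mem_self]
          · split
            · rfl
            · exact (h z hz hnz).1
          · rw [if_pos rfl]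
        intro t' fr' h'
        have hk'' : t'.reg .k = k := (fr'.reg .k rfl).trans ((fr.reg .k rfl).trans hk₂)
        have hy'' : t'.reg .y = y := fr'.reg .y rfl
        have hn'' : t'.mem .num = num := (fr'.mem .num rfl).trans hn'
        have hd'' : t'.mem .det = det := (fr'.mem .det rfl).trans ((fr.mem .det rfl).trans hd₂)
        let L : ℕ → Store Reg Arr → Prop := fun i t => (J y t ∧ t.mem .outAcc (num y - 1) = 1) ∧
          ∀ x < i, t.mem .outDelta ((num y - 1) * k + x) = num (det (y * k + x))
        apply Runs.conseq (Q₁ := L k)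
        · intro u _ hu z hz hnz
          rcases Nat.lt_succ_iff_lt_or_eq.mp hz with hz | rfl
          · exact hu.1.1 z hz hnz
          · exact ⟨hu.1.2, hu.2⟩
        apply Runs.loop L
        · exact room.valK hk''
        · exact ⟨h', by simp⟩
        intro x hx u fru hu
        have hku : u.reg .k = k := (fru.reg .k rfl).trans hk''
        have hnu : u.mem .num = num := (fru.mem .num rfl).trans hn''
        have hdu : u.mem .det = det := (fru.mem .det rfl).trans hd''
        have vx : Val w (u.setReg .x x) (rd .x) x := room.valCol rfl hx
        have vy : Val w (u.setReg .x x) (rd .y) y := room.valSet ((fru.reg .y rfl).trans hy'') hy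
        have vn : Val w (u.setReg .x x) (.get .num (rd .y) - 1) (num y - 1) :=
          (Val.get vy (congrFun hnu y) (room.set (by omega))).sub room.valOne
        have hdlt := hd _ (cell_lt hy hx)
        have hdle := hnumb.le _ hdlt
        have vd : Val w (u.setReg .x x) (.get .det (cell (rd .y) (rd .x))) (det (y * k + x)) :=
          .get (room.valSetCell hku vy vx hy hx) (congrFun hdu _) (room.set hdlt.le)
        refine Runs.put (room.valSetCell hku vn vx (by omega) hx)
          (.get vd (congrFun hnu _) (room.set (by omega)))
          ⟨⟨fun z hz hnz => ⟨(hu.1.1 z hz hnz).1, fun x' hx' => ?_⟩, hu.1.2⟩, fun x' hx' => ?_⟩ <;>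
          rw [setMem_mem_self]
        · rw [if_neg fun e => ?_]
          · exact (hu.1.1 z hz hnz).2 x' hx'
          · have := (cell_inj hx' hx e).1
            have := hnumb.inj z (by omega) y hy hnz (by omega)
            omega
        · split
          · next e => rw [show x' = x by omega]
          · exact hu.2 x' (by omega)
      · intro h0 z hz hnz
        rcases Nat.lt_succ_iff_lt_or_eq.mp hz with hz | rfl
        · exact h z hz hnz
        · exact absurd h0 ((hnumb.ne_zero_iff z hy).mp hnz)
    intro t₃ fr₃ h₃
    have hn₃ : t₃.mem .num = num := fr₃.mem .num rfl
    have ho₃ : t₃.reg .outN = t₂.reg .outN := fr₃.reg .outN rfl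
    have hle' := hnumb.le _ hst
    refine Runs.set (.get (room.valSet ((fr₃.reg .detStart rfl).trans hs₂) hst)
      (congrFun hn₃ _) (room.set (by omega))) (Q := fun t : Store Reg Arr => ∃ num : ℕ → ℕ,
      Numbering M da num (t.reg .outN) ∧
      (∀ y < M, num y ≠ 0 → t.mem .outAcc (num y - 1) = 1 ∧
        ∀ x < k, t.mem .outDelta ((num y - 1) * k + x) = num (det (y * k + x))) ∧
      t.reg .outStart = num (s.reg .detStart)) ⟨num, ?_, h₃, rfl⟩
    change Numbering _ _ _ (t₃.reg .outN)
    rw [ho₃]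
    exact hnumb
  · exact fun _ _ h => h
  · have h2 : n + 1 < 2 ^ (n + 1) := Nat.lt_two_pow_self
    simp
    nlinarith [Nat.zero_le (k * 2 ^ (n + 1))]

/-! ## The infimal prefix-closed and observable superlanguage -/

section Languages

variable {α Δ : Type} {P : Mask α Δ} {K : Language α}

theorem subset_prefixClosure (K : Language α) {w : List α} (h : w ∈ K) : w ∈ prefixClosure K :=
  ⟨[], by simpa using h⟩

theorem prefixClosed_prefixClosure (K : Language α) : PrefixClosed (prefixClosure K) :=
  fun u v ⟨v', h⟩ => ⟨v ++ v', by simpa using h⟩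

/-- After a string that looks like `s`, the event `a` may occur in the prefix closure of `K`. -/
def Enabled (P : Mask α Δ) (K : Language α) (s : List α) (a : α) : Prop :=
  ∃ u, P.word u = P.word s ∧ u ++ [a] ∈ prefixClosure K

/-- The empty language is itself prefix-closed and observable. It needs separate treatment because
the criterion for nonempty K always admits the empty string. -/
theorem infO_empty (P : Mask α Δ) : infO P (0 : Language α) = 0 := by
  refine le_antisymm (fun w hw => ?_) (fun w hw => hw.elim)
  exact hw 0 le_rfl (fun _ _ h => h) fun _ _ _ h => by
    obtain ⟨_, h⟩ := h
    exact h.elim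

/-- The right-hand side defines a language that is observable because `Enabled` sees a string only
through its mask image. Conversely, observability forces each justified event in turn, starting from
the empty string, which is present since K is nonempty. -/
theorem mem_infO_iff (hK : ∃ w, w ∈ K) (w : List α) :
    w ∈ infO P K ↔ ∀ u a v, u ++ [a] ++ v = w → Enabled P K u a := by
  let M : Language α := {w | ∀ u a v, u ++ [a] ++ v = w → Enabled P K u a}
  have hM : PrefixClosed M := fun u v huv u' a v' h =>
    huv u' a (v' ++ v) (by rw [← h]; simp)
  constructor
  · refine fun hw => hw M ?_ hM ?_
    · rintro x hx u a v rfl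
      exact ⟨u, rfl, prefixClosed_prefixClosure K _ v (subset_prefixClosure K hx)⟩
    · intro s t a _ ht hst hsa
      rw [mem_prefixClosure_iff hM] at ht hsa ⊢
      intro u b v h
      -- Either the prefix is all of ta, and the justification after s carries over to t; or it is a
      -- prefix of t, and membership of t suffices.
      rcases List.eq_nil_or_concat v with rfl | ⟨v', c, rfl⟩
      · rw [List.append_nil] at h
        obtain ⟨rfl, h⟩ := List.append_inj' h rfl
        obtain rfl : b = a := by simpa using h
        obtain ⟨x, hx, hxa⟩ := hsa s b [] (by simp)
        exact ⟨x, hx.trans hst, hxa⟩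
      · rw [List.concat_eq_append, ← List.append_assoc] at h
        exact ht u b v' (List.append_inj' h rfl).1
  · intro hw N h1 h2 h3
    have h1' : prefixClosure K ≤ N := fun x ⟨v, hx⟩ => h2 x v (h1 hx)
    induction w using List.reverseRecOn with
    | nil =>
      obtain ⟨x, hx⟩ := hK
      exact h2 [] x (h1 hx)
    | append_singleton s a ih =>
      -- The justifying string u and its extension ua lie in N with the prefix closure of K.
      -- Observability of N then transfers a from u to its look-alike s.
      obtain ⟨u, hu, hua⟩ := hw s a [] (by simp)
      have hs : s ∈ N := ih fun u b v h => hw u b (v ++ [a]) (by rw [← h]; simp)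
      have := h3 u s a
      simp only [mem_prefixClosure_iff h2] at this
      exact this (h2 u [a] (h1' hua)) hs hu (h1' hua)

theorem append_singleton_mem_infO_iff (hK : ∃ w, w ∈ K) (s : List α) (a : α) :
    s ++ [a] ∈ infO P K ↔ s ∈ infO P K ∧ Enabled P K s a := by
  refine ⟨fun h => ⟨(infO_isLeast P K).1.2.1 s [a] h, (mem_infO_iff hK _).mp h s a [] (by simp)⟩,
    fun h => (mem_infO_iff hK _).mpr fun u b v e => ?_⟩
  rcases List.eq_nil_or_concat v with rfl | ⟨v', c, rfl⟩
  · rw [List.append_nil] at e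
    obtain ⟨rfl, e⟩ := List.append_inj' e rfl
    obtain rfl : b = a := by simpa using e
    exact h.2
  · rw [List.concat_eq_append, ← List.append_assoc] at e
    exact (mem_infO_iff hK _).mp h.1 u b v' (List.append_inj' e rfl).1

theorem nil_mem_infO (hK : ∃ w, w ∈ K) : [] ∈ infO P K :=
  (mem_infO_iff hK _).mpr fun u a v h => by simp at h

theorem word_append (P : Mask α Δ) (u v : List α) : P.word (u ++ v) = P.word u ++ P.word v :=
  List.filterMap_append

end Languages

/-! ## Runs of deterministic automata -/

namespace PDFA

variable {α : Type} {n : ℕ} (A : PDFA α n)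

/-- The state reached from `o` by the string `w`. -/
def evalFrom (o : Option (Fin n)) (w : List α) : Option (Fin n) :=
  w.foldl (fun o a => o.bind fun q => A.step q a) o

theorem eval_append (u v : List α) : A.eval (u ++ v) = A.evalFrom (A.eval u) v :=
  List.foldl_append

theorem eval_append_singleton (u : List α) (a : α) :
    A.eval (u ++ [a]) = (A.eval u).bind fun q => A.step q a := A.eval_append u [a]

theorem evalFrom_none (w : List α) : A.evalFrom none w = none := by
  induction w with
  | nil => rfl
  | cons a w ih => exact ih

theorem evalFrom_cons (q : Fin n) (a : α) (w : List α) :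
    A.evalFrom (some q) (a :: w) = A.evalFrom (A.step q a) w := rfl

/-- The states reached by pairwise inequivalent strings are different. -/
theorem card_le_of_distinguishable {N : ℕ} (B : PDFA α N) {ι : Type} [Fintype ι]
    (W : ι → List α) (hW : ∀ i, ∃ z, W i ++ z ∈ B.marked)
    (h : ∀ i j, i ≠ j → ∃ z, ¬(W i ++ z ∈ B.marked ↔ W j ++ z ∈ B.marked)) :
    Fintype.card ι ≤ N := by
  -- Transitions are partial, but some extension of each string is marked, so the run on the string
  -- itself is defined.
  have hs : ∀ i, ∃ q, B.eval (W i) = some q := fun i => by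
    obtain ⟨z, q, hz, -⟩ := hW i
    rw [eval_append] at hz
    cases e : B.eval (W i) with
    | none => simp [e, evalFrom_none] at hz
    | some q => exact ⟨q, rfl⟩
  choose f hf using hs
  have inj : Function.Injective f := fun i j hij => by
    by_contra hne
    obtain ⟨z, hz⟩ := h i j hne
    refine hz (exists_congr fun q => ?_)
    rw [eval_append, eval_append, hf, hf, hij]
  simpa using Fintype.card_le_of_injective f inj

end PDFA

/-- The existence of an automaton is needed because the infimum of the empty set of numbers is 0. -/
theorem le_stateComplexity {α : Type} {L : Language α} {N : ℕ}
    (hL : ∃ n, 0 < n ∧ ∃ A : PDFA α n, A.marked = L)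
    (h : ∀ n, ∀ A : PDFA α n, A.marked = L → N ≤ n) : N ≤ stateComplexity L := by
  obtain ⟨_, A, hA⟩ := Nat.sInf_mem (s := {n | 0 < n ∧ ∃ A : PDFA α n, A.marked = L}) hL
  exact h _ A hA

theorem stateComplexity_eq {α : Type} {n : ℕ} (hn : 0 < n) (A : PDFA α n)
    (h : ∀ N, ∀ B : PDFA α N, B.marked = A.marked → n ≤ N) : stateComplexity A.marked = n :=
  le_antisymm (Nat.sInf_le ⟨hn, A, rfl⟩) (le_stateComplexity ⟨n, hn, A, rfl⟩ h)

/-! ## Automata with large infimal superlanguages -/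

namespace Ring

variable {k n : ℕ}

/-- The states form a ring. The event `0` moves every state `j > 0` to `j - 1` and the state `0` to
`n - 1`, the event `2` only moves the states `j > 0`, and the event `1` is a loop at `0`. -/
def aut (k n : ℕ) : PDFA (Fin k) n where
  step j x :=
    if x.val = 0 then some ⟨if j.val = 0 then n - 1 else j - 1, by have := j.2; split <;> omega⟩
    else if x.val = 1 then if j.val = 0 then some j else none
    else if x.val = 2 then if j.val = 0 then none else some ⟨j - 1, by have := j.2; omega⟩
    else none
  start := if h : 0 < n then some ⟨0, h⟩ else none
  accept j := j.val = 0

/-- The events `0` and `1` look alike. -/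
def mask (k : ℕ) : Mask (Fin k) (Fin k) := fun x =>
  some ⟨if x.val = 1 then 0 else x, by have := x.2; split <;> omega⟩

variable (hk : 3 ≤ k)

/-- The event that rotates the ring. -/
def rot : Fin k := ⟨0, by omega⟩
/-- The event that loops at `0`. -/
def test : Fin k := ⟨1, by omega⟩
/-- The event that moves the states other than `0`. -/
def drop : Fin k := ⟨2, by omega⟩

theorem evalFrom_drop (i : ℕ) (q : Fin n) :
    (aut k n).evalFrom (some q) (List.replicate i (drop hk)) =
      if h : i ≤ q then some ⟨q - i, by omega⟩ else none := by
  induction i generalizing q with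
  | zero => simp [PDFA.evalFrom]
  | succ i ih =>
    rw [List.replicate_succ, PDFA.evalFrom_cons]
    by_cases hq : q.val = 0
    · have : (aut k n).step q (drop hk) = none := by simp [aut, drop, hq]
      rw [this, PDFA.evalFrom_none, dif_neg (by omega)]
    · have : (aut k n).step q (drop hk) = some ⟨q - 1, by omega⟩ := by simp [aut, drop, hq]
      rw [this, ih]
      simp only
      split <;> split
      · simp only [Option.some.injEq, Fin.mk.injEq]
        omega
      · omega
      · omega
      · rfl

theorem eval_rot (hn : 0 < n) (i : ℕ) (hi : i < n) :
    (aut k n).eval (List.replicate (i + 1) (rot hk)) = some ⟨n - 1 - i, by omega⟩ := by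
  induction i with
  | zero => simp [PDFA.eval, aut, hn, rot]
  | succ i ih =>
    rw [List.replicate_succ', PDFA.eval_append_singleton, ih (by omega)]
    have : ¬ n - 1 - i = 0 := by omega
    simp only [Option.bind_some, aut, rot, this, if_true, if_false, Option.some.injEq, Fin.mk.injEq]
    omega

/-- Every state q is live: `drop`, taken q times, leads from it to the marked state 0. -/
theorem mem_prefixClosure_iff (hk : 3 ≤ k) (hn : 0 < n) (u : List (Fin k)) :
    u ∈ prefixClosure (aut k n).marked ↔ ∃ q, (aut k n).eval u = some q := by
  constructor
  · rintro ⟨v, q, h, -⟩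
    rw [PDFA.eval_append] at h
    cases e : (aut k n).eval u with
    | none => simp [e, PDFA.evalFrom_none] at h
    | some q => exact ⟨q, rfl⟩
  · rintro ⟨q, h⟩
    refine ⟨List.replicate q (drop hk), ⟨0, hn⟩, ?_, by simp [aut]⟩
    rw [PDFA.eval_append, h, evalFrom_drop, dif_pos le_rfl]
    simp

theorem stateComplexity_marked (hk : 3 ≤ k) (hn : 0 < n) :
    stateComplexity (aut k n).marked = n := by
  refine stateComplexity_eq hn _ fun N B hB => ?_
  -- Rotating n - i times leads to the state i, and from there `drop` taken j times ends in the
  -- marked state 0 only for j = i. So all n states are distinguishable.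
  have key : ∀ i j : Fin n, List.replicate (n - 1 - i + 1) (rot hk) ++
      List.replicate j (drop hk) ∈ (aut k n).marked ↔ j = i := by
    intro i j
    have e : n - 1 - (n - 1 - i.val) = i := by omega
    constructor
    · rintro ⟨q, h, hq⟩
      rw [PDFA.eval_append, eval_rot hk hn _ (by omega), evalFrom_drop] at h
      simp only [e] at h
      split at h
      · simp only [Option.some.injEq] at h
        subst h
        simp only [aut, decide_eq_true_eq] at hq
        omega
      · simp at h
    · rintro rfl
      refine ⟨⟨0, hn⟩, ?_, by simp [aut]⟩
      rw [PDFA.eval_append, eval_rot hk hn _ (by omega), evalFrom_drop]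
      simp only [e]
      rw [dif_pos le_rfl]
      simp
  have := B.card_le_of_distinguishable (fun i : Fin n => List.replicate (n - 1 - i + 1) (rot hk))
    (fun i => ⟨_, hB ▸ (key i i).mpr rfl⟩)
    (fun i j hij => ⟨List.replicate i (drop hk), by simp [hB, key, hij]⟩)
  simpa using this

/-- The state `q` can be reached by a string that looks like `s`. -/
def Reach (k n : ℕ) (s : List (Fin k)) (q : ℕ) : Prop :=
  ∃ u p, (mask k).word u = (mask k).word s ∧ (aut k n).eval u = some p ∧ p.val = q

theorem reach_nil (hn : 0 < n) (q : ℕ) : Reach k n [] q ↔ q = 0 := by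
  constructor
  · rintro ⟨u, p, hu, hp, rfl⟩
    cases u with
    | nil =>
      simp only [PDFA.eval, List.foldl_nil, aut, hn, dif_pos, Option.some.injEq] at hp
      exact hp ▸ rfl
    | cons x u => simp [Mask.word, mask] at hu
  · rintro rfl
    exact ⟨[], ⟨0, hn⟩, rfl, by simp [PDFA.eval, aut, hn], rfl⟩

/-- All events are observable for this mask, so a look-alike of sx is a look-alike of s followed by
one event with the same mask value as x. -/
theorem reach_append_singleton (s : List (Fin k)) (x : Fin k) (q : ℕ) :
    Reach k n (s ++ [x]) q ↔ ∃ p : Fin n, Reach k n s p ∧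
      ∃ y r, mask k y = mask k x ∧ (aut k n).step p y = some r ∧ r.val = q := by
  have hw : ∀ x : Fin k, ∃ d, mask k x = some d := fun x => ⟨_, rfl⟩
  have hword : ∀ (u : List (Fin k)) x d, mask k x = some d →
      (mask k).word (u ++ [x]) = (mask k).word u ++ [d] := by
    intro u x d h
    rw [word_append]
    simp [Mask.word, h]
  obtain ⟨d, hd⟩ := hw x
  constructor
  · rintro ⟨u, p, hu, hp, rfl⟩
    rw [hword s x d hd] at hu
    rcases List.eq_nil_or_concat u with rfl | ⟨v, y, rfl⟩
    · simp [Mask.word] at hu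
    · rw [List.concat_eq_append] at hu hp
      obtain ⟨d', hd'⟩ := hw y
      rw [hword v y d' hd'] at hu
      obtain ⟨h1, h2⟩ := List.append_inj' hu rfl
      rw [PDFA.eval_append_singleton, Option.bind_eq_some_iff] at hp
      obtain ⟨p', hp', hstep⟩ := hp
      refine ⟨p', ⟨v, p', h1, hp', rfl⟩, y, p, ?_, hstep, rfl⟩
      rw [hd, hd', (by simpa using h2 : d' = d)]
  · rintro ⟨p, ⟨u, p', hu, hp', hpp⟩, y, r, hy, hr, rfl⟩
    obtain rfl : p' = p := Fin.ext hpp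
    refine ⟨u ++ [y], r, ?_, ?_, rfl⟩
    · rw [hword s x d hd, hword u y d (hy.trans hd), hu]
    · rw [PDFA.eval_append_singleton, hp']
      exact hr

theorem Reach.lt {s : List (Fin k)} {q : ℕ} (h : Reach k n s q) : q < n := by
  obtain ⟨_, p, _, _, rfl⟩ := h
  exact p.2

/-- An observer of `rot` cannot exclude `test`. All tokens move down by one; a token at 0 moves to n
- 1 and, by the loop under `test`, also remains at 0. -/
theorem reach_rot (hn : 0 < n) (s : List (Fin k)) (q : ℕ) :
    Reach k n (s ++ [rot hk]) q ↔
      Reach k n s (q + 1) ∨ (Reach k n s 0 ∧ (q = n - 1 ∨ q = 0)) := by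
  rw [reach_append_singleton]
  constructor
  · rintro ⟨p, hp, y, r, hy, hr, rfl⟩
    simp only [mask, rot, Option.some.injEq, Fin.mk.injEq, zero_ne_one, if_false] at hy
    by_cases h0 : p.val = 0
    · right
      refine ⟨h0 ▸ hp, ?_⟩
      have hy' : y.val = 0 ∨ y.val = 1 := by split at hy <;> omega
      rcases hy' with hy' | hy'
      · simp only [aut, hy', h0, if_true, Option.some.injEq] at hr
        exact .inl (hr ▸ rfl)
      · simp only [aut, hy', h0, if_true, one_ne_zero, if_false, Option.some.injEq] at hr
        exact .inr (hr ▸ h0)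
    · left
      have hy' : y.val = 0 ∨ y.val = 1 := by split at hy <;> omega
      rcases hy' with hy' | hy'
      · simp only [aut, hy', h0, if_true, if_false, Option.some.injEq] at hr
        rw [← hr]
        simpa only [Nat.sub_add_cancel (Nat.pos_of_ne_zero h0)] using hp
      · simp [aut, hy', h0] at hr
  · rintro (h | ⟨h, hq⟩)
    · exact ⟨⟨q + 1, h.lt⟩, h, rot hk, ⟨q, by have := h.lt; omega⟩, rfl, by simp [aut, rot], rfl⟩
    · rcases hq with rfl | rfl
      · exact ⟨⟨0, hn⟩, h, rot hk, ⟨n - 1, by omega⟩, rfl, by simp [aut, rot], rfl⟩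
      · exact ⟨⟨0, hn⟩, h, test hk, ⟨0, hn⟩, by simp [mask, rot, test], by simp [aut, test], rfl⟩

/-- No other event looks like `drop`, and it is undefined at 0: the tokens move down by one and the
token at 0 is lost. -/
theorem reach_drop (s : List (Fin k)) (q : ℕ) :
    Reach k n (s ++ [drop hk]) q ↔ Reach k n s (q + 1) := by
  rw [reach_append_singleton]
  constructor
  · rintro ⟨p, hp, y, r, hy, hr, rfl⟩
    simp only [mask, drop, Option.some.injEq, Fin.mk.injEq] at hy
    have hy' : y.val = 2 := by
      have : ¬ 2 = 1 := by omega
      simp only [this, if_false] at hy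
      split at hy <;> omega
    by_cases h0 : p.val = 0
    · simp [aut, hy', h0] at hr
    · simp only [aut, hy', h0, if_false, if_true, Option.some.injEq, OfNat.ofNat_ne_zero,
        OfNat.ofNat_ne_one] at hr
      rw [← hr]
      simpa only [Nat.sub_add_cancel (Nat.pos_of_ne_zero h0)] using hp
  · intro h
    exact ⟨⟨q + 1, h.lt⟩, h, drop hk, ⟨q, by have := h.lt; omega⟩, rfl, by simp [aut, drop], rfl⟩

theorem exists_mem (hn : 0 < n) : ∃ w, w ∈ (aut k n).marked :=
  ⟨[], ⟨0, hn⟩, by simp [PDFA.eval, aut, hn], by simp [aut]⟩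

/-- All states are live, so an event is justified as soon as it is defined at some state that
carries a token. -/
theorem enabled_iff (hk : 3 ≤ k) (hn : 0 < n) (s : List (Fin k)) (x : Fin k) :
    Enabled (mask k) (aut k n).marked s x ↔
      ∃ p : Fin n, Reach k n s p ∧ ∃ r, (aut k n).step p x = some r := by
  constructor
  · rintro ⟨u, hu, hux⟩
    rw [mem_prefixClosure_iff hk hn] at hux
    obtain ⟨r, hr⟩ := hux
    rw [PDFA.eval_append_singleton, Option.bind_eq_some_iff] at hr
    obtain ⟨p, hp, hr⟩ := hr
    exact ⟨p, ⟨u, p, hu, hp, rfl⟩, r, hr⟩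
  · rintro ⟨p, ⟨u, p', hu, hp', hpp⟩, r, hr⟩
    obtain rfl : p' = p := Fin.ext hpp
    refine ⟨u, hu, ?_⟩
    rw [mem_prefixClosure_iff hk hn]
    exact ⟨r, by rw [PDFA.eval_append_singleton, hp']; exact hr⟩

/-- A string whose look-alikes reach the state `0` and the states `i + 1` with `e i`. -/
def code (n : ℕ) (e : ℕ → Bool) : ℕ → List (Fin k)
  | 0 => List.replicate (n - 1) (rot hk)
  | t + 1 => code n e t ++ [if e t then rot hk else drop hk]

/-- The token at 0 persists and sends out a new token to n - 1 with every rotation. After n - 1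
rotations the ring is full. -/
theorem reach_replicate (hn : 0 < n) (t : ℕ) (ht : t < n) (q : ℕ) :
    Reach k n (List.replicate t (rot hk)) q ↔ q < n ∧ (q = 0 ∨ n ≤ q + t) := by
  induction t generalizing q with
  | zero =>
    rw [List.replicate_zero, reach_nil hn]
    omega
  | succ t ih =>
    rw [List.replicate_succ', reach_rot hk hn, ih (by omega), ih (by omega)]
    omega

theorem mem_infO_replicate (hn : 0 < n) (t : ℕ) (ht : t < n) :
    List.replicate t (rot hk) ∈ infO (mask k) (aut k n).marked := by
  induction t with
  | zero => exact nil_mem_infO (exists_mem hn)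
  | succ t ih =>
    rw [List.replicate_succ', append_singleton_mem_infO_iff (exists_mem hn), enabled_iff hk hn]
    refine ⟨ih (by omega), ⟨0, hn⟩, ?_, _, by simp only [aut, rot, if_true]; rfl⟩
    rw [reach_replicate hk hn t (by omega)]
    exact ⟨hn, .inl rfl⟩

/-- A shift register: each step moves the tokens down by one and puts the bit e t at n - 1. The
states q with q + t < n still hold tokens of the full ring; among them is 0 as long as t < n. -/
theorem reach_code (hn : 0 < n) (e : ℕ → Bool) (t : ℕ) (ht : t < n) (q : ℕ) :
    Reach k n (code hk n e t) q ↔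
      q < n ∧ (q + t < n ∨ (n ≤ q + t ∧ e (q + t - n) = true)) := by
  induction t generalizing q with
  | zero =>
    rw [code, reach_replicate hk hn _ (by omega)]
    omega
  | succ t ih =>
    rw [code]
    have h1 : q + 1 + t - n = q + (t + 1) - n := by omega
    have ih1 := ih (by omega) (q + 1)
    -- The state 0 is occupied before the step, so a rotation does refill n - 1. The extra token
    -- left at 0 is harmless, since 0 is occupied after the step in any case.
    have r0 : Reach k n (code hk n e t) 0 := (ih (by omega) 0).mpr ⟨hn, .inl (by omega)⟩
    rw [h1] at ih1
    clear ih
    cases he : e t with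
    | true =>
      rw [if_pos rfl, reach_rot hk hn, ih1]
      by_cases hq : q = n - 1
      · have : q + (t + 1) - n = t := by omega
        rw [this, he]
        simp only [r0, true_and, and_true]
        omega
      · cases e (q + (t + 1) - n) <;> simp [r0] <;> omega
    | false =>
      rw [if_neg (by simp), reach_drop hk, ih1]
      by_cases hq : q = n - 1
      · have : q + (t + 1) - n = t := by omega
        rw [this, he]
        simp
        omega
      · cases e (q + (t + 1) - n) <;> simp <;> omega

theorem code_mem_infO (hn : 0 < n) (e : ℕ → Bool) (t : ℕ) (ht : t < n) :
    code hk n e t ∈ infO (mask k) (aut k n).marked := by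
  induction t with
  | zero => exact mem_infO_replicate hk hn _ (by omega)
  | succ t ih =>
    rw [code, append_singleton_mem_infO_iff (exists_mem hn), enabled_iff hk hn]
    -- The state 1 still holds a token of the full ring, and both possible events move it to 0.
    refine ⟨ih (by omega), ⟨1, by omega⟩, ?_, ⟨0, hn⟩, ?_⟩
    · rw [reach_code hk hn e t (by omega)]
      simp only
      omega
    · split <;> simp [aut, rot, drop]

theorem reach_code_drop (hn : 0 < n) (e : ℕ → Bool) (i q : ℕ) :
    Reach k n (code hk n e (n - 1) ++ List.replicate i (drop hk)) q ↔
      q + i < n ∧ (q + i = 0 ∨ e (q + i - 1) = true) := by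
  induction i generalizing q with
  | zero =>
    rw [List.replicate_zero, List.append_nil, reach_code hk hn e _ (by omega)]
    by_cases h : q = 0
    · simp [h, hn]
    · have : q + (n - 1) - n = q + 0 - 1 := by omega
      rw [this]
      grind
  | succ i ih =>
    rw [List.replicate_succ', ← List.append_assoc, reach_drop hk, ih]
    have : q + 1 + i = q + (i + 1) := by omega
    rw [this]

/-- Dropping i + 1 times brings the token of the state i + 1 to 0, if there is one, and removes the
tokens below it. The event `test` is defined only at 0, so it reads the bit e i. -/
theorem code_test_mem_infO_iff (hn : 0 < n) (e : ℕ → Bool) (i : ℕ) (hi : i + 1 < n) :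
    code hk n e (n - 1) ++ (List.replicate (i + 1) (drop hk) ++ [test hk]) ∈
      infO (mask k) (aut k n).marked ↔ e i = true := by
  rw [← List.append_assoc, append_singleton_mem_infO_iff (exists_mem hn), enabled_iff hk hn]
  constructor
  · rintro ⟨-, p, hp, r, hr⟩
    have h0 : p.val = 0 := by
      by_contra h0
      simp [aut, test, h0] at hr
    rw [reach_code_drop hk hn, h0] at hp
    simpa using hp.2
  · intro he
    refine ⟨?_, ⟨0, hn⟩, ?_, ⟨0, hn⟩, by simp [aut, test]⟩
    · have : ∀ j ≤ i + 1, code hk n e (n - 1) ++ List.replicate j (drop hk) ∈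
          infO (mask k) (aut k n).marked := by
        intro j
        induction j with
        | zero => simpa using code_mem_infO hk hn e (n - 1) (by omega)
        | succ j ih =>
          intro hj
          rw [List.replicate_succ', ← List.append_assoc,
            append_singleton_mem_infO_iff (exists_mem hn), enabled_iff hk hn]
          -- The token that started at i + 1 justifies every one of the drops: after j ≤ i of them
          -- it stands at i + 1 - j, which is not 0.
          refine ⟨ih (by omega), ⟨i + 1 - j, by omega⟩, ?_, ⟨i - j, by omega⟩, ?_⟩
          · rw [reach_code_drop hk hn]
            have : i + 1 - j + j - 1 = i := by omega
            simp only [this, he]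
            grind
          · have : ¬ i + 1 - j = 0 := by omega
            simp only [aut, drop, this, if_false, OfNat.ofNat_ne_zero, OfNat.ofNat_ne_one, if_true,
              Option.some.injEq, Fin.mk.injEq]
            omega
      exact this _ le_rfl
    · rw [reach_code_drop hk hn]
      simpa [he] using hi

/-- Two different bit vectors of length n - 1 differ in some bit, and reading that bit tells the
strings apart. -/
theorem two_pow_le (hk : 3 ≤ k) (hn : 0 < n) {N : ℕ} (B : PDFA (Fin k) N)
    (hB : B.marked = infO (mask k) (aut k n).marked) : 2 ^ (n - 1) ≤ N := by
  let ext : (Fin (n - 1) → Bool) → ℕ → Bool := fun e i => if h : i < n - 1 then e ⟨i, h⟩ else false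
  have := B.card_le_of_distinguishable (fun e => code hk n (ext e) (n - 1))
    (fun e => ⟨[], by rw [hB, List.append_nil]; exact code_mem_infO hk hn _ _ (by omega)⟩)
    (fun e e' hne => by
      obtain ⟨i, hi⟩ := Function.ne_iff.mp hne
      refine ⟨List.replicate (i + 1) (drop hk) ++ [test hk], ?_⟩
      rw [hB, code_test_mem_infO_iff hk hn _ _ (by omega),
        code_test_mem_infO_iff hk hn _ _ (by omega)]
      simp only [ext, i.2, dif_pos]
      cases h : e i <;> cases h' : e' i <;> simp_all)
  simpa using this

end Ring

/-! ## Correctness of the construction -/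

/-- The tables computed by the construction, for the transition table `D`, the table `mk` of the
mask, the set `L` of live states and the initial state `st`. -/
structure Tables (k n : ℕ) (D mk : ℕ → ℕ) (L : ℕ → Prop) (st : ℕ)
    (prime nfa eps clo succ det da num : ℕ → ℕ) (N : ℕ) : Prop where
  prime_iff : ∀ j < n * k, prime j ≠ 0 ↔ ∃ r, D j = r + 1 ∧ L r
  nfa_marks : Marks nfa (Upto k (n * k) (NfaAt k n D mk prime))
  eps_marks : Marks eps (Upto k (n * k) (EpsAt k n D mk))
  clo_spec : ∀ q < n + 1, CloSpec n eps q (clo q)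
  succ_spec : ∀ j < (n + 1) * k, SuccSpec n nfa clo (n + 1) j (succ j)
  det_spec : ∀ j < 2 ^ (n + 1) * k, DetSpec k n succ j (det j)
  clo_lt : clo st < 2 ^ (n + 1)
  det_top : ∀ x < k, det (2 ^ (n + 1) * k + x) = det (clo st * k + x)
  da_iff : ∀ y < 2 ^ (n + 1), da y ≠ 0 ↔ y.testBit n
  da_top : da (2 ^ (n + 1)) ≠ 0
  numbering : Numbering (2 ^ (n + 1) + 1) da num N

/-- The part of the algorithm for nonempty languages. -/
def construct : Program :=
  prefixStep ;; primeStep ;; nfaStep ;; determinizeStep ;; unionStep ;; supStep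

theorem construct_runs {w k n : ℕ} (room : Room w k n) {s : Store Reg Arr} {L : ℕ → Prop}
    (hk : s.reg .k = k) (hn : s.reg .n = n) (hst : s.reg .start ≤ n)
    (hD : ∀ j, s.mem .delta j ≤ n) (hm : ∀ j, s.mem .mask j < 2 ^ w)
    (hl : ∀ q < n, s.mem .live q ≤ 1 ∧ (s.mem .live q ≠ 0 ↔ L q))
    (h_prime : ∀ j, s.mem .prime j = 0) (h_nfa : ∀ j, s.mem .nfa j = 0)
    (h_eps : ∀ j, s.mem .eps j = 0) (h_succ : ∀ j, s.mem .succ j = 0)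
    (h_num : ∀ j, s.mem .num j = 0) :
    Runs w (2000 * ((n + 1) * (n + 1) * (n + 1) * ((k + 1) * (k + 1)) +
        (k + 1) * 2 ^ (n + 1))) construct s fun t =>
      ∃ prime nfa eps clo succ det da num : ℕ → ℕ,
        Tables k n (s.mem .delta) (s.mem .mask) L (s.reg .start - 1) prime nfa eps clo succ det da
          num (t.reg .outN) ∧
        (∀ y < 2 ^ (n + 1) + 1, num y ≠ 0 → t.mem .outAcc (num y - 1) = 1 ∧
          ∀ x < k, t.mem .outDelta ((num y - 1) * k + x) = num (det (y * k + x))) ∧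
        t.reg .outStart = num (2 ^ (n + 1)) := by
  apply Runs.mono
  · apply Runs.seq (prefixStep_runs room hn fun q hq => (hl q hq).1)
    intro t₁ fr₁ h₁
    have hk₁ : t₁.reg .k = k := (fr₁.reg .k rfl).trans hk
    have hn₁ : t₁.reg .n = n := (fr₁.reg .n rfl).trans hn
    have hd₁ : t₁.mem .delta = s.mem .delta := fr₁.mem .delta rfl
    have ha₁ : ∀ q < n, t₁.mem .acc3 q ≤ 1 := fun q hq => h₁ q hq ▸ (hl q hq).1
    apply Runs.seq (primeStep_runs room hk₁ hn₁ (hd₁ ▸ hD) ha₁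
      (fun j => (congrFun (fr₁.mem .prime rfl) j).trans (h_prime j)))
    intro t₂ fr₂ h₂
    rw [hd₁] at h₂
    have hk₂ : t₂.reg .k = k := (fr₂.reg .k rfl).trans hk₁
    have hn₂ : t₂.reg .n = n := (fr₂.reg .n rfl).trans hn₁
    have hd₂ : t₂.mem .delta = s.mem .delta := (fr₂.mem .delta rfl).trans hd₁
    have hm₂ : t₂.mem .mask = s.mem .mask := (fr₂.mem .mask rfl).trans (fr₁.mem .mask rfl)
    have hnfa₂ : t₂.mem .nfa = s.mem .nfa := (fr₂.mem .nfa rfl).trans (fr₁.mem .nfa rfl)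
    have heps₂ : t₂.mem .eps = s.mem .eps := (fr₂.mem .eps rfl).trans (fr₁.mem .eps rfl)
    have hpr₂ : ∀ j < n * k, t₂.mem .prime j ≤ 1 := fun j hj => by
      rw [h₂ j hj]
      split
      · exact Nat.zero_le 1
      · exact ha₁ _ (by have := hD j; omega)
    have hpi : ∀ j < n * k, t₂.mem .prime j ≠ 0 ↔ ∃ r, s.mem .delta j = r + 1 ∧ L r := by
      intro j hj
      rw [h₂ j hj]
      have hle := hD j
      cases hd : s.mem .delta j with
      | zero => simp
      | succ r =>
        rw [if_neg (by omega), Nat.add_sub_cancel, h₁ r (by omega), (hl r (by omega)).2]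
        simp
    apply Runs.seq (nfaStep_runs room hk₂ hn₂ (hd₂ ▸ hD) (hm₂ ▸ hm) hpr₂
      (fun j => (congrFun hnfa₂ j).trans (h_nfa j)) (fun j => (congrFun heps₂ j).trans (h_eps j)))
    intro t₃ fr₃ h₃
    rw [hd₂, hm₂] at h₃
    have hk₃ : t₃.reg .k = k := (fr₃.reg .k rfl).trans hk₂
    have hn₃ : t₃.reg .n = n := (fr₃.reg .n rfl).trans hn₂
    have hs₃ : t₃.reg .start = s.reg .start :=
      (fr₃.reg .start rfl).trans ((fr₂.reg .start rfl).trans (fr₁.reg .start rfl))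
    have hsu₃ : t₃.mem .succ = s.mem .succ :=
      (fr₃.mem .succ rfl).trans ((fr₂.mem .succ rfl).trans (fr₁.mem .succ rfl))
    have hnum₃ : t₃.mem .num = s.mem .num :=
      (fr₃.mem .num rfl).trans ((fr₂.mem .num rfl).trans (fr₁.mem .num rfl))
    apply Runs.seq (determinizeStep_runs room hk₃ hn₃ (by omega) (by omega)
      (fun j => (h₃.2 j).1) (fun j => (h₃.1 j).1) (fun j => (congrFun hsu₃ j).trans (h_succ j)))
    rintro t₄ fr₄ ⟨hp₄, hda₄, ⟨clo, succ, hclo, hsucc, hdet, hstart⟩, hlt⟩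
    rw [hs₃] at hstart
    have hk₄ : t₄.reg .k = k := (fr₄.reg .k rfl).trans hk₃
    have hn₄ : t₄.reg .n = n := (fr₄.reg .n rfl).trans hn₃
    have hnum₄ : t₄.mem .num = s.mem .num := (fr₄.mem .num rfl).trans hnum₃
    apply Runs.seq (unionStep_runs room hk₄ hn₄ hp₄ hlt fun j hj => (hdet j hj).1)
    rintro t₅ fr₅ ⟨hd₅, hd₅', hda₅, hda₅', hs₅⟩
    rw [hstart] at hd₅'
    have hk₅ : t₅.reg .k = k := (fr₅.reg .k rfl).trans hk₄
    have hn₅ : t₅.reg .n = n := (fr₅.reg .n rfl).trans hn₄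
    have hp₅ : t₅.mem .pow (n + 1) = 2 ^ (n + 1) := (congrFun (fr₅.mem .pow rfl) _).trans hp₄
    have hnum₅ : t₅.mem .num = s.mem .num := (fr₅.mem .num rfl).trans hnum₄
    -- The copied row belongs to the closure of the initial state. It lies below 2^(n+1) and was not
    -- overwritten, so the copy can be stated within the final table.
    have htop : ∀ x < k, t₅.mem .det (2 ^ (n + 1) * k + x) =
        t₅.mem .det (clo (s.reg .start - 1) * k + x) := fun x hx => by
      rw [hd₅' x hx, hd₅ _ (cell_lt (hstart ▸ hlt) hx)]
    have hspec : ∀ j < 2 ^ (n + 1) * k, DetSpec k n succ j (t₅.mem .det j) := fun j hj => by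
      rw [hd₅ j hj]
      exact hdet j hj
    have hacc : ∀ y < 2 ^ (n + 1), t₅.mem .detAcc y ≤ 1 ∧
        (t₅.mem .detAcc y ≠ 0 ↔ y.testBit n) := fun y hy => by
      rw [hda₅ y hy]
      exact hda₄ y hy
    have hacc' : ∀ y < 2 ^ (n + 1) + 1, t₅.mem .detAcc y ≤ 1 := fun y hy => by
      rcases Nat.lt_succ_iff_lt_or_eq.mp hy with hy | rfl
      · exact (hacc y hy).1
      · exact hda₅'.le
    have hdet' : ∀ j < (2 ^ (n + 1) + 1) * k, t₅.mem .det j < 2 ^ (n + 1) + 1 := fun j hj => by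
      by_cases hj' : j < 2 ^ (n + 1) * k
      · exact (hspec j hj').1.trans (Nat.lt_succ_self _)
      · rw [Nat.add_mul, Nat.one_mul] at hj
        obtain ⟨x, rfl⟩ := Nat.exists_eq_add_of_le (Nat.le_of_not_lt hj')
        have hx : x < k := by omega
        rw [htop x hx]
        exact (hspec _ (cell_lt (hstart ▸ hlt) hx)).1.trans (Nat.lt_succ_self _)
    have h_sup := supStep_runs room hk₅ hn₅ hp₅ (by omega) hacc' hdet'
      fun j => (congrFun hnum₅ j).trans (h_num j)
    refine h_sup.conseq (Q := fun t => ∃ prime nfa eps clo succ det da num : ℕ → ℕ,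
        Tables k n (s.mem .delta) (s.mem .mask) L (s.reg .start - 1) prime nfa eps clo succ det da
          num (t.reg .outN) ∧
        (∀ y < 2 ^ (n + 1) + 1, num y ≠ 0 → t.mem .outAcc (num y - 1) = 1 ∧
          ∀ x < k, t.mem .outDelta ((num y - 1) * k + x) = num (det (y * k + x))) ∧
        t.reg .outStart = num (2 ^ (n + 1))) ?_
    rintro t fr ⟨num, h1, h2, h3⟩
    exact ⟨t₂.mem .prime, t₃.mem .nfa, t₃.mem .eps, clo, succ, t₅.mem .det, t₅.mem .detAcc, num,
      ⟨hpi, h₃.1, h₃.2, hclo, hsucc, hspec, hstart ▸ hlt, htop, fun y hy => (hacc y hy).2,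
        by rw [hda₅']; exact one_ne_zero, h1⟩, h2, by rw [h3, hs₅]⟩
  · exact fun _ _ h => h
  · have e : (n + 1) * (n + 1) * (n + 1) * ((k + 1) * (k + 1)) =
        (n + 1) * (k + 1) * (k + 1) * ((n + 1) * (n + 1)) := by ring
    have h1 : (n + 1) * (k + 1) * (k + 1) ≤
        (n + 1) * (n + 1) * (n + 1) * ((k + 1) * (k + 1)) := by
      rw [e]
      exact Nat.le_mul_of_pos_right _ (by positivity)
    have h2 : (n + 1) * (k + 1) ≤ (n + 1) * (k + 1) * (k + 1) :=
      Nat.le_mul_of_pos_right _ (by positivity)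
    have h3 : n + 1 ≤ (n + 1) * (k + 1) := Nat.le_mul_of_pos_right _ (by positivity)
    have h4 : k + 1 ≤ (n + 1) * (k + 1) := Nat.le_mul_of_pos_left _ (by positivity)
    have h5 : (n + 1) * (n + 1) * (n + 1) * (k + 1) ≤
        (n + 1) * (n + 1) * (n + 1) * ((k + 1) * (k + 1)) := by
      rw [← Nat.mul_assoc]
      exact Nat.le_mul_of_pos_right _ (by positivity)
    omega

/-! ### From tables to automata. -/

namespace Tables

variable {k n N : ℕ} {D mk : ℕ → ℕ} {L : ℕ → Prop} {st : ℕ}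
  {prime nfa eps clo succ det da num : ℕ → ℕ}

/-- Addresses decode uniquely, and the contributing state lies below n; hence f = n has no outgoing
transitions. The three alternatives are copied observable transitions, self-loops under unobservable
events and renamed primed transitions. -/
theorem nfa_iff (T : Tables k n D mk L st prime nfa eps clo succ det da num N)
    (hD : ∀ j, D j ≤ n) {q a r : ℕ} (ha : a < k) (hr : r < n + 1) :
    nfa ((q * k + a) * (n + 1) + r) ≠ 0 ↔ q < n ∧
      ((∃ x < k, D (q * k + x) = r + 1 ∧ mk x ≠ 0 ∧ mk a = mk x) ∨ (mk a = 0 ∧ r = q) ∨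
        (prime (q * k + a) ≠ 0 ∧ r = n)) := by
  rw [(T.nfa_marks _).2]
  constructor
  · rintro ⟨p, x, hx, hlt, h⟩
    have hp : p < n := by
      by_contra hp
      have := Nat.mul_le_mul_right k (Nat.le_of_not_lt hp)
      omega
    rcases h with ⟨r', hr', hne, y, hy, hyx, e⟩ | ⟨h0, e⟩ | ⟨h0, e⟩
    · have := hD (p * k + x)
      obtain ⟨e1, rfl⟩ := cell_inj hr (by omega) e
      obtain ⟨rfl, rfl⟩ := cell_inj ha hy e1
      exact ⟨hp, .inl ⟨x, hx, hr', hne, hyx⟩⟩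
    · obtain ⟨e1, rfl⟩ := cell_inj hr (by omega) e
      obtain ⟨rfl, rfl⟩ := cell_inj ha hx e1
      exact ⟨hp, .inr (.inl ⟨h0, rfl⟩)⟩
    · obtain ⟨e1, rfl⟩ := cell_inj hr (by omega) e
      obtain ⟨rfl, rfl⟩ := cell_inj ha hx e1
      exact ⟨hp, .inr (.inr ⟨h0, rfl⟩)⟩
  · rintro ⟨hq, ⟨x, hx, h, hne, hax⟩ | ⟨h0, rfl⟩ | ⟨h0, rfl⟩⟩
    · exact ⟨q, x, hx, cell_lt hq hx, .inl ⟨r, h, hne, a, ha, hax, rfl⟩⟩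
    · exact ⟨r, a, ha, cell_lt hq ha, .inr (.inl ⟨h0, rfl⟩)⟩
    · exact ⟨q, a, ha, cell_lt hq ha, .inr (.inr ⟨h0, rfl⟩)⟩

theorem epsEdge_iff (T : Tables k n D mk L st prime nfa eps clo succ det da num N)
    (hD : ∀ j, D j ≤ n) {q r : ℕ} :
    EpsEdge n eps q r ↔ q < n ∧ ∃ x < k, D (q * k + x) = r + 1 ∧ mk x = 0 := by
  constructor
  · rintro ⟨hq, hr, h⟩
    rw [(T.eps_marks _).2] at h
    obtain ⟨p, x, hx, hlt, r', hr', h0, e⟩ := h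
    have hp : p < n := by
      by_contra hp
      have := Nat.mul_le_mul_right k (Nat.le_of_not_lt hp)
      omega
    have := hD (p * k + x)
    obtain ⟨rfl, rfl⟩ := cell_inj hr (by omega) e
    exact ⟨hp, x, hx, hr', h0⟩
  · rintro ⟨hq, x, hx, h, h0⟩
    have := hD (q * k + x)
    refine ⟨by omega, by omega, ?_⟩
    rw [(T.eps_marks _).2]
    exact ⟨q, x, hx, cell_lt hq hx, r, h, h0, rfl⟩

theorem det_iff (T : Tables k n D mk L st prime nfa eps clo succ det da num N)
    {y a b : ℕ} (hy : y < 2 ^ (n + 1)) (ha : a < k) :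
    (det (y * k + a)).testBit b ↔ ∃ q, y.testBit q ∧
      ∃ r < n + 1, nfa ((q * k + a) * (n + 1) + r) ≠ 0 ∧
        Relation.ReflTransGen (EpsEdge n eps) r b := by
  rw [(T.det_spec _ (cell_lt hy ha)).2, add_div_cell ha, add_mod_cell ha]
  refine exists_congr fun q => and_congr_right fun hq => ?_
  have hqn : q < n + 1 := by
    by_contra h
    rw [Nat.testBit_lt_two_pow (hy.trans_le
      (Nat.pow_le_pow_right two_pos (Nat.le_of_not_lt h)))] at hq
    exact absurd hq (by simp)
  rw [(T.succ_spec _ (cell_lt hqn ha)).2]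
  exact exists_congr fun r => and_congr_right fun hr => and_congr_right fun _ =>
    T.clo_spec r hr b

/-- The set of states reached by the string `w`. -/
def sets (clo det : ℕ → ℕ) (k st : ℕ) (w : List (Fin k)) : ℕ :=
  w.foldl (fun y a => det (y * k + a)) (clo st)

theorem sets_append_singleton (w : List (Fin k)) (a : Fin k) :
    sets clo det k st (w ++ [a]) = det (sets clo det k st w * k + a) := by
  simp [sets]

theorem sets_lt (T : Tables k n D mk L st prime nfa eps clo succ det da num N)
    (w : List (Fin k)) : sets clo det k st w < 2 ^ (n + 1) := by
  induction w using List.reverseRecOn with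
  | nil => exact T.clo_lt
  | append_singleton w a ih =>
    rw [sets_append_singleton]
    exact (T.det_spec _ (cell_lt ih a.2)).1

/-- The number of the state reached by the string `w` in the automaton with the new initial
state. -/
def states (det : ℕ → ℕ) (k n : ℕ) (w : List (Fin k)) : ℕ :=
  w.foldl (fun y a => det (y * k + a)) (2 ^ (n + 1))

theorem states_append_singleton (w : List (Fin k)) (a : Fin k) :
    states det k n (w ++ [a]) = det (states det k n w * k + a) := by
  simp [states]

/-- The new initial state has the transitions of the old one, so the two runs differ on the empty
string only. -/
theorem states_eq_sets (T : Tables k n D mk L st prime nfa eps clo succ det da num N)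
    (w : List (Fin k)) (hw : w ≠ []) : states det k n w = sets clo det k st w := by
  induction w using List.reverseRecOn with
  | nil => exact absurd rfl hw
  | append_singleton w a ih =>
    rw [sets_append_singleton, states_append_singleton]
    by_cases h : w = []
    · subst h
      exact T.det_top a a.2
    · rw [ih h]

theorem states_lt (T : Tables k n D mk L st prime nfa eps clo succ det da num N)
    (w : List (Fin k)) : states det k n w < 2 ^ (n + 1) + 1 := by
  by_cases h : w = []
  · subst h
    exact Nat.lt_succ_self _
  · rw [T.states_eq_sets w h]
    exact (T.sets_lt w).trans (Nat.lt_succ_self _)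

/-- All prefixes of `w` lead to marked states. -/
def Good (det da : ℕ → ℕ) (k n : ℕ) (w : List (Fin k)) : Prop :=
  ∀ u v, u ++ v = w → da (states det k n u) ≠ 0

theorem good_append_singleton (w : List (Fin k)) (a : Fin k) :
    Good det da k n (w ++ [a]) ↔ Good det da k n w ∧ da (states det k n (w ++ [a])) ≠ 0 := by
  refine ⟨fun h => ⟨fun u v e => h u (v ++ [a]) (by rw [← e]; simp), h _ [] (by simp)⟩,
    fun h u v e => ?_⟩
  rcases List.eq_nil_or_concat v with rfl | ⟨v', c, rfl⟩
  · rw [List.append_nil] at e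
    rw [e]
    exact h.2
  · rw [List.concat_eq_append, ← List.append_assoc] at e
    exact h.1 u v' (List.append_inj' e rfl).1

theorem good_nil (T : Tables k n D mk L st prime nfa eps clo succ det da num N) :
    Good det da k n [] := fun u v e => by
  obtain ⟨rfl, rfl⟩ := List.append_eq_nil_iff.mp e
  exact T.da_top

/-- The strings all of whose prefixes lead to marked states are marked by an automaton whose tables
are the output. -/
theorem exists_automaton (T : Tables k n D mk L st prime nfa eps clo succ det da num N)
    {t : Store Reg Arr} (hN : t.reg .outN = N)
    (h_out : ∀ y < 2 ^ (n + 1) + 1, num y ≠ 0 → t.mem .outAcc (num y - 1) = 1 ∧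
      ∀ x < k, t.mem .outDelta ((num y - 1) * k + x) = num (det (y * k + x)))
    (h_start : t.reg .outStart = num (2 ^ (n + 1))) :
    ∃ B : PDFA (Fin k) N, 0 < N ∧ IsOutput t B ∧ ∀ w, w ∈ B.marked ↔ Good det da k n w := by
  -- The inverse of `code` on the numbers up to N, so that the output tables can be read back as an
  -- automaton.
  let dec : ℕ → Option (Fin N) := fun v => if h : v - 1 < N ∧ v ≠ 0 then some ⟨v - 1, h.1⟩ else none
  have hdec : ∀ v ≤ N, code (dec v) = v := fun v hv => by
    by_cases h : v = 0
    · simp [dec, h, code]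
    · have h' : v - 1 < N ∧ v ≠ 0 := ⟨by omega, h⟩
      simp only [dec, dif_pos h', code]
      omega
  let B : PDFA (Fin k) N :=
    { step := fun q a => dec (t.mem .outDelta (q * k + a))
      start := dec (num (2 ^ (n + 1)))
      accept := fun _ => true }
  have hdet : ∀ y < 2 ^ (n + 1) + 1, ∀ x < k, det (y * k + x) < 2 ^ (n + 1) + 1 := by
    intro y hy x hx
    rcases Nat.lt_succ_iff_lt_or_eq.mp hy with hy | rfl
    · exact (T.det_spec _ (cell_lt hy hx)).1.trans (Nat.lt_succ_self _)
    · rw [T.det_top x hx]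
      exact (T.det_spec _ (cell_lt T.clo_lt hx)).1.trans (Nat.lt_succ_self _)
  have htop := T.numbering.le _ (Nat.lt_succ_self (2 ^ (n + 1)))
  have htop' := (T.numbering.ne_zero_iff _ (Nat.lt_succ_self (2 ^ (n + 1)))).mpr T.da_top
  refine ⟨B, by omega, ⟨hN, by rw [h_start, hdec _ htop], fun q => ?_⟩, fun w => ?_⟩
  · obtain ⟨y, hy, e⟩ := T.numbering.surj q q.2
    obtain ⟨h1, h2⟩ := h_out y hy (by omega)
    rw [e, Nat.add_sub_cancel] at h1 h2
    refine ⟨h1, fun a => ?_⟩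
    rw [hdec _ (by rw [h2 a a.2]; exact T.numbering.le _ (hdet y hy a a.2))]
  · have key : ∀ w, (Good det da k n w → code (B.eval w) = num (states det k n w)) ∧
        (¬ Good det da k n w → B.eval w = none) := by
      intro w
      induction w using List.reverseRecOn with
      | nil => exact ⟨fun _ => hdec _ htop, fun h => absurd T.good_nil h⟩
      | append_singleton w a ih =>
        rw [good_append_singleton, PDFA.eval_append_singleton]
        by_cases hw : Good det da k n w
        · have e := ih.1 hw
          have hlt := T.states_lt w
          have hne : num (states det k n w) ≠ 0 :=
            (T.numbering.ne_zero_iff _ hlt).mpr (hw w [] (by simp))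
          have hlt' := T.states_lt (w ++ [a])
          have hstep : code ((B.eval w).bind fun q => B.step q a) =
              num (states det k n (w ++ [a])) := by
            cases hq : B.eval w with
            | none =>
              rw [hq] at e
              exact absurd e.symm hne
            | some q =>
              rw [hq] at e
              change q.val + 1 = _ at e
              change code (dec (t.mem .outDelta (q * k + a))) = _
              have := (h_out _ hlt hne).2 a a.2
              rw [← e, Nat.add_sub_cancel] at this
              rw [this, ← states_append_singleton (det := det) (n := n) w a,
                hdec _ (T.numbering.le _ hlt')]
          refine ⟨fun _ => hstep, fun h => ?_⟩
          have h0 : ¬ da (states det k n (w ++ [a])) ≠ 0 := fun h' => h ⟨hw, h'⟩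
          rw [← T.numbering.ne_zero_iff _ hlt', not_not] at h0
          rw [h0] at hstep
          cases hq : (B.eval w).bind fun q => B.step q a with
          | none => rfl
          | some q =>
            rw [hq] at hstep
            exact absurd hstep (Nat.succ_ne_zero _)
        · exact ⟨fun h => absurd h.1 hw, fun _ => by rw [ih.2 hw]; rfl⟩
    constructor
    · rintro ⟨q, hq, -⟩
      by_contra h
      rw [(key w).2 h] at hq
      exact absurd hq (by simp)
    · intro h
      have e := (key w).1 h
      have hne := (T.numbering.ne_zero_iff _ (T.states_lt w)).mpr (h w [] (by simp))
      cases hq : B.eval w with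
      | none =>
        rw [hq] at e
        exact absurd e.symm hne
      | some q => exact ⟨q, hq, rfl⟩

end Tables

/-! ### The input -/

theorem code_eq_zero {n : ℕ} {o : Option (Fin n)} : code o = 0 ↔ o = none := by
  cases o <;> simp [code]

theorem code_eq_succ {n r : ℕ} {o : Option (Fin n)} :
    code o = r + 1 ↔ ∃ p : Fin n, o = some p ∧ p.val = r := by
  cases o <;> simp [code]

theorem code_inj {n : ℕ} {o o' : Option (Fin n)} : code o = code o' ↔ o = o' := by
  cases o <;> cases o' <;> simp [code, Fin.ext_iff]

theorem code_le {n : ℕ} (o : Option (Fin n)) : code o ≤ n := by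
  cases o with
  | none => exact Nat.zero_le n
  | some q => exact q.2

section Input

variable {k n m : ℕ} (A : PDFA (Fin k) n) (P : Mask (Fin k) (Fin m))

theorem inputStore_delta (q : Fin n) (x : Fin k) :
    (inputStore A P).mem .delta (q * k + x) = code (A.step q x) := by
  have h1 := add_div_cell (q := q.val) x.2
  have h2 := add_mod_cell (q := q.val) x.2
  have h : (q * k + x : ℕ) / k < n ∧ (q * k + x : ℕ) % k < k := by
    rw [h1, h2]
    exact ⟨q.2, x.2⟩
  simp only [inputStore, dif_pos h]
  congr

theorem inputStore_acc (q : Fin n) : (inputStore A P).mem .acc q = (A.accept q).toNat := by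
  simp [inputStore]

theorem inputStore_mask (x : Fin k) : (inputStore A P).mem .mask x = code (P x) := by
  simp [inputStore]

theorem inputStore_delta_le (j : ℕ) : (inputStore A P).mem .delta j ≤ n := by
  simp only [inputStore]
  split
  · exact code_le _
  · exact Nat.zero_le n

theorem inputStore_acc_le (j : ℕ) : (inputStore A P).mem .acc j ≤ 1 := by
  simp only [inputStore]
  split
  · exact Bool.toNat_le _
  · exact Nat.zero_le 1

theorem inputStore_mask_le (j : ℕ) : (inputStore A P).mem .mask j ≤ m := by
  simp only [inputStore]
  split
  · exact code_le _
  · exact Nat.zero_le m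

/-- The live states of the input automaton. -/
def InputLive (q : ℕ) : Prop :=
  Live k n ((inputStore A P).mem .delta) ((inputStore A P).mem .acc) q

theorem inputLive_iff (q : Fin n) :
    InputLive A P q ↔ ∃ v f, A.evalFrom (some q) v = some f ∧ A.accept f = true := by
  constructor
  · rintro ⟨f, hf, hacc, h⟩
    have hacc' : A.accept ⟨f, hf⟩ = true := by
      have := inputStore_acc A P ⟨f, hf⟩
      rw [this] at hacc
      cases e : A.accept ⟨f, hf⟩ <;> simp_all
    have : ∀ p, Relation.ReflTransGen (Edge k n ((inputStore A P).mem .delta)) p f →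
        ∀ hp : p < n, ∃ v, A.evalFrom (some ⟨p, hp⟩) v = some ⟨f, hf⟩ := by
      intro p hpf
      induction hpf using Relation.ReflTransGen.head_induction_on with
      | refl => exact fun _ => ⟨[], rfl⟩
      | head hac _ ih =>
        intro hp
        obtain ⟨_, x, hx, h⟩ := hac
        rw [inputStore_delta A P ⟨_, hp⟩ ⟨x, hx⟩, code_eq_succ] at h
        obtain ⟨r, hr, rfl⟩ := h
        obtain ⟨v, hv⟩ := ih r.2
        exact ⟨⟨x, hx⟩ :: v, by rw [PDFA.evalFrom_cons, hr]; exact hv⟩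
    obtain ⟨v, hv⟩ := this q h q.2
    exact ⟨v, _, hv, hacc'⟩
  · rintro ⟨v, f, hv, hf⟩
    refine ⟨f, f.2, by rw [inputStore_acc, hf]; simp, ?_⟩
    induction v generalizing q with
    | nil =>
      obtain rfl : q = f := by simpa [PDFA.evalFrom] using hv
      exact .refl
    | cons a v ih =>
      rw [PDFA.evalFrom_cons] at hv
      cases e : A.step q a with
      | none => simp [e, PDFA.evalFrom_none] at hv
      | some r =>
        rw [e] at hv
        refine .head ⟨q.2, a, a.2, ?_⟩ (ih r hv)
        rw [inputStore_delta, e]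
        rfl

theorem mem_prefixClosure_marked_iff (u : List (Fin k)) :
    u ∈ prefixClosure A.marked ↔ ∃ q, A.eval u = some q ∧ InputLive A P q := by
  constructor
  · rintro ⟨v, f, hf, hacc⟩
    rw [PDFA.eval_append] at hf
    cases e : A.eval u with
    | none => simp [e, PDFA.evalFrom_none] at hf
    | some q =>
      rw [e] at hf
      exact ⟨q, rfl, (inputLive_iff A P q).mpr ⟨v, f, hf, hacc⟩⟩
  · rintro ⟨q, hq, h⟩
    obtain ⟨v, f, hv, hf⟩ := (inputLive_iff A P q).mp h
    exact ⟨v, f, by rw [PDFA.eval_append, hq, hv], hf⟩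

theorem exists_mem_marked_iff :
    (∃ w, w ∈ A.marked) ↔ ∃ q, A.start = some q ∧ InputLive A P q := by
  -- A language is nonempty if and only if its prefix closure contains the empty string.
  rw [← show A.eval [] = A.start from rfl, ← mem_prefixClosure_marked_iff]
  exact exists_congr fun w => Iff.rfl

variable {A P}

/-! ### Sets of the subset automaton and look-alike strings. -/

section Correct

variable {N : ℕ} {prime nfa eps clo succ det da num : ℕ → ℕ} {q₀ : Fin n}

/-- Words that look alike and extend each other by unobservable events. -/
theorem sets_iff (hq₀ : A.start = some q₀)
    (T : Tables k n ((inputStore A P).mem .delta) ((inputStore A P).mem .mask) (InputLive A P) q₀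
      prime nfa eps clo succ det da num N) (w : List (Fin k)) (q : Fin n) :
    (Tables.sets clo det k q₀ w).testBit q ↔
      ∃ u, P.word u = P.word w ∧ A.eval u = some q := by
  have hD := inputStore_delta_le A P
  set E := EpsEdge n eps with hE
  have hedge : ∀ (p : Fin n) (r : ℕ), E p r ↔ ∃ x, P x = none ∧ ∃ r' : Fin n,
      A.step p x = some r' ∧ r'.val = r := by
    intro p r
    rw [hE, T.epsEdge_iff hD]
    constructor
    · rintro ⟨_, x, hx, h, h0⟩
      rw [inputStore_delta A P p ⟨x, hx⟩, code_eq_succ] at h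
      rw [inputStore_mask A P ⟨x, hx⟩, code_eq_zero] at h0
      exact ⟨⟨x, hx⟩, h0, h⟩
    · rintro ⟨x, h0, h⟩
      exact ⟨p.2, x, x.2, by rw [inputStore_delta, code_eq_succ]; exact h,
        by rw [inputStore_mask, code_eq_zero]; exact h0⟩
  have hstep : ∀ (w : List (Fin k)) (a : Fin k) (b : ℕ),
      (Tables.sets clo det k q₀ (w ++ [a])).testBit b ↔
      ∃ p, (Tables.sets clo det k q₀ w).testBit p ∧
        ∃ r < n + 1, nfa ((p * k + a) * (n + 1) + r) ≠ 0 ∧ Relation.ReflTransGen E r b := by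
    intro w a b
    rw [Tables.sets_append_singleton, T.det_iff (T.sets_lt w) a.2]
  -- Every set that is reached is closed under ε-transitions, since the initial set and all
  -- successor sets are unions of closures.
  have hclosed : ∀ w p r, (Tables.sets clo det k q₀ w).testBit p → E p r →
      (Tables.sets clo det k q₀ w).testBit r := by
    intro w p r
    induction w using List.reverseRecOn with
    | nil =>
      intro h1 h2
      rw [show Tables.sets clo det k q₀ [] = clo q₀ from rfl] at h1 ⊢
      rw [T.clo_spec _ (by omega)] at h1 ⊢
      exact h1.tail h2
    | append_singleton w a _ =>
      rw [hstep, hstep]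
      rintro ⟨p', h1, r', hr', h2, h3⟩ h4
      exact ⟨p', h1, r', hr', h2, h3.tail h4⟩
  -- An ε-path is realized by appending unobservable events, which leave the mask image unchanged.
  have hext : ∀ (r : Fin n) (b : ℕ), Relation.ReflTransGen E r b → ∀ u, A.eval u = some r →
      ∃ u' b', P.word u' = P.word u ∧ A.eval u' = some b' ∧ b'.val = b := by
    intro r b h
    induction h with
    | refl => exact fun u hu => ⟨u, r, rfl, hu, rfl⟩
    | tail _ h ih =>
      intro u hu
      obtain ⟨u', b', h1, h2, rfl⟩ := ih u hu
      obtain ⟨x, hx, r', h3, rfl⟩ := (hedge _ _).mp h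
      refine ⟨u' ++ [x], r', ?_, ?_, rfl⟩
      · rw [word_append, h1]
        simp [Mask.word, hx]
      · rw [PDFA.eval_append_singleton, h2]
        exact h3
  have hnfa : ∀ (p : Fin n) (a : Fin k) (r : ℕ), r < n + 1 →
      (nfa ((p * k + a) * (n + 1) + r) ≠ 0 ↔
        (∃ x r', A.step p x = some r' ∧ r'.val = r ∧ P x ≠ none ∧ P a = P x) ∨
          (P a = none ∧ r = p) ∨ (prime (p * k + a) ≠ 0 ∧ r = n)) := by
    intro p a r hr
    rw [T.nfa_iff hD a.2 hr, inputStore_mask, code_eq_zero]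
    constructor
    · rintro ⟨_, ⟨x, hx, h1, h2, h3⟩ | h⟩
      · rw [inputStore_delta A P p ⟨x, hx⟩, code_eq_succ] at h1
        rw [inputStore_mask A P ⟨x, hx⟩] at h2 h3
        rw [code_inj] at h3
        obtain ⟨r', h1, h1'⟩ := h1
        exact .inl ⟨⟨x, hx⟩, r', h1, h1', fun h => h2 (code_eq_zero.mpr h), h3⟩
      · exact .inr h
    · rintro (⟨x, r', h1, h1', h2, h3⟩ | h)
      · refine ⟨p.2, .inl ⟨x, x.2, ?_, ?_, ?_⟩⟩
        · rw [inputStore_delta, code_eq_succ]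
          exact ⟨r', h1, h1'⟩
        · rw [inputStore_mask]
          exact fun h => h2 (code_eq_zero.mp h)
        · rw [inputStore_mask, h3]
      · exact ⟨p.2, .inr h⟩
  constructor
  · induction w using List.reverseRecOn generalizing q with
    | nil =>
      intro h
      rw [show Tables.sets clo det k q₀ [] = clo q₀ from rfl, T.clo_spec _ (by omega)] at h
      obtain ⟨u, b, h1, h2, h3⟩ := hext q₀ q h [] hq₀
      obtain rfl : b = q := Fin.ext h3
      exact ⟨u, h1, h2⟩
    | append_singleton w a ih =>
      rw [hstep]
      rintro ⟨p, hp, r, hr, h1, h2⟩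
      have hpn := ((T.nfa_iff hD a.2 hr).mp h1).1
      obtain ⟨u, hu, hup⟩ := ih ⟨p, hpn⟩ hp
      have hbase : ∃ u' r', P.word u' = P.word (w ++ [a]) ∧ A.eval u' = some r' ∧ r'.val = r := by
        rcases (hnfa ⟨p, hpn⟩ a r hr).mp h1 with ⟨x, r', h3, h3', h4, h5⟩ | ⟨h3, h4⟩ | ⟨-, h3⟩
        · refine ⟨u ++ [x], r', ?_, ?_, h3'⟩
          · rw [word_append, word_append, hu]
            simp [Mask.word, List.filterMap_cons, h5]
          · rw [PDFA.eval_append_singleton, hup]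
            exact h3
        · refine ⟨u, ⟨p, hpn⟩, ?_, hup, h4.symm⟩
          rw [word_append, hu]
          simp [Mask.word, h3]
        · exfalso
          rcases h2.cases_head with h | ⟨c, h, _⟩
          · have := q.2
            omega
          · have := ((T.epsEdge_iff hD).mp h).1
            omega
      obtain ⟨u', r', h3, h4, rfl⟩ := hbase
      obtain ⟨u'', b, h5, h6, h7⟩ := hext r' q h2 u' h4
      obtain rfl : b = q := Fin.ext h7
      exact ⟨u'', h5.trans h3, h6⟩
  · have main : ∀ l, ∀ (u w : List (Fin k)) (q : Fin n), u.length + w.length ≤ l →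
        P.word u = P.word w → A.eval u = some q → (Tables.sets clo det k q₀ w).testBit q := by
      intro l
      induction l with
      | zero =>
        intro u w q hl _ hq
        obtain rfl : u = [] := List.length_eq_zero_iff.mp (by omega)
        obtain rfl : w = [] := List.length_eq_zero_iff.mp (by omega)
        obtain rfl : q₀ = q := by
          rw [show A.eval [] = A.start from rfl, hq₀] at hq
          simpa using hq
        rw [show Tables.sets clo det k q₀ [] = clo q₀ from rfl, T.clo_spec _ (by omega)]
      | succ l ih =>
        have self : ∀ (u w : List (Fin k)) (a : Fin k) (q : Fin n),
            u.length + (w ++ [a]).length ≤ l + 1 → P.word u = P.word (w ++ [a]) → P a = none →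
            A.eval u = some q → (Tables.sets clo det k q₀ (w ++ [a])).testBit q := by
          intro u w a q hl hw ha hq
          rw [hstep]
          refine ⟨q, ih u w q (by simp at hl; omega) ?_ hq, q, by omega, ?_, .refl⟩
          · rw [hw, word_append]
            simp [Mask.word, ha]
          · exact (hnfa q a q (by omega)).mpr (.inr (.inl ⟨ha, rfl⟩))
        intro u w q hl hw hq
        rcases List.eq_nil_or_concat u with rfl | ⟨u', x, rfl⟩
        · rcases List.eq_nil_or_concat w with rfl | ⟨w', a, rfl⟩
          · exact ih [] [] q (by simp) hw hq
          · rw [List.concat_eq_append] at hl hw ⊢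
            refine self [] w' a q hl hw ?_ hq
            rw [word_append] at hw
            cases h : P a with
            | none => rfl
            | some d => simp [Mask.word, h] at hw
        · rw [List.concat_eq_append] at hl hw hq
          have hq' := hq
          rw [PDFA.eval_append_singleton, Option.bind_eq_some_iff] at hq'
          obtain ⟨p, hp, hpq⟩ := hq'
          cases hx : P x with
          | none =>
            refine hclosed w p q (ih u' w p (by simp at hl; omega) ?_ hp)
              ((hedge p q).mpr ⟨x, hx, q, hpq, rfl⟩)
            rw [← hw, word_append]
            simp [Mask.word, hx]
          | some d =>
            rcases List.eq_nil_or_concat w with rfl | ⟨w', a, rfl⟩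
            · rw [word_append] at hw
              simp [Mask.word, hx] at hw
            · rw [List.concat_eq_append] at hl hw ⊢
              cases ha : P a with
              | none => exact self _ w' a q hl hw ha hq
              | some d' =>
                rw [word_append, word_append] at hw
                have e1 : P.word [x] = [d] := by simp [Mask.word, hx]
                have e2 : P.word [a] = [d'] := by simp [Mask.word, ha]
                rw [e1, e2] at hw
                obtain ⟨h1, h2⟩ := List.append_inj' hw rfl
                have h2 : d = d' := by simpa using h2
                rw [hstep]
                refine ⟨p, ih u' w' p (by simp at hl; omega) h1 hp, q, by omega, ?_, .refl⟩
                exact (hnfa p a q (by omega)).mpr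
                  (.inl ⟨x, q, hpq, rfl, by simp [hx], by rw [ha, hx, h2]⟩)
    exact fun ⟨u, hu, hq⟩ => main _ u w q le_rfl hu hq

/-- No transition of the input automaton enters f, so f can be reached only by a primed transition
in the very last step. Such a transition exists at p exactly when a leads from p to a live state. -/
theorem sets_testBit_top_iff (hq₀ : A.start = some q₀)
    (T : Tables k n ((inputStore A P).mem .delta) ((inputStore A P).mem .mask) (InputLive A P) q₀
      prime nfa eps clo succ det da num N) (w : List (Fin k)) (a : Fin k) :
    (Tables.sets clo det k q₀ (w ++ [a])).testBit n ↔ Enabled P A.marked w a := by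
  have hD := inputStore_delta_le A P
  have hprime : ∀ p : Fin n, prime (p * k + a) ≠ 0 ↔
      ∃ r, A.step p a = some r ∧ InputLive A P r := by
    intro p
    rw [T.prime_iff _ (cell_lt p.2 a.2), inputStore_delta]
    constructor
    · rintro ⟨r, h1, h2⟩
      obtain ⟨r', h3, rfl⟩ := code_eq_succ.mp h1
      exact ⟨r', h3, h2⟩
    · rintro ⟨r, h1, h2⟩
      exact ⟨r, code_eq_succ.mpr ⟨r, h1, rfl⟩, h2⟩
  rw [Tables.sets_append_singleton, T.det_iff (T.sets_lt w) a.2]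
  constructor
  · rintro ⟨p, hp, r, hr, h1, h2⟩
    have hrn : r = n := by
      rcases h2.cases_tail with h | ⟨c, _, h⟩
      · exact h.symm
      · obtain ⟨_, x, hx, h, _⟩ := (T.epsEdge_iff hD).mp h
        have := hD (c * k + x)
        omega
    obtain ⟨hpn, h3⟩ := (T.nfa_iff hD a.2 hr).mp h1
    have hpr : prime (p * k + a) ≠ 0 := by
      rcases h3 with ⟨x, hx, h, _⟩ | ⟨_, h⟩ | ⟨h, _⟩
      · have := hD (p * k + x)
        omega
      · omega
      · exact h
    obtain ⟨u, hu, hup⟩ := (sets_iff hq₀ T w ⟨p, hpn⟩).mp hp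
    obtain ⟨r', h4, h5⟩ := (hprime ⟨p, hpn⟩).mp hpr
    refine ⟨u, hu, (mem_prefixClosure_marked_iff A P _).mpr ⟨r', ?_, h5⟩⟩
    rw [PDFA.eval_append_singleton, hup]
    exact h4
  · rintro ⟨u, hu, hua⟩
    obtain ⟨r, hr, hlive⟩ := (mem_prefixClosure_marked_iff A P _).mp hua
    rw [PDFA.eval_append_singleton, Option.bind_eq_some_iff] at hr
    obtain ⟨p, hp, hr⟩ := hr
    refine ⟨p, (sets_iff hq₀ T w p).mpr ⟨u, hu, hp⟩, n, by omega, ?_, .refl⟩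
    exact (T.nfa_iff hD a.2 (by omega)).mpr
      ⟨p.2, .inr (.inr ⟨(hprime p).mpr ⟨r, hr, hlive⟩, rfl⟩)⟩

/-- Both sides obey the same recursion on the last event: the shorter string belongs, and the event
is justified. -/
theorem good_iff (hq₀ : A.start = some q₀) (hlive : InputLive A P q₀)
    (T : Tables k n ((inputStore A P).mem .delta) ((inputStore A P).mem .mask) (InputLive A P) q₀
      prime nfa eps clo succ det da num N) (w : List (Fin k)) :
    Tables.Good det da k n w ↔ w ∈ infO P A.marked := by
  have hK : ∃ w, w ∈ A.marked := (exists_mem_marked_iff A P).mpr ⟨q₀, hq₀, hlive⟩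
  induction w using List.reverseRecOn with
  | nil => exact ⟨fun _ => nil_mem_infO hK, fun _ => T.good_nil⟩
  | append_singleton w a ih =>
    rw [Tables.good_append_singleton, append_singleton_mem_infO_iff hK]
    refine and_congr ih ?_
    rw [T.states_eq_sets _ (by simp), T.da_iff _ (T.sets_lt _), sets_testBit_top_iff hq₀ T]

end Correct

end Input

/-! ## The complete algorithm -/

section Algorithm

variable {k n m : ℕ}

/-- The memory holds an automaton for the result. -/
def Result (A : PDFA (Fin k) n) (P : Mask (Fin k) (Fin m)) (t : Store Reg Arr) : Prop :=
  ∃ (N : ℕ) (B : PDFA (Fin k) N), 0 < N ∧ IsOutput t B ∧ B.marked = infO P A.marked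

theorem algorithm1_runs {w : ℕ} (room : Room w k n) (hm : m < 2 ^ w) (hn : 0 < n)
    (A : PDFA (Fin k) n) (P : Mask (Fin k) (Fin m)) :
    Runs w (3000 * ((n + 1) * (n + 1) * (n + 1) * ((k + 1) * (k + 1)) + (k + 1) * 2 ^ (n + 1)))
      algorithm1 (inputStore A P) (Result A P) := by
  set s := inputStore A P with hs
  have hD := inputStore_delta_le A P
  have ha := inputStore_acc_le A P
  have hst : s.reg .start ≤ n := code_le A.start
  apply Runs.mono
  · apply Runs.seq (findLive_runs room rfl rfl hD ha)
    intro t fr hl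
    have hnt : t.reg .n = n := fr.reg .n rfl
    have hkt : t.reg .k = k := fr.reg .k rfl
    have hst' : t.reg .start = s.reg .start := fr.reg .start rfl
    have hdt : t.mem .delta = s.mem .delta := fr.mem .delta rfl
    have hat : t.mem .acc = s.mem .acc := fr.mem .acc rfl
    have hmt : t.mem .mask = s.mem .mask := fr.mem .mask rfl
    -- Without an initial state the truncated difference is 0, a valid address because n > 0. The
    -- first factor of the test makes the cell read there irrelevant.
    have hlt := (hl (s.reg .start - 1) (by omega)).1
    have vs : Val w t (rd .start) (s.reg .start) := .var hst' (room.small (by omega))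
    have hle : (if 0 < s.reg .start then 1 else 0) * t.mem .live (s.reg .start - 1) ≤ 1 := by
      split <;> omega
    have ve : Val w t (ltTest 0 (rd .start) * .get .live (rd .start - 1))
        ((if 0 < s.reg .start then 1 else 0) * t.mem .live (s.reg .start - 1)) :=
      (Val.ltTest .zero vs (room.small (by omega))).mul
        (.get (vs.sub room.valOne) rfl (room.small (by omega))) (room.small (by omega))
    have hne : (if 0 < s.reg .start then 1 else 0) * t.mem .live (s.reg .start - 1) ≠ 0 ↔
        ∃ w, w ∈ A.marked := by
      rw [exists_mem_marked_iff A P]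
      change (if 0 < code A.start then 1 else 0) * t.mem .live (code A.start - 1) ≠ 0 ↔ _
      cases A.start with
      | none => simp [code]
      | some q => simpa [code, InputLive] using (hl q q.2).2
    apply Runs.ite (Q := Result A P) ve
    · intro h
      have hK := hne.mp h
      obtain ⟨q₀, hq₀, hlive⟩ := (exists_mem_marked_iff A P).mp hK
      have h_start : s.reg .start - 1 = q₀ := by
        change code A.start - 1 = _
        rw [hq₀]
        rfl
      refine Runs.conseq ?_ (construct_runs (L := InputLive A P) room hkt hnt
        (by omega) (hdt ▸ hD) (fun j => hmt ▸ (inputStore_mask_le A P j).trans_lt hm) hl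
        (fun j => congrFun (fr.mem .prime rfl) j) (fun j => congrFun (fr.mem .nfa rfl) j)
        (fun j => congrFun (fr.mem .eps rfl) j) (fun j => congrFun (fr.mem .succ rfl) j)
        (fun j => congrFun (fr.mem .num rfl) j))
      rintro u - ⟨prime, nfa, eps, clo, succ, det, da, num, T, h1, h2⟩
      rw [hst', hdt, hmt, h_start] at T
      obtain ⟨B, hN, hB, hmem⟩ := T.exists_automaton rfl h1 h2
      exact ⟨_, B, hN, hB, Set.ext fun w => (hmem w).trans (good_iff hq₀ hlive T w)⟩
    · intro h
      have hK : A.marked = 0 := by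
        ext w
        exact ⟨fun hw => hne.mpr ⟨w, hw⟩ h, fun hw => hw.elim⟩
      refine Runs.conseq ?_ (returnInput_runs room hkt hnt (by omega) (hdt ▸ hD) (hat ▸ ha))
      rintro u - ⟨h1, h2, h3, h4⟩
      refine ⟨n, A, hn, ⟨h1, h2.trans hst', fun q => ⟨?_, fun a => ?_⟩⟩, by rw [hK, infO_empty]⟩
      · rw [h3 q q.2, hat]
        exact inputStore_acc A P q
      · rw [h4 _ (cell_lt q.2 a.2), hdt]
        exact inputStore_delta A P q a
  · exact fun _ _ h => h
  · have h1 : (n + 1) * (n + 1) * (k + 1) ≤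
        (n + 1) * (n + 1) * (n + 1) * ((k + 1) * (k + 1)) := by
      gcongr
      · exact Nat.le_mul_of_pos_right _ (by positivity)
      · exact Nat.le_mul_of_pos_right _ (by positivity)
    have h2 : (n + 1) * (k + 1) ≤ (n + 1) * (n + 1) * (k + 1) := by
      gcongr
      exact Nat.le_mul_of_pos_right _ (by positivity)
    have h3 : 0 < (n + 1) * (k + 1) := by positivity
    simp only [Expr.cost_get, Expr.cost_sub, Expr.cost_var, Expr.cost_one, Expr.cost_mul,
      Expr.cost_bin, Expr.cost_zero]
    omega

/-! ### Polynomial factors absorbed by the exponential. -/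

theorem succ_pow_three_le (n : ℕ) : (n + 1) * (n + 1) * (n + 1) ≤ 8 * 2 ^ n := by
  -- At n = 3 there is equality, 64 = 64, and only from there on does the cube grow by a factor of
  -- at most two per step; the smaller values are checked singly.
  have key : ∀ j, (j + 4) * (j + 4) * (j + 4) ≤ 8 * 2 ^ (j + 3) := by
    intro j
    induction j with
    | zero => norm_num
    | succ j ih =>
      rw [show j + 1 + 3 = j + 3 + 1 by ring, Nat.pow_succ]
      nlinarith [Nat.zero_le (j * j), Nat.zero_le (j * (j * j))]
  match n with
  | 0 => norm_num
  | 1 => norm_num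
  | 2 => norm_num
  | j + 3 => exact key j

theorem add_two_sq_le (n : ℕ) : (n + 2) * (n + 2) ≤ 8 * 2 ^ n := by
  induction n with
  | zero => norm_num
  | succ n ih =>
    rw [Nat.pow_succ]
    -- The step from 0 to 1 is separate: the square grows from 4 to 9, more than twofold.
    rcases n with _ | n
    · norm_num
    · nlinarith [Nat.zero_le (n * n)]

theorem Room.of_width (k n c : ℕ) (h : 8 * (k + 1) ≤ c) : Room (n + c) k n := by
  have hc : 8 * (k + 1) < 2 ^ c := h.trans_lt Nat.lt_two_pow_self
  have hn : 0 < 2 ^ n := Nat.two_pow_pos n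
  constructor
  · calc (n + 2) * (n + 2) * (k + 1) ≤ 8 * 2 ^ n * (k + 1) :=
          Nat.mul_le_mul_right _ (add_two_sq_le n)
      _ = 2 ^ n * (8 * (k + 1)) := by ring
      _ < 2 ^ n * 2 ^ c := Nat.mul_lt_mul_of_pos_left hc hn
      _ = 2 ^ (n + c) := (Nat.pow_add 2 n c).symm
  · calc (2 ^ (n + 1) + 2) * (k + 1) ≤ 8 * 2 ^ n * (k + 1) := by
          rw [Nat.pow_succ]
          gcongr
          omega
      _ = 2 ^ n * (8 * (k + 1)) := by ring
      _ < 2 ^ n * 2 ^ c := Nat.mul_lt_mul_of_pos_left hc hn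
      _ = 2 ^ (n + c) := (Nat.pow_add 2 n c).symm

theorem lt_two_pow_width (n m c : ℕ) (h : m ≤ c) : m < 2 ^ (n + c) :=
  (h.trans (Nat.le_add_left c n)).trans_lt Nat.lt_two_pow_self

/-- Machine words of `n + width k m` bits are long enough. -/
def width (k m : ℕ) : ℕ := 8 * (k + 1) + m

theorem algorithm1_runs_width (hn : 0 < n) (A : PDFA (Fin k) n) (P : Mask (Fin k) (Fin m)) :
    Runs (n + width k m) (30000 * ((k + 1) * (k + 1)) * 2 ^ n) algorithm1 (inputStore A P)
      (Result A P) := by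
  refine (algorithm1_runs (.of_width k n _ (Nat.le_add_right _ _))
    (lt_two_pow_width n m _ (Nat.le_add_left _ _)) hn A P).mono (fun _ _ h => h) ?_
  -- The cube contributes at most 8 * 2^n and the sets 2 * 2^n, each with a factor of at most (k +
  -- 1)^2; together this is 3000 * 10.
  have h1 := Nat.mul_le_mul_right ((k + 1) * (k + 1)) (succ_pow_three_le n)
  have h2 : (k + 1) * 2 ^ n ≤ (k + 1) * (k + 1) * 2 ^ n := by
    gcongr
    exact Nat.le_mul_of_pos_right _ (by positivity)
  rw [Nat.pow_succ]
  nlinarith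

end Algorithm

/-! ## The size of the output bounds the running time from below -/

section Time

variable {V M : Type} [DecidableEq V]

theorem Cmd.time_loop_ge [DecidableEq M] (x : V) (e : Expr V M) (c : Cmd V M) (s : Store V M) :
    e.eval s ≤ (Cmd.loop x e c).time s := by
  rw [Cmd.time, Finset.sum_add_distrib]
  simp only [Finset.sum_const, Finset.card_range, smul_eq_mul, mul_one]
  omega

theorem rounds_reg_le {x y : V} (hxy : y ≠ x) {f : Store V M → Store V M}
    (hf : ∀ s, (f s).reg y ≤ s.reg y + 1) (s : Store V M) :
    ∀ N, (rounds x f N s).reg y ≤ s.reg y + N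
  | 0 => le_rfl
  | N + 1 => by
    exact (hf _).trans <| (congrArg (· + 1) (if_neg hxy)).trans_le <|
      Nat.succ_le_succ (rounds_reg_le hxy hf s N)

end Time

theorem returnInput_outN_le_time (s : Store Reg Arr) :
    (returnInput.run s).reg .outN ≤ returnInput.time s := by
  have h : (returnInput.run s).reg .outN = s.reg .n := by
    rw [returnInput, Cmd.run]
    exact (Cmd.frame_run _ _).reg Reg.outN rfl
  rw [h, returnInput, Cmd.time, Cmd.time]
  refine le_trans (le_of_eq ?_) ((Cmd.time_loop_ge _ _ _ _).trans
    ((Nat.le_add_left _ _).trans (Nat.le_add_left _ _)))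
  rfl

/-- The counter starts at 0 and grows by at most one in each round of the numbering loop, every
round costs at least one step, and nothing later changes the counter. -/
theorem supStep_outN_le_time (s : Store Reg Arr) :
    (supStep.run s).reg .outN ≤ supStep.time s := by
  rw [supStep, Cmd.run, Cmd.run, Cmd.run, Cmd.time, Cmd.time]
  refine ((Cmd.frame_run _ _).reg Reg.outN rfl).trans_le ?_
  refine le_trans ?_ ((Cmd.time_loop_ge _ _ _ _).trans
    ((Nat.le_add_right _ _).trans (Nat.le_add_left _ _)))
  rw [Cmd.run]
  refine (rounds_reg_le (by decide) (fun t => ?_) _ _).trans (le_of_eq (Nat.zero_add _))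
  rw [Cmd.run]
  split
  · exact le_rfl
  · exact Nat.le_succ _

theorem construct_outN_le_time (s : Store Reg Arr) :
    (construct.run s).reg .outN ≤ construct.time s := by
  simp only [construct, Cmd.run, Cmd.time]
  refine (supStep_outN_le_time _).trans ?_
  omega

theorem algorithm1_outN_le_time (s : Store Reg Arr) :
    (algorithm1.run s).reg .outN ≤ algorithm1.time s := by
  rw [algorithm1, Cmd.run, Cmd.time]
  refine le_trans ?_ (Nat.le_add_left _ _)
  rw [Cmd.run, Cmd.time]
  refine le_trans ?_ (Nat.le_add_left _ _)
  split
  · exact construct_outN_le_time _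
  · exact returnInput_outN_le_time _

/-- The algorithm needs exponential time, for the automata `Ring.aut k n`, because every
automaton for the result is that large. -/
theorem Ring.two_pow_le_time {k n : ℕ} (hk : 3 ≤ k) (hn : 0 < n) :
    2 ^ n ≤ 2 * algorithm1.time (inputStore (Ring.aut k n) (Ring.mask k)) ∧
      2 ^ n ≤ 2 * stateComplexity (infO (Ring.mask k) (Ring.aut k n).marked) := by
  obtain ⟨N, B, hN, hB, hmarked⟩ := (algorithm1_runs_width hn (Ring.aut k n) (Ring.mask k)).post
  have e : 2 ^ n = 2 * 2 ^ (n - 1) := by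
    rw [← Nat.pow_succ']
    congr 1
    omega
  rw [e]
  refine ⟨Nat.mul_le_mul_left 2 ?_, Nat.mul_le_mul_left 2 ?_⟩
  · exact (Ring.two_pow_le hk hn B hmarked).trans (hB.1 ▸ algorithm1_outN_le_time _)
  · exact le_stateComplexity ⟨N, hN, B, hmarked⟩ fun _ B hB => Ring.two_pow_le hk hn B hB

end InfObs

theorem mainTheorem6 :
    -- correctness, for every input automaton and every mask
    (∀ (k m n : ℕ), 0 < n → ∀ (A : PDFA (Fin k) n) (P : Mask (Fin k) (Fin m)),
      ∃ (N : ℕ) (B : PDFA (Fin k) N), 0 < N ∧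
        IsOutput (algorithm1.run (inputStore A P)) B ∧ B.marked = infO P A.marked) ∧
    -- the words that occur have length `n + O(1)`
    (∀ k m : ℕ, ∃ c : ℕ, ∀ n : ℕ, 0 < n →
      ∀ (A : PDFA (Fin k) n) (P : Mask (Fin k) (Fin m)),
        algorithm1.Fits (n + c) (inputStore A P)) ∧
    -- upper bound on the running time
    (∀ k : ℕ, ∃ C : ℕ, ∀ n : ℕ, 0 < n →
      ∀ (m : ℕ) (A : PDFA (Fin k) n) (P : Mask (Fin k) (Fin m)),
        algorithm1.time (inputStore A P) ≤ C * 2 ^ n) ∧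
    -- lower bound on the worst-case running time, and already on the size of any possible output
    (∀ k : ℕ, 3 ≤ k → ∃ C : ℕ, ∀ n : ℕ, 0 < n →
      ∃ (m : ℕ) (A : PDFA (Fin k) n) (P : Mask (Fin k) (Fin m)),
        stateComplexity A.marked = n ∧
        2 ^ n ≤ C * algorithm1.time (inputStore A P) ∧
        2 ^ n ≤ C * stateComplexity (infO P A.marked)) := by
  refine ⟨fun k m n hn A P => (algorithm1_runs_width hn A P).post,
    fun k m => ⟨width k m, fun n hn A P => (algorithm1_runs_width hn A P).fits⟩,
    fun k => ⟨30000 * ((k + 1) * (k + 1)), fun n hn m A P =>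
      (algorithm1_runs_width hn A P).time_le⟩,
    fun k hk => ⟨2, fun n hn => ⟨k, Ring.aut k n, Ring.mask k, Ring.stateComplexity_marked hk hn,
      Ring.two_pow_le_time hk hn⟩⟩⟩
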